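/- Let $\beta>\pi$, put $\nu_\beta=\frac{\pi}{2\beta-\pi}$ and fix $h$ with $\frac{\nu_\beta}{2}<h<\min\left(\frac12,\frac{3\nu_\beta}{2}\right)$. Let $$D'_\beta=\left\{(z_1,z_2)\in\mathbb C^2: z_2\neq0,\ \left|\operatorname{Im}z_1-\log|z_2|^2\right|<\tfrac{\pi}{2},\ \left|\log|z_2|^2\right|<\beta-\tfrac{\pi}{2}\right\}.$$ For $F$ holomorphic in $D'_\beta$ and $(t,s)\in[0,\frac\pi2)\times[0,\beta-\frac\pi2)$ let $$\mathcal L_2F(t,s)=\sum_{(y,u)}\int_{\mathbb R}\int_0^1\left|F\left(x+iy,e^{u/2}e^{2\pi i\theta}\right)\right|^2d\theta\,dx,$$ where $(y,u)$ runs over the four pairs $(s+t,s)$, $(-(s+t),-s)$, $(s-t,s)$, $(-(s-t),-s)$, and let $H^2(D'_\beta)$ be the space of all $F$ holomorphic in $D'_\beta$ with $\sup_{(t,s)}\mathcal L_2F(t,s)<\infty$. The boundary value function $\widetilde F$ of $F\in H^2(D'_\beta)$ is the $L^2$-limit, as $(t,s)\to(\frac\pi2,\beta-\frac\pi2)$ from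 inside, of the restrictions of $F$ to these four families. It lives on the distinguished boundary, which consists of the four corresponding components, each parametrized by $(x,\theta)\in\mathbb R\times[0,1]$ and carrying the measure $dx\,d\theta$. The inner product is $\langle F,G\rangle=\langle\widetilde F,\widetilde G\rangle_{L^2}$. The space $H^2(D'_\beta)$ has a reproducing kernel $K_{D'_\beta}$, its Szegő kernel: $K_{D'_\beta}(\cdot,z)\in H^2(D'_\beta)$ and $F(z)=\langle F,K_{D'_\beta}(\cdot,z)\rangle$ for all $z\in D'_\beta$ and $F\in H^2(D'_\beta)$. Write $\tau=w_1-\overline{z_1}$. For each choice of sign $\varepsilon\in\{1,-1\}$ there exist an open neighbourhood $U$ of $\overline{D'_\beta}$ and functions $\rho_1,\rho_2,G_1,\dots,G_8,E,\widetilde E$ on $U\times U$, holomorphic in $w$ and anti-holomorphic in $z$ for $w,z\in U$, which remain bounded, together with all their derivatives, for $w,z\in\overline{D'_\beta}$ as $|\operatorname{Re}\tau|\to+\infty$, such that for all $w,z\in D'_\beta$ with $\varepsilon\operatorname{Re}\tau\ge0$ $$K_{D'_\beta}(w,z)=e^{-\varepsilon\tau\nu_\beta/2}K(w,z)+e^{-\varepsilon\tau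 h}\widetilde K(w,z),$$ where $$K(w,z)=\frac{\rho_1(w,z)}{e^{\frac{\pi-i\tau}{2}}-w_2\overline{z_2}}+\frac{\rho_2(w,z)}{e^{-\frac{i\tau+\pi}{2}}-w_2\overline{z_2}}+E(w,z)$$ and $$\begin{aligned}\widetilde K(w,z)={}&\frac{G_1(w,z)}{[i\tau+2\beta][e^{\beta-\frac\pi2}-w_2\overline{z_2}]}+\frac{G_2(w,z)}{[e^{-\frac{i\tau+\pi}{2}}-w_2\overline{z_2}][i\tau+2\beta]}+\frac{G_3(w,z)}{[e^{\frac{\pi-i\tau}{2}}-w_2\overline{z_2}][e^{\beta-\frac\pi2}-w_2\overline{z_2}]}\\&+\frac{G_4(w,z)}{[e^{\frac{\pi-i\tau}{2}}-w_2\overline{z_2}][i\tau-2\beta]}+\frac{G_5(w,z)}{[i\tau-2\beta][e^{-(\beta-\frac\pi2)}-w_2\overline{z_2}]}+\frac{G_6(w,z)}{[e^{-\frac{i\tau+\pi}{2}}-w_2\overline{z_2}][e^{-(\beta-\frac\pi2)}-w_2\overline{z_2}]}\\&+\frac{G_7(w,z)}{e^{\frac{\pi-i\tau}{2}}-w_2\overline{z_2}}+\frac{G_8(w,z)}{e^{-\frac{i\tau+\pi}{2}}-w_2\overline{z_2}}+\widetilde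 E(w,z).\end{aligned}$$ -/

import Mathlib

open MeasureTheory Filter Topology
open scoped ComplexConjugate ENNReal

noncomputable section

namespace Worm

/-- The non-smooth worm domain `D'_β` in `ℂ²`. The condition `z₂ ≠ 0` is implicit in the use of
`log |z₂|²` (in Lean `Real.log 0 = 0`, so it has to be said). -/
def domain (β : ℝ) : Set (ℂ × ℂ) :=
  {z | z.2 ≠ 0 ∧ |z.1.im - Real.log (‖z.2‖ ^ 2)| < Real.pi / 2 ∧
    |Real.log (‖z.2‖ ^ 2)| < β - Real.pi / 2}

/-- The point `(x + i y, e^{u/2} e^{2πiθ})`, where `p = (x, θ)`. -/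
def point (y u : ℝ) (p : ℝ × ℝ) : ℂ × ℂ :=
  ((p.1 : ℂ) + (y : ℂ) * Complex.I,
    (Real.exp (u / 2) : ℂ) * Complex.exp (2 * (Real.pi : ℂ) * Complex.I * (p.2 : ℂ)))

/-- The four copies of `ℝ × [0,1]` inside `D'_β` with parameters `(t, s)`. For `t = π/2` and
`s = β - π/2` they parametrize, in this order, the components
`Im z₁ = β, log|z₂|² = β - π/2`; `Im z₁ = -β, log|z₂|² = -(β - π/2)`;
`Im z₁ = β - π, log|z₂|² = β - π/2`; `Im z₁ = -(β - π), log|z₂|² = -(β - π/2)`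
of the distinguished boundary. -/
def slice (k : Fin 4) (t s : ℝ) : ℝ × ℝ → ℂ × ℂ :=
  ![point (s + t) s, point (-(s + t)) (-s), point (s - t) s, point (-(s - t)) (-s)] k

/-- The measure `dx dθ` on `ℝ × [0,1]`. -/
def stripMeasure : Measure (ℝ × ℝ) :=
  (volume : Measure ℝ).prod ((volume : Measure ℝ).restrict (Set.Icc 0 1))

/-- The sum `ℒ₂F(t,s)` of the four integrals of `|F|²`, with values in `[0,∞]`. -/
def sliceIntegral (F : ℂ × ℂ → ℂ) (t s : ℝ) : ℝ≥0∞ :=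
  ∑ k : Fin 4, ∫⁻ p, ‖F (slice k t s p)‖ₑ ^ 2 ∂stripMeasure

/-- The square of the Hardy norm, with values in `[0,∞]`. -/
def hardyNormSq (β : ℝ) (F : ℂ × ℂ → ℂ) : ℝ≥0∞ :=
  ⨆ t ∈ Set.Ico (0 : ℝ) (Real.pi / 2), ⨆ s ∈ Set.Ico (0 : ℝ) (β - Real.pi / 2),
    sliceIntegral F t s

/-- Membership in the Hardy space `H²(D'_β)`. Values of `F` outside `D'_β` play no role. -/
def MemHardy (β : ℝ) (F : ℂ × ℂ → ℂ) : Prop :=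
  DifferentiableOn ℂ F (domain β) ∧ hardyNormSq β F < ⊤

/-- `B` is the boundary value function of `F` on the distinguished boundary, whose four components
are each parametrized by `ℝ × [0,1]`: the restrictions of `F` to the slices converge to `B` in `L²`
as `(t, s)` tends to `(π/2, β - π/2)` from inside. -/
def IsBoundaryValue (β : ℝ) (F : ℂ × ℂ → ℂ) (B : Fin 4 → ℝ × ℝ → ℂ) : Prop :=
  ∀ k, MemLp (B k) 2 stripMeasure ∧
    Tendsto (fun q : ℝ × ℝ => eLpNorm (fun p => F (slice k q.1 q.2 p) - B k p) 2 stripMeasure)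
      (𝓝[<] (Real.pi / 2) ×ˢ 𝓝[<] (β - Real.pi / 2)) (𝓝 0)

/-- The inner product of `L²` of the distinguished boundary. -/
def boundaryInner (A B : Fin 4 → ℝ × ℝ → ℂ) : ℂ :=
  ∑ k : Fin 4, ∫ p, A k p * conj (B k p) ∂stripMeasure

/-- `K` is the Szegő kernel of `D'_β`, i.e. the reproducing kernel of `H²(D'_β)`: every `K(·, z)`
lies in `H²(D'_β)`, and `F(z) = ⟨F, K(·, z)⟩` for every `F` in `H²(D'_β)`, where the inner product
is that of the boundary value functions. -/
def IsSzegoKernel (β : ℝ) (K : ℂ × ℂ → ℂ × ℂ → ℂ) : Prop :=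
  ∀ z ∈ domain β, MemHardy β (fun w => K w z) ∧
    ∀ F, MemHardy β F → ∃ A B, IsBoundaryValue β F A ∧ IsBoundaryValue β (fun w => K w z) B ∧
      F z = boundaryInner A B

/-- Complex conjugation on `ℂ²`. -/
def conjPair (z : ℂ × ℂ) : ℂ × ℂ := (conj z.1, conj z.2)

/-- The function `(w, ζ) ↦ f(w, conj ζ)`. It is holomorphic exactly where `f(w, z)` is holomorphic
in `w` and anti-holomorphic in `z`, and its derivatives are those of `f` in `w` and `conj z`. -/
def polarized (f : ℂ × ℂ → ℂ × ℂ → ℂ) (p : (ℂ × ℂ) × (ℂ × ℂ)) : ℂ := f p.1 (conjPair p.2)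

/-- `f(w, z)` is holomorphic in `w` and anti-holomorphic in `z` for `w, z ∈ U`. -/
def HolAntihol (U : Set (ℂ × ℂ)) (f : ℂ × ℂ → ℂ × ℂ → ℂ) : Prop :=
  DifferentiableOn ℂ (polarized f) {p | p.1 ∈ U ∧ conjPair p.2 ∈ U}

/-- `f` and all its derivatives (of every order `n`, in `w` and `conj z`) remain bounded for
`w, z` in the closure of `D'_β` as `|Re (w₁ - conj z₁)| → ∞`. -/
def BoundedAtInfinity (β : ℝ) (f : ℂ × ℂ → ℂ × ℂ → ℂ) : Prop :=
  ∀ n : ℕ, ∃ C R : ℝ, ∀ w ∈ closure (domain β), ∀ z ∈ closure (domain β),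
    R ≤ |(w.1 - conj z.1).re| → ‖iteratedFDeriv ℂ n (polarized f) (w, conjPair z)‖ ≤ C

/-- `τ = w₁ - conj z₁`. -/
def tau (w z : ℂ × ℂ) : ℂ := w.1 - conj z.1

/-- `e^{(π - iτ)/2} - w₂ conj z₂`. -/
def denP (w z : ℂ × ℂ) : ℂ :=
  Complex.exp (((Real.pi : ℂ) - Complex.I * tau w z) / 2) - w.2 * conj z.2

/-- `e^{-(iτ + π)/2} - w₂ conj z₂`. -/
def denQ (w z : ℂ × ℂ) : ℂ :=
  Complex.exp (-((Complex.I * tau w z + (Real.pi : ℂ)) / 2)) - w.2 * conj z.2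

/-- `e^a - w₂ conj z₂`, used for `a = ±(β - π/2)`. -/
def denExp (a : ℝ) (w z : ℂ × ℂ) : ℂ := (Real.exp a : ℂ) - w.2 * conj z.2

/-- `iτ + b`, used for `b = ±2β`. -/
def denLin (b : ℝ) (w z : ℂ × ℂ) : ℂ := Complex.I * tau w z + (b : ℂ)

end Worm

end

namespace Worm

/-! ### Holomorphic functions of several variables -/

section SeveralVariables

/-! The domain is invariant under real translations of `z₁` and rotations of `z₂`, so Fourier
analysis on `ℝ × ℝ/ℤ` decomposes every Hardy function into modes `z₂ʲ e^{2πiηz₁}`. On the four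
slices with parameters `(t, s)` the squared moduli of a mode add up to `4 cosh(4πηt) cosh((4πη -
j)s)`. Hence the Hardy space is a weighted `L²` space over `ℤ × ℝ` (`MemHardy.exists_modes`,
`IsHardyModes.exists_boundaryValue`), and its reproducing kernel is the superposition of products of
modes divided by the weight at the distinguished boundary (`isSzegoKernel_szegoKernel`,
`IsSzegoKernel.eq_szegoKernel`). With `b = β - π/2`, `ξ = 2πη`, `μ = w₂ conj z₂` this reads
(`szegoKernel_eq_coneSum`) `K = (8π)⁻¹ ∑ⱼ μʲ ∫ e^{iξτ} / (cosh(πξ) cosh(b(2ξ - j))) dξ`.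

For `ε = 1` the line of integration is raised to `Im ξ = h`. Since `2bν = π`, the second factor has
poles at `j/2 + iν/2`, `j/2 + 3iν/2`, ..., and the first one at `i/2`, ...; the conditions on `h`
say that exactly the first of these is crossed (`integral_coeffIntegrand_shift`). The residues carry
`e^{-τν/2}` and form a two-sided series in `λ = μ e^{iτ/2}`. Each half is a geometric series plus a
remainder converging on a larger region, and the two geometric series produce the two simple poles
of the leading term (`exists_hasSum_poleSeries`).

The integral on the new line carries `e^{-τh}`. The dual group is cut into four cones by the signs
of `ξ` and `2ξ - j`. In each cone both reciprocals of `cosh` are a multiple of `e^{-kx}` plus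
`O(e^{-3kx})`, with `k = π` and `k = b`. Remainder times remainder converges on a larger region;
leading times remainder is a geometric series along one edge of the cone; leading times leading is
computed explicitly. This produces the singular factors `G₁` to `G₈` (`hasForm_coneTerm`,
`hasForm_coneSum`). The case `ε = -1` follows from the symmetry `(τ, μ) ↦ (-τ, μ⁻¹)`
(`exists_kernel_form`).

All coefficients are bounded holomorphic functions of `(τ, μ)` on a region exceeding the one needed
by a fixed margin, so Cauchy estimates on balls of a fixed radius bound all derivatives up to the
closure (`IsGood.boundedAtInfinity`). -/

theorem norm_fderiv_le_of_norm_le_on_ball {E F : Type*} [NormedAddCommGroup E] [NormedSpace ℂ E]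
    [NormedAddCommGroup F] [NormedSpace ℂ F] {f : E → F} {c : E} {R C : ℝ} (hR : 0 < R)
    (hf : DifferentiableOn ℂ f (Metric.ball c R)) (hC : ∀ z ∈ Metric.ball c R, ‖f z‖ ≤ C) :
    ‖fderiv ℂ f c‖ ≤ 2 * C / R := by
  refine Complex.norm_fderiv_le_div_of_mapsTo_ball hf (fun z hz => ?_) hR
  rw [mem_closedBall_iff_norm]
  have h1 := hC z hz
  have h2 := hC c (Metric.mem_ball_self hR)
  linarith [norm_sub_le (f z) (f c)]

/-- Reduces measurability and holomorphy of operator-valued functions to that of their values on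
finitely many basis vectors. -/
theorem clm_eq_sum_smulRight {E F : Type*} [NormedAddCommGroup E] [NormedSpace ℂ E]
    [FiniteDimensional ℂ E] [NormedAddCommGroup F] [NormedSpace ℂ F] (L : E →L[ℂ] F) :
    L = ∑ i, ContinuousLinearMap.smulRightL ℂ E F
      (LinearMap.toContinuousLinearMap ((Module.finBasis ℂ E).coord i))
      (L (Module.finBasis ℂ E i)) := by
  ext v
  have h1 : L v = ∑ i, (Module.finBasis ℂ E).repr v i • L (Module.finBasis ℂ E i) := by
    conv_lhs => rw [← (Module.finBasis ℂ E).sum_repr v]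
    rw [map_sum]
    exact Finset.sum_congr rfl fun i _ => map_smul _ _ _
  simp [h1]

theorem aestronglyMeasurable_clm_of_apply {X E F : Type*} [MeasurableSpace X] {μ : Measure X}
    [NormedAddCommGroup E] [NormedSpace ℂ E] [FiniteDimensional ℂ E]
    [NormedAddCommGroup F] [NormedSpace ℂ F] {L : X → E →L[ℂ] F}
    (hL : ∀ v, AEStronglyMeasurable (fun x => L x v) μ) : AEStronglyMeasurable L μ := by
  rw [funext fun x => clm_eq_sum_smulRight (L x)]
  refine Finset.aestronglyMeasurable_fun_sum _ (fun i _ => ?_)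
  exact (ContinuousLinearMap.continuous _).comp_aestronglyMeasurable (hL _)

/-- An integral depending on a parameter is holomorphic as soon as the integrand is holomorphic in
the parameter and dominated by an integrable function. -/
theorem differentiableOn_integral_of_dominated {X E F : Type*} [MeasurableSpace X] {μ : Measure X}
    [NormedAddCommGroup E] [NormedSpace ℂ E] [FiniteDimensional ℂ E]
    [NormedAddCommGroup F] [NormedSpace ℂ F] {f : E → X → F} {Ω : Set E} (hΩ : IsOpen Ω)
    {g : X → ℝ} (hg : Integrable g μ) (hm : ∀ p ∈ Ω, AEStronglyMeasurable (f p) μ)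
    (hd : ∀ x, DifferentiableOn ℂ (fun p => f p x) Ω) (hb : ∀ p ∈ Ω, ∀ x, ‖f p x‖ ≤ g x) :
    DifferentiableOn ℂ (fun p => ∫ x, f p x ∂μ) Ω := by
  intro p hp
  obtain ⟨r, hr, hrΩ⟩ := Metric.isOpen_iff.1 hΩ p hp
  have hsub : ∀ q ∈ Metric.ball p (r / 2), Metric.ball q (r / 2) ⊆ Ω := fun q hq =>
    (Metric.ball_subset_ball' (by rw [Metric.mem_ball] at hq; linarith)).trans hrΩ
  have hdiff : ∀ q ∈ Metric.ball p (r / 2), ∀ x,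
      HasFDerivAt (fun p => f p x) (fderiv ℂ (fun p => f p x) q) q := fun q hq x =>
    ((hd x).differentiableAt (hΩ.mem_nhds (hsub q hq (Metric.mem_ball_self (by positivity))))).hasFDerivAt
  have hp2 : p ∈ Metric.ball p (r / 2) := Metric.mem_ball_self (by positivity)
  -- Each directional derivative is a pointwise limit of the difference quotients with increment
  -- `v/n`, which are measurable in `x`.
  have meas : AEStronglyMeasurable (fun x => fderiv ℂ (fun p => f p x) p) μ := by
    refine aestronglyMeasurable_clm_of_apply (fun v => ?_)
    have hev : ∀ᶠ n : ℕ in atTop, p + ((n : ℂ))⁻¹ • v ∈ Ω := by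
      have : Tendsto (fun n : ℕ => p + ((n : ℂ))⁻¹ • v) atTop (𝓝 p) := by
        have h0 : Tendsto (fun n : ℕ => ((n : ℂ))⁻¹) atTop (𝓝 0) :=
          tendsto_inv_atTop_nhds_zero_nat
        simpa using tendsto_const_nhds.add (h0.smul_const v)
      exact this.eventually (hΩ.mem_nhds hp)
    obtain ⟨N, hN⟩ := eventually_atTop.1 hev
    refine aestronglyMeasurable_of_tendsto_ae atTop
      (f := fun (n : ℕ) x => ((n + N : ℕ) : ℂ) • (f (p + (((n + N : ℕ) : ℂ))⁻¹ • v) x - f p x))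
      (fun n => ((hm _ (hN _ (by omega))).sub (hm p hp)).const_smul _) (ae_of_all _ fun x => ?_)
    have hc : Tendsto (fun n : ℕ => ‖((n + N : ℕ) : ℂ)‖) atTop atTop := by
      simp only [Complex.norm_natCast]
      exact tendsto_natCast_atTop_atTop.comp (tendsto_add_atTop_nat N)
    exact (hdiff p hp2 x).lim v hc
  have := hasFDerivAt_integral_of_dominated_of_fderiv_le (𝕜 := ℂ) (μ := μ) (F := f) (x₀ := p)
    (F' := fun q x => fderiv ℂ (fun p => f p x) q) (bound := fun x => 2 * g x / (r / 2))
    (Metric.ball_mem_nhds p (half_pos hr))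
    (by filter_upwards [hΩ.mem_nhds hp] with q hq using hm q hq)
    (hg.mono' (hm p hp) (ae_of_all _ (hb p hp))) meas
    (ae_of_all _ fun x q hq => norm_fderiv_le_of_norm_le_on_ball (half_pos hr)
      ((hd x).mono (hsub q hq)) (fun z hz => hb z (hsub q hq hz) x))
    ((hg.const_mul 2).div_const _) (ae_of_all _ fun x q hq => hdiff q hq x)
  exact this.differentiableAt.differentiableWithinAt

/-- Cauchy's formula on the complex line through `q` in direction `v` writes the directional
derivative as a circle integral of values of `f`, and such an integral is holomorphic in `q` by
dominated differentiation. -/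
theorem differentiableOn_fderiv {E F : Type*} [NormedAddCommGroup E] [NormedSpace ℂ E]
    [FiniteDimensional ℂ E] [NormedAddCommGroup F] [NormedSpace ℂ F] [CompleteSpace F]
    {f : E → F} {Ω : Set E} (hΩ : IsOpen Ω) (hf : DifferentiableOn ℂ f Ω) :
    DifferentiableOn ℂ (fderiv ℂ f) Ω := by
  intro p hp
  have hΩp : ∀ᶠ q in 𝓝 p, q ∈ Ω := hΩ.mem_nhds hp
  have hev : ∀ᶠ q in 𝓝 p, q ∈ Ω ∧ ‖f q‖ ≤ ‖f p‖ + 1 :=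
    hΩp.and
      ((((hf.continuousOn.continuousAt (hΩ.mem_nhds hp)).norm).eventually
        (gt_mem_nhds (lt_add_one ‖f p‖))).mono fun q hq => hq.le)
  obtain ⟨r, hr, hball⟩ := Metric.eventually_nhds_iff_ball.1 hev
  have hdir : ∀ v : E, DifferentiableOn ℂ (fun q => fderiv ℂ f q v) (Metric.ball p (r / 2)) := by
    intro v
    -- The discs `q + t v`, `‖t‖ ≤ R`, stay in the ball where `f` is bounded, for every `q` in the
    -- half ball.
    obtain ⟨R, hR, hRv⟩ : ∃ R : ℝ, 0 < R ∧ R * ‖v‖ < r / 2 := by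
      refine ⟨r / 2 / (‖v‖ + 1), by positivity, ?_⟩
      rw [div_mul_eq_mul_div, div_lt_iff₀ (by positivity)]
      nlinarith [norm_nonneg v]
    have hmem : ∀ q ∈ Metric.ball p (r / 2), ∀ t : ℂ, ‖t‖ ≤ R → q + t • v ∈ Metric.ball p r := by
      intro q hq t ht
      rw [mem_ball_iff_norm] at hq ⊢
      calc ‖q + t • v - p‖ = ‖(q - p) + t • v‖ := by congr 1; abel
        _ ≤ ‖q - p‖ + ‖t‖ * ‖v‖ := by rw [← norm_smul]; exact norm_add_le _ _
        _ ≤ ‖q - p‖ + R * ‖v‖ := by gcongr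
        _ < r := by linarith
    have hline : ∀ q : E, Differentiable ℂ fun t : ℂ => q + t • v := fun q => by fun_prop
    have hfo : DifferentiableOn ℂ f (Metric.ball p r) := hf.mono fun q hq => (hball q hq).1
    have hcauchy : ∀ q ∈ Metric.ball p (r / 2), fderiv ℂ f q v =
        (2 * (Real.pi : ℂ) * Complex.I)⁻¹ • ∮ t in C(0, R), ((t - 0) ^ 2)⁻¹ • f (q + t • v) := by
      intro q hq
      have hU : IsOpen ((fun t : ℂ => q + t • v) ⁻¹' Metric.ball p r) :=
        Metric.isOpen_ball.preimage (hline q).continuous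
      rw [Complex.two_pi_I_inv_smul_circleIntegral_sub_sq_inv_smul_of_differentiable hU
        (f := fun t => f (q + t • v)) (fun t ht => hmem q hq t (by simpa using ht))
        (hfo.comp (hline q).differentiableOn fun t ht => ht) (Metric.mem_ball_self hR)]
      have hq' : q ∈ Metric.ball p r := Metric.ball_subset_ball (by linarith) hq
      have h1 : HasFDerivAt f (fderiv ℂ f q) (q + (0 : ℂ) • v) := by
        simpa using (hfo.differentiableAt (Metric.isOpen_ball.mem_nhds hq')).hasFDerivAt
      have h2 : HasDerivAt (fun t : ℂ => q + t • v) v 0 := by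
        simpa using ((hasDerivAt_id (0 : ℂ)).smul_const v).const_add q
      exact ((h1.comp_hasDerivAt 0 h2).deriv).symm
    refine DifferentiableOn.congr ?_ hcauchy
    refine DifferentiableOn.const_smul ?_ _
    simp only [circleIntegral, intervalIntegral.integral_of_le Real.two_pi_pos.le]
    have hsph : ∀ θ : ℝ, ‖circleMap 0 R θ‖ = R := fun θ => by simp [abs_of_pos hR]
    refine differentiableOn_integral_of_dominated Metric.isOpen_ball
      (g := fun _ => R * ((R ^ 2)⁻¹ * (‖f p‖ + 1))) (integrable_const _) ?_ ?_ ?_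
    · intro q hq
      refine Continuous.aestronglyMeasurable ?_
      have hc : Continuous fun θ : ℝ => f (q + circleMap 0 R θ • v) :=
        hfo.continuousOn.comp_continuous (by fun_prop) fun θ => hmem q hq _ (hsph θ).le
      have hne : ∀ θ : ℝ, (circleMap 0 R θ - 0) ^ 2 ≠ 0 := fun θ => by simp [hR.ne']
      simp only [deriv_circleMap]
      exact Continuous.smul (by fun_prop) (Continuous.smul (Continuous.inv₀ (by fun_prop) hne) hc)
    · intro θ
      refine DifferentiableOn.const_smul (DifferentiableOn.const_smul ?_ _) _
      exact hfo.comp (f := fun q => q + circleMap 0 R θ • v) (by fun_prop)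
        fun q hq => hmem q hq _ (hsph θ).le
    · intro q hq θ
      rw [norm_smul, norm_smul]
      have h3 := (hball _ (hmem q hq _ (hsph θ).le)).2
      have h4 : ‖deriv (circleMap 0 R) θ‖ = R := by simp [abs_of_pos hR]
      have h5 : ‖((circleMap 0 R θ - 0) ^ 2)⁻¹‖ = (R ^ 2)⁻¹ := by
        rw [sub_zero, norm_inv, norm_pow, hsph]
      rw [h4, h5]
      gcongr
  have hD : DifferentiableOn ℂ (fderiv ℂ f) (Metric.ball p (r / 2)) := by
    rw [funext fun q => clm_eq_sum_smulRight (fderiv ℂ f q)]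
    refine DifferentiableOn.fun_sum fun i _ => ?_
    exact (ContinuousLinearMap.differentiable _).comp_differentiableOn (hdir _)
  exact (hD.differentiableAt (Metric.ball_mem_nhds p (half_pos hr))).differentiableWithinAt

/-- Cauchy estimates, halving the radius for each derivative. The bound is chosen before the target
space because the inductive step passes to `fderiv ℂ f`, and before `f` and `p` because it must be
uniform over the closed worm domain. -/
theorem exists_bound_iteratedFDeriv {E : Type} [NormedAddCommGroup E] [NormedSpace ℂ E]
    [FiniteDimensional ℂ E] (n : ℕ) : ∀ {r : ℝ}, 0 < r → ∀ C : ℝ, ∃ C' : ℝ,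
    ∀ {F : Type} [NormedAddCommGroup F] [NormedSpace ℂ F] [CompleteSpace F] (f : E → F) (p : E),
      DifferentiableOn ℂ f (Metric.ball p r) → (∀ q ∈ Metric.ball p r, ‖f q‖ ≤ C) →
        ‖iteratedFDeriv ℂ n f p‖ ≤ C' := by
  induction n with
  | zero =>
    intro r hr C
    refine ⟨C, fun f p _ hC => ?_⟩
    rw [norm_iteratedFDeriv_zero]
    exact hC p (Metric.mem_ball_self hr)
  | succ n ih =>
    intro r hr C
    obtain ⟨C', hC'⟩ := ih (half_pos hr) (2 * C / (r / 2))
    refine ⟨C', fun {F} _ _ _ f p hf hC => ?_⟩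
    rw [← norm_iteratedFDeriv_fderiv]
    refine hC' (fderiv ℂ f) p ?_ fun q hq => ?_
    · exact (differentiableOn_fderiv Metric.isOpen_ball hf).mono
        (Metric.ball_subset_ball (by linarith))
    · have hsub : Metric.ball q (r / 2) ⊆ Metric.ball p r :=
        Metric.ball_subset_ball' (by rw [Metric.mem_ball] at hq; linarith)
      exact norm_fderiv_le_of_norm_le_on_ball (half_pos hr) (hf.mono hsub)
        fun z hz => hC z (hsub hz)

end SeveralVariables

/-! ### Shifting a horizontal line of integration -/

/-- No pointwise decay is needed. By Fubini the integrals over the vertical sides at abscissas `±R`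
are integrable in `R`, and by Cauchy's theorem they bound the difference of the truncated integrals.
A nonzero limit of that difference would make a positive constant integrable on a half-line. -/
theorem integral_horizontal_line_eq {H : ℂ → ℂ} {y₁ y₂ : ℝ}
    (hH : DifferentiableOn ℂ H {z | z.im ∈ Set.uIcc y₁ y₂})
    (h₁ : Integrable fun x : ℝ => H (x + y₁ * Complex.I))
    (h₂ : Integrable fun x : ℝ => H (x + y₂ * Complex.I))
    (h₁₂ : Integrable (fun p : ℝ × ℝ => H (p.1 + p.2 * Complex.I))
      ((volume : Measure ℝ).prod ((volume : Measure ℝ).restrict (Set.uIoc y₁ y₂)))) :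
    ∫ x : ℝ, H (x + y₁ * Complex.I) = ∫ x : ℝ, H (x + y₂ * Complex.I) := by
  set v : ℝ → ℝ := fun x => ∫ y in Set.uIoc y₁ y₂, ‖H (x + y * Complex.I)‖ with hv
  have hvint : Integrable v := h₁₂.norm.integral_prod_left
  have hvneg : Integrable fun x => v (-x) := hvint.comp_neg
  set c := ‖(∫ x : ℝ, H (x + y₁ * Complex.I)) - ∫ x : ℝ, H (x + y₂ * Complex.I)‖ with hc
  have bound : ∀ R : ℝ, ‖(∫ x in (-R)..R, H (x + y₁ * Complex.I)) -
      ∫ x in (-R)..R, H (x + y₂ * Complex.I)‖ ≤ v R + v (-R) := by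
    intro R
    have key := Complex.integral_boundary_rect_eq_zero_of_differentiableOn H
      ⟨-R, y₁⟩ ⟨R, y₂⟩ (hH.mono fun z hz => hz.2)
    simp only at key
    have e : (∫ x in (-R)..R, H (x + y₁ * Complex.I)) -
        (∫ x in (-R)..R, H (x + y₂ * Complex.I)) =
        Complex.I • (∫ y in y₁..y₂, H (((-R : ℝ) : ℂ) + y * Complex.I)) -
        Complex.I • (∫ y in y₁..y₂, H ((R : ℂ) + y * Complex.I)) := by
      linear_combination key
    rw [e]
    refine (norm_sub_le _ _).trans ?_
    rw [norm_smul, norm_smul, Complex.norm_I, one_mul, one_mul, add_comm]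
    exact add_le_add (intervalIntegral.norm_integral_le_integral_norm_uIoc)
      (intervalIntegral.norm_integral_le_integral_norm_uIoc)
  have hlim : Tendsto (fun R : ℝ => ‖(∫ x in (-R)..R, H (x + y₁ * Complex.I)) -
      ∫ x in (-R)..R, H (x + y₂ * Complex.I)‖) atTop (𝓝 c) :=
    ((intervalIntegral_tendsto_integral h₁ tendsto_neg_atTop_atBot tendsto_id).sub
      (intervalIntegral_tendsto_integral h₂ tendsto_neg_atTop_atBot tendsto_id)).norm
  by_contra hne
  have hcpos : 0 < c := norm_pos_iff.2 (sub_ne_zero.2 hne)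
  obtain ⟨R₀, hR₀⟩ := eventually_atTop.1 (hlim.eventually (lt_mem_nhds (half_lt_self hcpos)))
  have hint : IntegrableOn (fun _ : ℝ => c / 2) (Set.Ici R₀) := by
    refine Integrable.mono' (hvint.add hvneg).integrableOn aestronglyMeasurable_const ?_
    refine (ae_restrict_iff' measurableSet_Ici).2 (ae_of_all _ fun R hR => ?_)
    rw [Real.norm_of_nonneg (by positivity)]
    exact (hR₀ R hR).le.trans (bound R)
  rw [integrableOn_const_iff] at hint
  simp at hint
  linarith

end Worm

namespace Worm

/-! ### The Fourier transform on the line -/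

section Fourier

open FourierTransform SchwartzMap

theorem eLpNorm_two_sq {X E : Type*} [MeasurableSpace X] [NormedAddCommGroup E] {μ : Measure X}
    (f : X → E) : eLpNorm f 2 μ ^ 2 = ∫⁻ x, ‖f x‖ₑ ^ 2 ∂μ := by
  simpa using eLpNorm_nnreal_pow_eq_lintegral (f := f) (μ := μ) (p := 2) two_ne_zero

theorem memLp_two_of_lintegral {X E : Type*} [MeasurableSpace X] [NormedAddCommGroup E]
    {μ : Measure X} {f : X → E} (hf : AEStronglyMeasurable f μ)
    (h : ∫⁻ x, ‖f x‖ₑ ^ 2 ∂μ < ⊤) : MemLp f 2 μ := by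
  refine ⟨hf, ?_⟩
  rw [← eLpNorm_two_sq] at h
  exact (ENNReal.pow_lt_top_iff.1 h).resolve_right two_ne_zero

theorem enorm_toLp_sq {X E : Type*} [MeasurableSpace X] [NormedAddCommGroup E]
    {μ : Measure X} {f : X → E} (hf : MemLp f 2 μ) :
    ‖hf.toLp f‖ₑ ^ 2 = ∫⁻ x, ‖f x‖ₑ ^ 2 ∂μ := by
  rw [Lp.enorm_toLp, eLpNorm_two_sq]

/-- The `L²` transform is only given abstractly; comparing it with the transform of tempered
distributions makes it computable by duality. -/
theorem integral_smul_coe_fourier (f : Lp ℂ 2 (volume : Measure ℝ)) (ψ : 𝓢(ℝ, ℂ)) :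
    ∫ x, ψ x • (𝓕 f : Lp ℂ 2 (volume : Measure ℝ)) x = ∫ x, 𝓕 (ψ : ℝ → ℂ) x • f x := by
  rw [← Lp.toTemperedDistribution_apply, ← Lp.fourier_toTemperedDistribution_eq,
    TemperedDistribution.fourier_apply, Lp.toTemperedDistribution_apply, SchwartzMap.fourier_coe]

theorem integral_smul_coe_fourierInv (f : Lp ℂ 2 (volume : Measure ℝ)) (ψ : 𝓢(ℝ, ℂ)) :
    ∫ x, ψ x • (𝓕⁻ f : Lp ℂ 2 (volume : Measure ℝ)) x = ∫ x, 𝓕⁻ (ψ : ℝ → ℂ) x • f x := by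
  rw [← Lp.toTemperedDistribution_apply, ← Lp.fourierInv_toTemperedDistribution_eq,
    TemperedDistribution.fourierInv_apply, Lp.toTemperedDistribution_apply,
    SchwartzMap.fourierInv_coe]

theorem continuous_fourierInv_of_integrable {φ : ℝ → ℂ} (hφ : Integrable φ) :
    Continuous (𝓕⁻ φ) := by
  have h : Continuous (𝓕 φ) := VectorFourier.fourierIntegral_continuous
    Real.continuous_fourierChar continuous_inner hφ
  rw [funext fun x => Real.fourierInv_eq_fourier_neg φ x]
  exact h.comp continuous_neg

theorem integral_fourierInv_smul {φ ψ : ℝ → ℂ} (hφ : Integrable φ) (hψ : Integrable ψ) :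
    ∫ x, 𝓕⁻ ψ x • φ x = ∫ x, ψ x • 𝓕⁻ φ x := by
  have h := VectorFourier.integral_fourierIntegral_smul_eq_flip (L := innerₗ ℝ) (μ := volume)
    (ν := volume) Real.continuous_fourierChar continuous_inner hψ (hφ.comp_neg)
  have h1 : ∀ x, 𝓕⁻ ψ x = 𝓕 ψ (-x) := Real.fourierInv_eq_fourier_neg ψ
  have h2 : ∀ x, 𝓕⁻ φ x = 𝓕 (fun y => φ (-y)) x := fun x => by
    rw [Real.fourierInv_eq_fourier_comp_neg]
  simp only [h2]
  rw [← integral_neg_eq_self]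
  simp only [h1, neg_neg]
  rw [flip_innerₗ] at h
  exact h

theorem ae_eq_of_integral_test_eq {f g : ℝ → ℂ} (hf : LocallyIntegrable f)
    (hg : LocallyIntegrable g)
    (h : ∀ ψ : ℝ → ℝ, ContDiff ℝ (⊤ : ℕ∞) ψ → HasCompactSupport ψ →
      ∫ x, (ψ x : ℂ) * f x = ∫ x, (ψ x : ℂ) * g x) : f =ᵐ[volume] g :=
  ae_eq_of_integral_contDiff_smul_eq hf hg (by simpa only [Complex.real_smul] using h)

/-- A test function, as a complex-valued Schwartz function. -/
noncomputable def testSchwartz (ψ : ℝ → ℝ) (h1 : ContDiff ℝ (⊤ : ℕ∞) ψ)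
    (h2 : HasCompactSupport ψ) : 𝓢(ℝ, ℂ) :=
  HasCompactSupport.toSchwartzMap (f := fun x => (ψ x : ℂ)) (h2.comp_left Complex.ofReal_zero)
    (Complex.ofRealCLM.contDiff.comp h1)

@[simp]
theorem testSchwartz_apply (ψ : ℝ → ℝ) (h1 : ContDiff ℝ (⊤ : ℕ∞) ψ) (h2 : HasCompactSupport ψ)
    (x : ℝ) : testSchwartz ψ h1 h2 x = (ψ x : ℂ) := rfl

theorem _root_.ENNReal.mul_le_sq_add_sq (a b : ℝ≥0∞) : a * b ≤ a ^ 2 + b ^ 2 := by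
  rcases le_total a b with h | h
  · exact (mul_le_mul_left h b).trans (by rw [← sq]; exact le_add_self)
  · exact (mul_le_mul_right h a).trans (by rw [← sq]; exact le_self_add)

/-- Both sides have the same pairing with every test function, and both are locally integrable. -/
theorem coeFn_fourierInv_toLp {φ : ℝ → ℂ} (h1 : Integrable φ) (h2 : MemLp φ 2) :
    (𝓕⁻ (h2.toLp φ) : Lp ℂ 2 (volume : Measure ℝ)) =ᵐ[volume] 𝓕⁻ φ := by
  refine ae_eq_of_integral_test_eq ((Lp.memLp _).locallyIntegrable one_le_two)
    (continuous_fourierInv_of_integrable h1).locallyIntegrable fun ψ hψ1 hψ2 => ?_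
  have h := integral_smul_coe_fourierInv (h2.toLp φ) (testSchwartz ψ hψ1 hψ2)
  have h3 : ∫ x, 𝓕⁻ (testSchwartz ψ hψ1 hψ2 : ℝ → ℂ) x • (h2.toLp φ) x =
      ∫ x, 𝓕⁻ (testSchwartz ψ hψ1 hψ2 : ℝ → ℂ) x • φ x := by
    refine integral_congr_ae ?_
    filter_upwards [h2.coeFn_toLp] with x hx
    rw [hx]
  rw [h3, integral_fourierInv_smul h1 (SchwartzMap.integrable _)] at h
  exact h

/-- Plancherel's theorem for functions in `L¹ ∩ L²`. -/
theorem lintegral_fourierInv_sq {φ : ℝ → ℂ} (h1 : Integrable φ) (h2 : MemLp φ 2) :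
    ∫⁻ x, ‖𝓕⁻ φ x‖ₑ ^ 2 = ∫⁻ x, ‖φ x‖ₑ ^ 2 := by
  have e : ‖(𝓕⁻ (h2.toLp φ) : Lp ℂ 2 (volume : Measure ℝ))‖ₑ = ‖h2.toLp φ‖ₑ :=
    enorm_eq_iff_norm_eq.2 ((Lp.fourierTransformₗᵢ ℝ ℂ).symm.norm_map _)
  rw [← enorm_toLp_sq h2, ← eLpNorm_two_sq, ← eLpNorm_congr_ae (coeFn_fourierInv_toLp h1 h2),
    ← Lp.enorm_def, e]

theorem lintegral_fourier_sq {φ : ℝ → ℂ} (h1 : Integrable φ) (h2 : MemLp φ 2) :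
    ∫⁻ x, ‖𝓕 φ x‖ₑ ^ 2 = ∫⁻ x, ‖φ x‖ₑ ^ 2 := by
  rw [← lintegral_fourierInv_sq h1 h2, ← lintegral_neg_eq_self]
  simp only [Real.fourierInv_eq_fourier_neg]

end Fourier

end Worm

namespace Worm

/-! ### The Paley–Wiener theorem on a strip -/

section PaleyWiener

open FourierTransform SchwartzMap

theorem integrable_exp_neg_mul_abs {c : ℝ} (hc : 0 < c) :
    Integrable fun x : ℝ => Real.exp (-(c * |x|)) := by
  rw [← integrableOn_univ, ← Set.Iic_union_Ioi (a := (0 : ℝ))]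
  refine IntegrableOn.union ?_ ?_
  · refine (integrableOn_exp_mul_Iic hc 0).congr_fun (fun x hx => ?_) measurableSet_Iic
    simp only [abs_of_nonpos (Set.mem_Iic.1 hx)]
    congr 1; ring
  · refine (exp_neg_integrableOn_Ioi 0 hc).congr_fun (fun x hx => ?_) measurableSet_Ioi
    simp only [abs_of_pos (Set.mem_Ioi.1 hx)]
    congr 1; ring

theorem memLp_two_exp_neg_mul_abs {c : ℝ} (hc : 0 < c) :
    MemLp (fun x : ℝ => Real.exp (-(c * |x|))) 2 := by
  refine (memLp_two_iff_integrable_sq (by fun_prop)).2 ?_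
  refine (integrable_exp_neg_mul_abs (mul_pos two_pos hc)).congr (ae_of_all _ fun x => ?_)
  simp only [← Real.exp_nat_mul]
  congr 1; push_cast; ring

/-- The Fourier–Laplace transform of a test function. -/
noncomputable def fourierLaplace (ψ : ℝ → ℝ) (z : ℂ) : ℂ :=
  ∫ ξ : ℝ, Complex.exp (-(2 * Real.pi * Complex.I * ξ * z)) * (ψ ξ : ℂ)

theorem differentiable_fourierLaplace {ψ : ℝ → ℝ} (h1 : Continuous ψ) (h2 : HasCompactSupport ψ) :
    Differentiable ℂ (fourierLaplace ψ) := by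
  intro z
  set Y := |z.im| + 1
  have hΩ : IsOpen {w : ℂ | |w.im| < Y} := isOpen_lt (by fun_prop) continuous_const
  have hz : z ∈ {w : ℂ | |w.im| < Y} := lt_add_one |z.im|
  have key := differentiableOn_integral_of_dominated (μ := (volume : Measure ℝ))
    (f := fun (z : ℂ) (ξ : ℝ) => Complex.exp (-(2 * Real.pi * Complex.I * ξ * z)) * (ψ ξ : ℂ))
    (Ω := {w : ℂ | |w.im| < Y}) hΩ
    (g := fun ξ => Real.exp (2 * Real.pi * |ξ| * Y) * |ψ ξ|)
    (Continuous.integrable_of_hasCompactSupport (by fun_prop) (h2.abs.mul_left))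
    (fun p _ => (by fun_prop : Continuous _).aestronglyMeasurable)
    (fun x => by fun_prop)
    (fun p hp x => by
      rw [norm_mul, Complex.norm_exp, Complex.norm_real, Real.norm_eq_abs]
      gcongr
      have : (-(2 * (Real.pi : ℂ) * Complex.I * x * p)).re = 2 * Real.pi * (x * p.im) := by
        simp; ring
      rw [this, mul_assoc]
      have h3 : x * p.im ≤ |x| * Y := (le_abs_self _).trans (by
        rw [abs_mul]; exact mul_le_mul_of_nonneg_left (le_of_lt hp) (abs_nonneg _))
      have := Real.pi_pos
      nlinarith)
  exact (key z hz).differentiableAt (hΩ.mem_nhds hz)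

theorem contDiff_exp_mul_test {ψ : ℝ → ℝ} (h1 : ContDiff ℝ (⊤ : ℕ∞) ψ) (y : ℝ) :
    ContDiff ℝ (⊤ : ℕ∞) fun ξ => Real.exp (2 * Real.pi * ξ * y) * ψ ξ := by fun_prop

theorem fourierLaplace_eq_fourier (ψ : ℝ → ℝ) (x y : ℝ) :
    fourierLaplace ψ (x + y * Complex.I) =
      𝓕 (fun ξ : ℝ => ((Real.exp (2 * Real.pi * ξ * y) * ψ ξ : ℝ) : ℂ)) x := by
  rw [Real.fourier_eq', fourierLaplace]
  refine integral_congr_ae (ae_of_all _ fun ξ => ?_)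
  simp only [smul_eq_mul]
  push_cast
  rw [← mul_assoc, ← Complex.exp_add]
  congr 2
  simp only [RCLike.inner_apply, conj_trivial]
  push_cast
  linear_combination (-2 * Real.pi * ξ * y : ℂ) * Complex.I_mul_I

/-- The Paley–Wiener theorem for the Hardy space of a strip. -/
theorem exists_paleyWiener {f : ℂ → ℂ} {β : ℝ} (hβ : 0 < β) {M : ℝ≥0∞} (hM : M < ⊤)
    (hf : DifferentiableOn ℂ f {z | |z.im| < β})
    (hb : ∀ y : ℝ, |y| < β → ∫⁻ x : ℝ, ‖f (x + y * Complex.I)‖ₑ ^ 2 ≤ M) :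
    ∃ g : ℝ → ℂ, Measurable g ∧ ∀ y : ℝ, |y| < β →
      Integrable (fun η => g η * (Real.exp (-(2 * Real.pi * η * y)) : ℂ)) ∧
      MemLp (fun η => g η * (Real.exp (-(2 * Real.pi * η * y)) : ℂ)) 2 ∧
      ∀ x : ℝ, f (x + y * Complex.I) =
        𝓕⁻ (fun η => g η * (Real.exp (-(2 * Real.pi * η * y)) : ℂ)) x := by
  have hcont : ∀ y : ℝ, |y| < β → Continuous fun x : ℝ => f (x + y * Complex.I) := fun y hy =>
    hf.continuousOn.comp_continuous (by fun_prop) fun x => by simpa using hy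
  have hmem : ∀ y : ℝ, |y| < β → MemLp (fun x : ℝ => f (x + y * Complex.I)) 2 := fun y hy =>
    memLp_two_of_lintegral (hcont y hy).aestronglyMeasurable ((hb y hy).trans_lt hM)
  -- The `L²` transform of the restriction to height `y`. The goal is `φ y = e^{-2πηy} φ 0`, so that
  -- `φ 0` serves as the density for all heights.
  set φ : ℝ → Lp ℂ 2 (volume : Measure ℝ) := fun y =>
    if h : |y| < β then 𝓕 ((hmem y h).toLp _) else 0 with hφ
  have hφy : ∀ y (h : |y| < β), φ y = 𝓕 ((hmem y h).toLp _) := fun y h => by simp [hφ, h]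
  have h0 : |(0 : ℝ)| < β := by simpa using hβ
  -- pairing with a test function
  have pair : ∀ (ψ : ℝ → ℝ), ContDiff ℝ (⊤ : ℕ∞) ψ → HasCompactSupport ψ → ∀ y, |y| < β →
      ∫ ξ : ℝ, (ψ ξ : ℂ) * ((Real.exp (2 * Real.pi * ξ * y) : ℂ) * φ y ξ) =
        ∫ x : ℝ, fourierLaplace ψ (x + y * Complex.I) * f (x + y * Complex.I) := by
    intro ψ h1 h2 y hy
    have h := integral_smul_coe_fourier ((hmem y hy).toLp _)
      (testSchwartz _ (contDiff_exp_mul_test h1 y) (h2.mul_left))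
    rw [← hφy y hy] at h
    have e1 : (∫ ξ : ℝ, (ψ ξ : ℂ) * ((Real.exp (2 * Real.pi * ξ * y) : ℂ) * φ y ξ)) =
        ∫ x, testSchwartz _ (contDiff_exp_mul_test h1 y) (h2.mul_left) x • φ y x := by
      refine integral_congr_ae (ae_of_all _ fun x => ?_)
      simp only [testSchwartz_apply, smul_eq_mul]
      push_cast; ring
    rw [e1, h]
    refine integral_congr_ae ?_
    filter_upwards [(hmem y hy).coeFn_toLp] with x hx
    rw [hx, fourierLaplace_eq_fourier, smul_eq_mul]
    rfl
  -- The Fourier–Laplace transform of a test function is entire, so the line of integration in the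
  -- pairing can be moved to the real axis.
  have indep : ∀ (ψ : ℝ → ℝ), ContDiff ℝ (⊤ : ℕ∞) ψ → HasCompactSupport ψ → ∀ y, |y| < β →
      (∫ x : ℝ, fourierLaplace ψ (x + y * Complex.I) * f (x + y * Complex.I)) =
        ∫ x : ℝ, fourierLaplace ψ (x + (0 : ℝ) * Complex.I) * f (x + (0 : ℝ) * Complex.I) := by
    intro ψ h1 h2 y hy
    have hstrip : ∀ v ∈ Set.uIcc y 0, |v| < β := fun v hv =>
      (by simpa using Set.abs_sub_right_of_mem_uIcc hv : |v| ≤ |y|).trans_lt hy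
    have hH : DifferentiableOn ℂ (fun z => fourierLaplace ψ z * f z) {z | |z.im| < β} :=
      (differentiable_fourierLaplace h1.continuous h2).differentiableOn.mul hf
    have hΨ : ∀ v : ℝ, ∫⁻ x : ℝ, ‖fourierLaplace ψ (x + v * Complex.I)‖ₑ ^ 2 =
        ∫⁻ ξ : ℝ, ‖((Real.exp (2 * Real.pi * ξ * v) * ψ ξ : ℝ) : ℂ)‖ₑ ^ 2 := by
      intro v
      simp only [fourierLaplace_eq_fourier]
      exact lintegral_fourier_sq
        (φ := fun ξ => ((Real.exp (2 * Real.pi * ξ * v) * ψ ξ : ℝ) : ℂ))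
        (testSchwartz _ (contDiff_exp_mul_test h1 v) h2.mul_left).integrable
        ((testSchwartz _ (contDiff_exp_mul_test h1 v) h2.mul_left).memLp 2 volume)
    -- A bound for the squared `L²` norm of the entire factor that is uniform over the strip; with
    -- `M` it makes the product integrable over the rectangle of heights.
    set B : ℝ≥0∞ := ∫⁻ ξ : ℝ, ‖Real.exp (2 * Real.pi * |ξ| * β) * ψ ξ‖ₑ ^ 2 with hB
    have hBtop : B < ⊤ := by
      have hc : Continuous fun ξ => Real.exp (2 * Real.pi * |ξ| * β) * ψ ξ := by
        have := h1.continuous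
        fun_prop
      rw [hB, ← eLpNorm_two_sq]
      exact ENNReal.pow_lt_top (hc.memLp_of_hasCompactSupport h2.mul_left).2
    have hΨB : ∀ v : ℝ, |v| < β → ∫⁻ x : ℝ, ‖fourierLaplace ψ (x + v * Complex.I)‖ₑ ^ 2 ≤ B := by
      intro v hv
      rw [hΨ, hB]
      gcongr with ξ
      rw [← ofReal_norm, ← ofReal_norm, Complex.norm_real, norm_mul, norm_mul]
      refine ENNReal.ofReal_le_ofReal (mul_le_mul_of_nonneg_right ?_ (norm_nonneg _))
      rw [Real.norm_eq_abs, Real.norm_eq_abs, Real.abs_exp, Real.abs_exp, Real.exp_le_exp,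
        mul_assoc, mul_assoc (2 * Real.pi)]
      refine mul_le_mul_of_nonneg_left ?_ Real.two_pi_pos.le
      calc ξ * v ≤ |ξ| * |v| := by rw [← abs_mul]; exact le_abs_self _
        _ ≤ |ξ| * β := by gcongr
    have hline : ∀ v : ℝ, |v| < β →
        ∫⁻ x : ℝ, ‖fourierLaplace ψ (x + v * Complex.I) * f (x + v * Complex.I)‖ₑ ≤ B + M := by
      intro v hv
      calc _ ≤ ∫⁻ x : ℝ, (‖fourierLaplace ψ (x + v * Complex.I)‖ₑ ^ 2 +
            ‖f (x + v * Complex.I)‖ₑ ^ 2) := lintegral_mono fun x => by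
              rw [enorm_mul]
              exact ENNReal.mul_le_sq_add_sq _ _
        _ = _ := lintegral_add_right _ ((hcont v hv).measurable.enorm.pow_const 2)
        _ ≤ _ := add_le_add (hΨB v hv) (hb v hv)
    have hcH : ∀ v : ℝ, |v| < β → Continuous fun x : ℝ =>
        fourierLaplace ψ (x + v * Complex.I) * f (x + v * Complex.I) := fun v hv =>
      hH.continuousOn.comp_continuous (f := fun x : ℝ => (x + v * Complex.I : ℂ))
        (by fun_prop) fun x => by simpa using hv
    have hint : ∀ v : ℝ, |v| < β → Integrable fun x : ℝ =>
        fourierLaplace ψ (x + v * Complex.I) * f (x + v * Complex.I) := fun v hv =>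
      ⟨(hcH v hv).aestronglyMeasurable,
        (hline v hv).trans_lt (ENNReal.add_lt_top.2 ⟨hBtop, hM⟩)⟩
    refine integral_horizontal_line_eq (H := fun z => fourierLaplace ψ z * f z)
      (hH.mono fun z hz => hstrip _ hz) (hint y hy) (hint 0 h0) ⟨?_, ?_⟩
    · have hrestr : (volume : Measure ℝ).prod ((volume : Measure ℝ).restrict (Set.uIoc y 0)) =
          (volume : Measure (ℝ × ℝ)).restrict (Set.univ ×ˢ Set.uIoc y 0) := by
        rw [Measure.volume_eq_prod, ← Measure.prod_restrict, Measure.restrict_univ]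
      rw [hrestr]
      refine ContinuousOn.aestronglyMeasurable ?_ (MeasurableSet.univ.prod measurableSet_uIoc)
      refine hH.continuousOn.comp (f := fun p : ℝ × ℝ => (p.1 + p.2 * Complex.I : ℂ))
        (by fun_prop) fun p hp => ?_
      simpa using hstrip _ (Set.uIoc_subset_uIcc hp.2)
    · rw [hasFiniteIntegral_iff_enorm]
      rw [← lintegral_prod_swap]
      refine (lintegral_prod_le _).trans_lt ?_
      calc _ ≤ ∫⁻ v in Set.uIoc y 0, (B + M) :=
            setLIntegral_mono measurable_const fun v hv =>
              hline v (hstrip v (Set.uIoc_subset_uIcc hv))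
        _ < ⊤ := by
            rw [setLIntegral_const]
            refine ENNReal.mul_lt_top (ENNReal.add_lt_top.2 ⟨hBtop, hM⟩) ?_
            simp [Set.uIoc]
  have key : ∀ y, |y| < β → φ y =ᵐ[volume]
      fun η => φ 0 η * (Real.exp (-(2 * Real.pi * η * y)) : ℂ) := by
    intro y hy
    have h : (fun η => (Real.exp (2 * Real.pi * η * y) : ℂ) * φ y η) =ᵐ[volume] φ 0 := by
      refine ae_eq_of_integral_test_eq ?_ ((Lp.memLp _).locallyIntegrable one_le_two)
        fun ψ h1 h2 => ?_
      · exact ((Lp.memLp (φ y)).locallyIntegrable one_le_two).continuous_smul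
          (g := fun η => (Real.exp (2 * Real.pi * η * y) : ℂ)) (by fun_prop)
      · rw [pair ψ h1 h2 y hy, indep ψ h1 h2 y hy, ← pair ψ h1 h2 0 h0]
        simp
    filter_upwards [h] with η hη
    rw [← hη]
    have : (Real.exp (2 * Real.pi * η * y) : ℂ) * (Real.exp (-(2 * Real.pi * η * y)) : ℂ) = 1 := by
      rw [← Complex.ofReal_mul, ← Real.exp_add]; simp
    linear_combination (-(φ y η)) * this
  refine ⟨φ 0, (Lp.stronglyMeasurable _).measurable, fun y hy => ?_⟩
  have hL2 : ∀ y, |y| < β → MemLp (fun η => φ 0 η * (Real.exp (-(2 * Real.pi * η * y)) : ℂ)) 2 :=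
    fun y hy => (memLp_congr_ae (key y hy)).1 (Lp.memLp _)
  -- Square integrability at the heights `y ± δ` leaves a spare factor `e^{-2πδ|η|}`, itself in
  -- `L²`; the product of two `L²` functions is integrable.
  have hL1 : Integrable (fun η => φ 0 η * (Real.exp (-(2 * Real.pi * η * y)) : ℂ)) := by
    obtain ⟨δ, hδ, hδ1, hδ2⟩ : ∃ δ : ℝ, 0 < δ ∧ |y + δ| < β ∧ |y - δ| < β := by
      refine ⟨(β - |y|) / 2, by linarith, ?_, ?_⟩
      · refine (abs_add_le _ _).trans_lt ?_
        rw [abs_of_pos (by linarith : 0 < (β - |y|) / 2)]; linarith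
      · refine (abs_sub _ _).trans_lt ?_
        rw [abs_of_pos (by linarith : 0 < (β - |y|) / 2)]; linarith
    have hsum := ((hL2 _ hδ1).norm.add (hL2 _ hδ2).norm).integrable_mul
      (memLp_two_exp_neg_mul_abs (mul_pos Real.two_pi_pos hδ))
    refine hsum.mono' (hL2 y hy).1 (ae_of_all _ fun η => ?_)
    simp only [norm_mul, Complex.norm_real, Real.norm_eq_abs, Real.abs_exp, Pi.mul_apply,
      Pi.add_apply]
    have hexp : Real.exp (-(2 * Real.pi * η * y)) ≤
        (Real.exp (-(2 * Real.pi * η * (y + δ))) + Real.exp (-(2 * Real.pi * η * (y - δ)))) *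
          Real.exp (-(2 * Real.pi * δ * |η|)) := by
      rw [add_mul, ← Real.exp_add, ← Real.exp_add]
      rcases le_total 0 η with h | h
      · rw [abs_of_nonneg h]
        refine (le_of_eq ?_).trans (le_add_of_nonneg_left (Real.exp_nonneg _))
        congr 1; ring
      · rw [abs_of_nonpos h]
        refine (le_of_eq ?_).trans (le_add_of_nonneg_right (Real.exp_nonneg _))
        congr 1; ring
    calc _ ≤ _ := mul_le_mul_of_nonneg_left hexp (norm_nonneg (φ 0 η))
      _ = _ := by ring
  refine ⟨hL1, hL2 y hy, fun x => ?_⟩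
  have e1 : φ y = (hL2 y hy).toLp _ := by
    ext1
    exact (key y hy).trans (hL2 y hy).coeFn_toLp.symm
  -- Inversion in `L²` holds almost everywhere; continuity of both sides then gives it everywhere.
  have e2 : (fun x : ℝ => f (x + y * Complex.I)) =ᵐ[volume]
      𝓕⁻ (fun η => φ 0 η * (Real.exp (-(2 * Real.pi * η * y)) : ℂ)) := by
    refine (hmem y hy).coeFn_toLp.symm.trans ?_
    refine EventuallyEq.trans ?_ (coeFn_fourierInv_toLp hL1 (hL2 y hy))
    rw [← e1, hφy y hy, FourierTransform.fourierInv_fourier_eq]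
  exact congrFun (((hcont y hy).ae_eq_iff_eq _ (continuous_fourierInv_of_integrable hL1)).1 e2) x

end PaleyWiener

end Worm

namespace Worm

/-! ### Fourier series on the unit circle -/

section Circle

open AddCircle

theorem haarAddCircle_one_eq_volume :
    (haarAddCircle : Measure (AddCircle (1 : ℝ))) = volume := by
  rw [volume_eq_smul_haarAddCircle]; simp

theorem setLIntegral_Icc_eq_addCircle (f : AddCircle (1 : ℝ) → ℝ≥0∞) :
    ∫⁻ θ in Set.Icc (0 : ℝ) 1, f (θ : AddCircle (1 : ℝ)) = ∫⁻ θ, f θ ∂haarAddCircle := by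
  have h := AddCircle.lintegral_preimage (1 : ℝ) 0 f
  rw [zero_add] at h
  rw [haarAddCircle_one_eq_volume, ← h]
  exact setLIntegral_congr Ioc_ae_eq_Icc.symm

/-- Parseval in `[0, ∞]`, the form in which sums over `j` can be exchanged with integrals without
summability conditions. -/
theorem lintegral_sq_eq_tsum_fourierCoeff (f : C(AddCircle (1 : ℝ), ℂ)) :
    ∫⁻ θ in Set.Icc (0 : ℝ) 1, ‖f θ‖ₑ ^ 2 = ∑' j : ℤ, ‖fourierCoeff f j‖ₑ ^ 2 := by
  rw [setLIntegral_Icc_eq_addCircle fun θ => ‖f θ‖ₑ ^ 2]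
  have hmem : MemLp f 2 (haarAddCircle : Measure (AddCircle (1 : ℝ))) :=
    f.continuous.memLp_of_hasCompactSupport (HasCompactSupport.of_compactSpace f)
  have h := hasSum_sq_fourierCoeff (hmem.toLp f)
  have hcoeff : ∀ j, fourierCoeff (hmem.toLp f) j = fourierCoeff f j := fun j => by
    rw [fourierCoeff_congr_ae hmem.coeFn_toLp]
  simp only [hcoeff] at h
  have h2 : ∑' j : ℤ, ‖fourierCoeff f j‖ₑ ^ 2 =
      ∑' j : ℤ, ENNReal.ofReal (‖fourierCoeff f j‖ ^ 2) := by
    simp only [ENNReal.ofReal_pow (norm_nonneg _), ofReal_norm]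
  rw [h2, ← ENNReal.ofReal_tsum_of_nonneg (fun _ => by positivity) h.summable, h.tsum_eq,
    ofReal_integral_eq_lintegral_ofReal]
  · refine lintegral_congr_ae ?_
    filter_upwards [hmem.coeFn_toLp] with θ hθ
    rw [hθ, ENNReal.ofReal_pow (norm_nonneg _), ofReal_norm]
  · exact (memLp_two_iff_integrable_sq_norm (Lp.aestronglyMeasurable _)).1 (Lp.memLp _)
  · exact ae_of_all _ fun _ => by positivity

theorem fourier_one_apply (j : ℤ) (θ : ℝ) : fourier j (θ : AddCircle (1 : ℝ)) =
    Complex.exp (2 * Real.pi * Complex.I * j * θ) := by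
  rw [fourier_coe_apply]; simp

/-- Parseval's identity for an absolutely convergent Fourier series. -/
theorem lintegral_sq_tsum_exp {c : ℤ → ℂ} (hc : Summable fun j => ‖c j‖) :
    ∫⁻ θ in Set.Icc (0 : ℝ) 1,
      ‖∑' j : ℤ, c j * Complex.exp (2 * Real.pi * Complex.I * j * θ)‖ₑ ^ 2 =
      ∑' j : ℤ, ‖c j‖ₑ ^ 2 := by
  have hs : Summable fun j => c j • (fourier j : C(AddCircle (1 : ℝ), ℂ)) := by
    refine Summable.of_norm ?_
    simpa only [norm_smul, fourier_norm, mul_one] using hc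
  set f : C(AddCircle (1 : ℝ), ℂ) := ∑' j, c j • fourier j with hf
  have hfa : ∀ θ, f θ = ∑' j, c j * fourier j θ := fun θ =>
    ((ContinuousMap.evalCLM ℂ θ).hasSum hs.hasSum).tsum_eq.symm
  have hcoeff : ∀ n, fourierCoeff f n = c n := by
    intro n
    have h1 : ∀ j, fourierCoeff (c j • (fourier j : C(AddCircle (1 : ℝ), ℂ))) n =
        if j = n then c n else 0 := fun j => by
      have := fourierCoeff.const_mul (T := 1) (fourier j : AddCircle (1 : ℝ) → ℂ) (c j) n
      rw [fourierCoeff_fourier] at this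
      simp only [Pi.single_apply] at this
      refine Eq.trans ?_ (this.trans ?_)
      · rfl
      · by_cases h : j = n
        · simp [h]
        · simp [h, Ne.symm h]
    -- Absolute convergence allows the coefficient of the sum to be computed term by term, where
    -- orthogonality leaves one term.
    have h2 : HasSum (fun j => fourierCoeff (c j • (fourier j : C(AddCircle (1 : ℝ), ℂ))) n)
        (fourierCoeff f n) := by
      have hint : ∀ j, Integrable (fun θ => fourier (-n) θ •
          (c j • (fourier j : C(AddCircle (1 : ℝ), ℂ))) θ) haarAddCircle := fun j =>
        (map_continuous (fourier (-n) * (c j • (fourier j : C(AddCircle (1 : ℝ), ℂ)))))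
          |>.integrable_of_hasCompactSupport (HasCompactSupport.of_compactSpace _)
      have h3 := hasSum_integral_of_summable_integral_norm hint (by
        refine hc.of_nonneg_of_le (fun j => by positivity) fun j => ?_
        refine (integral_mono_of_nonneg (ae_of_all _ fun _ => norm_nonneg _)
          (integrable_const ‖c j‖) (ae_of_all _ fun θ => ?_)).trans (by simp)
        have h4 : ∀ m : ℤ, ‖(fourier m : C(AddCircle (1 : ℝ), ℂ)) θ‖ = 1 := fun m =>
          Circle.norm_coe _
        simp only [norm_smul, ContinuousMap.coe_smul, Pi.smul_apply, h4, mul_one, one_mul, le_refl])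
      have h5 : fourierCoeff f n = ∫ θ, ∑' j, fourier (-n) θ •
          (c j • (fourier j : C(AddCircle (1 : ℝ), ℂ))) θ ∂haarAddCircle := by
        refine integral_congr_ae (ae_of_all _ fun θ => ?_)
        simp only [hfa, smul_eq_mul, ContinuousMap.coe_smul, Pi.smul_apply, tsum_mul_left]
      rw [h5]
      exact h3
    rw [← h2.tsum_eq]
    simp only [h1]
    rw [tsum_ite_eq]
  have := lintegral_sq_eq_tsum_fourierCoeff f
  simp only [hcoeff, hfa, fourier_one_apply] at this
  exact this

end Circle

/-! ### The Fourier transform of `ℝ × ℝ/ℤ` -/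

section Synthesis

open FourierTransform

/-- The measure on the dual group `ℤ × ℝ` of `ℝ/ℤ × ℝ`. -/
noncomputable def modeMeasure : Measure (ℤ × ℝ) := (Measure.count : Measure ℤ).prod volume

instance : SFinite modeMeasure := by unfold modeMeasure; infer_instance

instance : SFinite stripMeasure := by unfold stripMeasure; infer_instance

theorem lintegral_modeMeasure {f : ℤ × ℝ → ℝ≥0∞} (hf : AEMeasurable f modeMeasure) :
    ∫⁻ q, f q ∂modeMeasure = ∑' j : ℤ, ∫⁻ η, f (j, η) := by
  rw [modeMeasure, lintegral_prod _ hf, lintegral_count]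

theorem ae_modeMeasure_iff {p : ℤ × ℝ → Prop} (h : ∀ᵐ q ∂modeMeasure, p q) (j : ℤ) :
    ∀ᵐ η : ℝ, p (j, η) := by
  have := Measure.ae_ae_of_ae_prod h
  rw [Measure.ae_count_iff] at this
  exact this j

/-- For counting measure "almost every `j`" means every `j`. -/
theorem integrable_mode_slice {γ : ℤ × ℝ → ℂ} (h : Integrable γ modeMeasure) (j : ℤ) :
    Integrable fun η => γ (j, η) := by
  have := h.prod_right_ae
  rw [Measure.ae_count_iff] at this
  exact this j

theorem aestronglyMeasurable_mode_slice {γ : ℤ × ℝ → ℂ} (h : AEStronglyMeasurable γ modeMeasure)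
    (j : ℤ) : AEStronglyMeasurable (fun η => γ (j, η)) volume := by
  refine ⟨fun η => h.mk γ (j, η), h.stronglyMeasurable_mk.comp_measurable measurable_prodMk_left, ?_⟩
  exact ae_modeMeasure_iff h.ae_eq_mk j

theorem summable_mode_norm {γ : ℤ × ℝ → ℂ} (h : Integrable γ modeMeasure) :
    Summable fun j : ℤ => ∫ η, ‖γ (j, η)‖ := by
  have := h.norm.integral_prod_left
  rw [integrable_count_iff] at this
  exact this.of_norm

theorem hasSum_integral_modeMeasure {γ : ℤ × ℝ → ℂ} (h : Integrable γ modeMeasure) :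
    HasSum (fun j : ℤ => ∫ η, γ (j, η)) (∫ q, γ q ∂modeMeasure) := by
  have h1 := h.integral_prod_left
  rw [modeMeasure, integral_prod _ h]
  have hs : Summable fun j : ℤ => ∫ η, γ (j, η) := (integrable_count_iff.1 h1).of_norm
  rw [integral_countable h1]
  simpa [measureReal_def] using hs.hasSum

theorem memLp_mode_slice {γ : ℤ × ℝ → ℂ} (h : MemLp γ 2 modeMeasure) (j : ℤ) :
    MemLp (fun η => γ (j, η)) 2 := by
  refine memLp_two_of_lintegral (aestronglyMeasurable_mode_slice h.1 j) ?_
  refine (ENNReal.le_tsum (f := fun j : ℤ => ∫⁻ η, ‖γ (j, η)‖ₑ ^ 2) j).trans_lt ?_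
  rw [← lintegral_modeMeasure (f := fun q => ‖γ q‖ₑ ^ 2) (h.1.enorm.pow_const 2), ← eLpNorm_two_sq]
  exact ENNReal.pow_lt_top h.2

/-- The function on `ℝ × [0,1]` with the given Fourier transform. -/
noncomputable def synthesis (γ : ℤ × ℝ → ℂ) (p : ℝ × ℝ) : ℂ :=
  ∫ q, γ q * Complex.exp (2 * Real.pi * Complex.I * (q.1 * p.2 + q.2 * p.1)) ∂modeMeasure

theorem norm_character (q : ℤ × ℝ) (p : ℝ × ℝ) :
    ‖Complex.exp (2 * Real.pi * Complex.I * (q.1 * p.2 + q.2 * p.1))‖ = 1 := by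
  rw [show (2 * Real.pi * Complex.I * (q.1 * p.2 + q.2 * p.1) : ℂ) =
    ((2 * Real.pi * (q.1 * p.2 + q.2 * p.1) : ℝ) : ℂ) * Complex.I by push_cast; ring,
    Complex.norm_exp_ofReal_mul_I]

theorem measurable_character (p : ℝ × ℝ) : Measurable fun q : ℤ × ℝ =>
    Complex.exp (2 * Real.pi * Complex.I * (q.1 * p.2 + q.2 * p.1)) := by
  have : Measurable fun q : ℤ × ℝ => (q.1 : ℂ) :=
    (measurable_from_top (f := fun j : ℤ => (j : ℂ))).comp measurable_fst
  fun_prop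

theorem integrable_mul_character {γ : ℤ × ℝ → ℂ} (h : Integrable γ modeMeasure) (p : ℝ × ℝ) :
    Integrable (fun q => γ q *
      Complex.exp (2 * Real.pi * Complex.I * (q.1 * p.2 + q.2 * p.1))) modeMeasure :=
  h.mul_bdd (c := 1) (measurable_character p).aestronglyMeasurable
    (ae_of_all _ fun q => (norm_character q p).le)

theorem continuous_synthesis {γ : ℤ × ℝ → ℂ} (h : Integrable γ modeMeasure) :
    Continuous (synthesis γ) := by
  refine continuous_of_dominated (bound := fun q => ‖γ q‖)
    (fun p => (integrable_mul_character h p).aestronglyMeasurable)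
    (fun p => ae_of_all _ fun q => ?_) h.norm (ae_of_all _ fun q => by fun_prop)
  rw [norm_mul, norm_character, mul_one]

theorem synthesis_eq_tsum {γ : ℤ × ℝ → ℂ} (h : Integrable γ modeMeasure) (x θ : ℝ) :
    synthesis γ (x, θ) = ∑' j : ℤ, 𝓕⁻ (fun η => γ (j, η)) x *
      Complex.exp (2 * Real.pi * Complex.I * j * θ) := by
  rw [synthesis, ← (hasSum_integral_modeMeasure (integrable_mul_character h (x, θ))).tsum_eq]
  refine tsum_congr fun j => ?_
  rw [Real.fourierInv_eq', ← integral_mul_const]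
  refine integral_congr_ae (ae_of_all _ fun η => ?_)
  simp only [smul_eq_mul, RCLike.inner_apply, conj_trivial]
  rw [mul_comm (Complex.exp _) (γ _), mul_assoc (γ _), ← Complex.exp_add]
  congr 2
  push_cast; ring

theorem norm_fourierInv_le (φ : ℝ → ℂ) (x : ℝ) : ‖𝓕⁻ φ x‖ ≤ ∫ η, ‖φ η‖ := by
  rw [Real.fourierInv_eq]
  refine (norm_integral_le_integral_norm _).trans_eq ?_
  simp only [Circle.norm_smul]

/-- Plancherel's theorem on `ℝ × ℝ/ℤ`. -/
theorem lintegral_synthesis_sq {γ : ℤ × ℝ → ℂ} (h1 : Integrable γ modeMeasure)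
    (h2 : MemLp γ 2 modeMeasure) :
    ∫⁻ p, ‖synthesis γ p‖ₑ ^ 2 ∂stripMeasure = ∫⁻ q, ‖γ q‖ₑ ^ 2 ∂modeMeasure := by
  have hm : Measurable fun p => ‖synthesis γ p‖ₑ ^ 2 :=
    (continuous_synthesis h1).measurable.enorm.pow_const 2
  rw [stripMeasure, lintegral_prod _ hm.aemeasurable,
    lintegral_modeMeasure (h2.1.enorm.pow_const 2)]
  have hx : ∀ x : ℝ, ∫⁻ θ in Set.Icc (0 : ℝ) 1, ‖synthesis γ (x, θ)‖ₑ ^ 2 =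
      ∑' j : ℤ, ‖𝓕⁻ (fun η => γ (j, η)) x‖ₑ ^ 2 := fun x => by
    simp only [synthesis_eq_tsum h1]
    exact lintegral_sq_tsum_exp ((summable_mode_norm h1).of_nonneg_of_le
      (fun _ => norm_nonneg _) fun j => norm_fourierInv_le _ x)
  simp only [hx]
  rw [lintegral_tsum fun j => ((continuous_fourierInv_of_integrable
    (integrable_mode_slice h1 j)).measurable.enorm.pow_const 2).aemeasurable]
  exact tsum_congr fun j =>
    lintegral_fourierInv_sq (integrable_mode_slice h1 j) (memLp_mode_slice h2 j)

theorem memLp_synthesis {γ : ℤ × ℝ → ℂ} (h1 : Integrable γ modeMeasure)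
    (h2 : MemLp γ 2 modeMeasure) : MemLp (synthesis γ) 2 stripMeasure := by
  refine memLp_two_of_lintegral (continuous_synthesis h1).aestronglyMeasurable ?_
  rw [lintegral_synthesis_sq h1 h2, ← eLpNorm_two_sq]
  exact ENNReal.pow_lt_top h2.2

theorem synthesis_add {γ γ' : ℤ × ℝ → ℂ} (h : Integrable γ modeMeasure)
    (h' : Integrable γ' modeMeasure) : synthesis (γ + γ') = synthesis γ + synthesis γ' := by
  funext p
  simp only [synthesis, Pi.add_apply, add_mul]
  exact integral_add (integrable_mul_character h p) (integrable_mul_character h' p)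

theorem synthesis_smul (c : ℂ) (γ : ℤ × ℝ → ℂ) : synthesis (c • γ) = c • synthesis γ := by
  funext p
  simp only [synthesis, Pi.smul_apply, smul_eq_mul, mul_assoc]
  exact integral_const_mul _ _

theorem synthesis_congr_ae {γ γ' : ℤ × ℝ → ℂ} (h : γ =ᵐ[modeMeasure] γ') :
    synthesis γ = synthesis γ' := by
  funext p
  refine integral_congr_ae ?_
  filter_upwards [h] with q hq
  rw [hq]

/-- The integrable elements of `L²(ℤ × ℝ)`. -/
noncomputable def integrableModes : Submodule ℂ (Lp ℂ 2 modeMeasure) where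
  carrier := {γ | Integrable γ modeMeasure}
  add_mem' {a b} ha hb := (integrable_congr (Lp.coeFn_add a b)).2 (ha.add hb)
  zero_mem' := (integrable_congr (Lp.coeFn_zero ℂ 2 modeMeasure)).2 (integrable_zero _ _ _)
  smul_mem' c a ha := (integrable_congr (Lp.coeFn_smul c a)).2 (Integrable.smul c ha)

/-- Synthesis on the integrable elements of `L²(ℤ × ℝ)`. -/
noncomputable def synthesisLinear : integrableModes →ₗ[ℂ] Lp ℂ 2 stripMeasure where
  toFun γ := (memLp_synthesis γ.2 (Lp.memLp γ.1)).toLp _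
  map_add' a b := by
    rw [← MemLp.toLp_add]
    congr 1
    rw [← synthesis_add a.2 b.2]
    exact synthesis_congr_ae (Lp.coeFn_add a.1 b.1)
  map_smul' c a := by
    rw [RingHom.id_apply, ← MemLp.toLp_const_smul]
    congr 1
    rw [← synthesis_smul]
    exact synthesis_congr_ae (Lp.coeFn_smul c a.1)

theorem norm_synthesisLinear (γ : integrableModes) : ‖synthesisLinear γ‖ = ‖γ.1‖ := by
  rw [← enorm_eq_iff_norm_eq]
  have h : ‖synthesisLinear γ‖ₑ ^ 2 = ‖γ.1‖ₑ ^ 2 := by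
    change ‖(memLp_synthesis γ.2 (Lp.memLp γ.1)).toLp _‖ₑ ^ 2 = _
    rw [enorm_toLp_sq, lintegral_synthesis_sq γ.2 (Lp.memLp γ.1), ← eLpNorm_two_sq, Lp.enorm_def]
  exact (ENNReal.pow_right_strictMono two_ne_zero).injective h

/-- Square-integrable simple functions are integrable, having support of finite measure. -/
theorem denseRange_integrableModes : DenseRange integrableModes.subtype := by
  have h := Lp.simpleFunc.denseRange (E := ℂ) (μ := modeMeasure) (p := 2) ENNReal.ofNat_ne_top
  refine h.mono ?_
  rintro _ ⟨γ, rfl⟩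
  refine ⟨⟨γ, ?_⟩, rfl⟩
  refine (integrable_congr (Lp.simpleFunc.toSimpleFunc_eq_toFun γ)).1 ?_
  exact (SimpleFunc.memLp_iff_integrable two_ne_zero ENNReal.ofNat_ne_top).1
    (Lp.simpleFunc.memLp γ)

/-- The inverse Fourier transform `L²(ℤ × ℝ) → L²(ℝ × [0,1])`. -/
theorem exists_synthesis_isometry :
    ∃ T : Lp ℂ 2 modeMeasure →ₗᵢ[ℂ] Lp ℂ 2 stripMeasure,
      ∀ (γ : ℤ × ℝ → ℂ) (h1 : Integrable γ modeMeasure) (h2 : MemLp γ 2 modeMeasure),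
        T (h2.toLp γ) = (memLp_synthesis h1 h2).toLp _ := by
  have hb : ∃ C, ∀ γ, ‖synthesisLinear γ‖ ≤ C * ‖integrableModes.subtype γ‖ :=
    ⟨1, fun γ => by rw [one_mul]; exact (norm_synthesisLinear γ).le⟩
  have hext := LinearMap.extendOfNorm_eq denseRange_integrableModes hb
  refine ⟨⟨synthesisLinear.extendOfNorm integrableModes.subtype, fun γ => ?_⟩, fun γ h1 h2 => ?_⟩
  · refine denseRange_integrableModes.induction_on
      (p := fun γ => ‖synthesisLinear.extendOfNorm integrableModes.subtype γ‖ = ‖γ‖) γ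
      (isClosed_eq (by fun_prop) (by fun_prop)) fun γ => ?_
    rw [hext]
    exact norm_synthesisLinear γ
  · have := hext ⟨h2.toLp γ, (integrable_congr h2.coeFn_toLp).2 h1⟩
    refine this.trans ?_
    exact MemLp.toLp_congr (memLp_synthesis ((integrable_congr h2.coeFn_toLp).2 h1) (Lp.memLp _))
      (memLp_synthesis h1 h2) (EventuallyEq.of_eq (synthesis_congr_ae h2.coeFn_toLp))

end Synthesis

end Worm

namespace Worm

/-! ### Functions on the worm domain with given Fourier modes -/

section Modes

/-- The imaginary part of the first coordinate on the slices. -/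
noncomputable def sliceY (k : Fin 4) (t s : ℝ) : ℝ := ![s + t, -(s + t), s - t, -(s - t)] k

/-- The logarithm of `|z₂|²` on the slices. -/
noncomputable def sliceU (k : Fin 4) (s : ℝ) : ℝ := ![s, -s, s, -s] k

theorem slice_eq_point (k : Fin 4) (t s : ℝ) : slice k t s = point (sliceY k t s) (sliceU k s) := by
  fin_cases k <;> rfl

theorem abs_sliceU (k : Fin 4) {s : ℝ} (hs : 0 ≤ s) : |sliceU k s| = s := by
  fin_cases k <;> simp [sliceU, abs_of_nonneg hs]

theorem abs_sliceY_sub (k : Fin 4) {t : ℝ} (s : ℝ) (ht : 0 ≤ t) :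
    |sliceY k t s - sliceU k s| = t := by
  fin_cases k <;> simp [sliceY, sliceU, abs_of_nonneg ht]

/-- The modulus of the mode `z₂ʲ e^{2πiηz₁}` at `Im z₁ = y`, `log |z₂|² = u`. -/
noncomputable def modeAbs (y u : ℝ) (q : ℤ × ℝ) : ℝ :=
  Real.exp (q.1 * u / 2 - 2 * Real.pi * q.2 * y)

/-- The sum of the squares of the moduli of a mode over the four slices. -/
noncomputable def modeWeight (t s : ℝ) (q : ℤ × ℝ) : ℝ :=
  4 * Real.cosh (4 * Real.pi * q.2 * t) * Real.cosh ((4 * Real.pi * q.2 - q.1) * s)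

/-- The mode `z₂ʲ e^{2πiηz₁}`. -/
noncomputable def mode (z : ℂ × ℂ) (q : ℤ × ℝ) : ℂ :=
  z.2 ^ q.1 * Complex.exp (2 * Real.pi * Complex.I * q.2 * z.1)

theorem modeWeight_pos (t s : ℝ) (q : ℤ × ℝ) : 0 < modeWeight t s q := by
  unfold modeWeight
  have := Real.cosh_pos (4 * Real.pi * q.2 * t)
  have := Real.cosh_pos ((4 * Real.pi * q.2 - q.1) * s)
  positivity

theorem modeAbs_pos (y u : ℝ) (q : ℤ × ℝ) : 0 < modeAbs y u q := Real.exp_pos _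

/-- The exponents of the four squares are `±4πηt ± (4πη - j)s` with all choices of signs, so their
sum factors into two hyperbolic cosines. -/
theorem sum_modeAbs_sq (t s : ℝ) (q : ℤ × ℝ) :
    ∑ k : Fin 4, modeAbs (sliceY k t s) (sliceU k s) q ^ 2 = modeWeight t s q := by
  simp only [Fin.sum_univ_four, modeAbs, sliceY, sliceU, modeWeight, Real.cosh_eq,
    ← Real.exp_nat_mul]
  simp only [Matrix.cons_val]
  ring_nf
  simp only [← Real.exp_add]
  ring_nf

theorem modeAbs_sq_le (k : Fin 4) (t s : ℝ) (q : ℤ × ℝ) :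
    modeAbs (sliceY k t s) (sliceU k s) q ^ 2 ≤ modeWeight t s q := by
  rw [← sum_modeAbs_sq]
  exact Finset.single_le_sum (f := fun k => modeAbs (sliceY k t s) (sliceU k s) q ^ 2)
    (fun _ _ => sq_nonneg _) (Finset.mem_univ k)

theorem cosh_mul_le_cosh_mul {a t t' : ℝ} (ht : 0 ≤ t) (h : t ≤ t') :
    Real.cosh (a * t) ≤ Real.cosh (a * t') := by
  rw [Real.cosh_le_cosh, abs_mul, abs_mul, abs_of_nonneg ht, abs_of_nonneg (ht.trans h)]
  gcongr

theorem modeWeight_mono {t t' s s' : ℝ} (ht : 0 ≤ t) (h : t ≤ t') (hs : 0 ≤ s) (h' : s ≤ s')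
    (q : ℤ × ℝ) : modeWeight t s q ≤ modeWeight t' s' q := by
  unfold modeWeight
  gcongr 4 * ?_ * ?_
  · exact cosh_mul_le_cosh_mul ht h
  · exact cosh_mul_le_cosh_mul hs h'

theorem exp_le_two_mul_cosh {a b : ℝ} (h : |a| ≤ |b|) : Real.exp a ≤ 2 * Real.cosh b := by
  have h1 := Real.cosh_le_cosh.2 h
  rw [Real.cosh_eq a] at h1
  linarith [Real.exp_pos (-a)]

/-- The exponent splits as `-4πη(y - u) - (4πη - j)u`, and the two inequalities defining the domain
control one summand each. -/
theorem modeAbs_sq_le_of_abs_le {y u t s : ℝ} (h1 : |y - u| ≤ t) (h2 : |u| ≤ s) (q : ℤ × ℝ) :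
    modeAbs y u q ^ 2 ≤ modeWeight t s q := by
  have e : modeAbs y u q ^ 2 = Real.exp (-(4 * Real.pi * q.2 * (y - u))) *
      Real.exp (-((4 * Real.pi * q.2 - q.1) * u)) := by
    rw [modeAbs, ← Real.exp_nat_mul, ← Real.exp_add]
    congr 1; push_cast; ring
  rw [e, modeWeight]
  have ht := (abs_nonneg _).trans h1
  have hs := (abs_nonneg _).trans h2
  calc _ ≤ (2 * Real.cosh (4 * Real.pi * q.2 * t)) *
        (2 * Real.cosh ((4 * Real.pi * q.2 - q.1) * s)) := by
        refine mul_le_mul (exp_le_two_mul_cosh ?_) (exp_le_two_mul_cosh ?_) (Real.exp_nonneg _)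
          (mul_nonneg zero_le_two (Real.cosh_pos _).le)
        · rw [abs_neg, abs_mul, abs_mul _ t, abs_of_nonneg ht]
          gcongr
        · rw [abs_neg, abs_mul, abs_mul _ s, abs_of_nonneg hs]
          gcongr
    _ = _ := by ring

theorem measurable_intCast_fst : Measurable fun q : ℤ × ℝ => (q.1 : ℝ) :=
  (measurable_from_top (f := fun j : ℤ => (j : ℝ))).comp measurable_fst

theorem measurable_modeAbs (y u : ℝ) : Measurable (modeAbs y u) := by
  have := measurable_intCast_fst
  unfold modeAbs
  fun_prop

theorem measurable_modeWeight (t s : ℝ) : Measurable (modeWeight t s) := by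
  have := measurable_intCast_fst
  unfold modeWeight
  simp only [Real.cosh_eq]
  fun_prop

theorem measurable_mode (z : ℂ × ℂ) : Measurable (mode z) := by
  have h : Measurable fun q : ℤ × ℝ => z.2 ^ q.1 :=
    (measurable_from_top (f := fun j : ℤ => z.2 ^ j)).comp measurable_fst
  unfold mode
  fun_prop

theorem integrable_exp_neg_mode {c : ℝ} (hc : 0 < c) :
    Integrable (fun q : ℤ × ℝ => Real.exp (-(c * |(q.1 : ℝ)|)) * Real.exp (-(c * |q.2|)))
      modeMeasure := by
  refine Integrable.mul_prod (f := fun j : ℤ => Real.exp (-(c * |(j : ℝ)|)))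
    (g := fun η : ℝ => Real.exp (-(c * |η|))) ?_ (integrable_exp_neg_mul_abs hc)
  rw [integrable_count_iff]
  have h : Summable fun n : ℕ => Real.exp (-(c * |((n : ℤ) : ℝ)|)) := by
    refine (Real.summable_exp_nat_mul_iff.2 (neg_lt_zero.2 hc)).congr fun n => ?_
    rw [Int.cast_natCast, Nat.abs_cast]
    congr 1; ring
  refine Summable.of_nat_of_neg ?_ ?_
  · simpa using h
  · simpa using h

theorem cosh_mul_div_le {a t t' : ℝ} (ht : 0 ≤ t) :
    Real.cosh (a * t) ≤ 2 * Real.exp (-((t' - t) * |a|)) * Real.cosh (a * t') := by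
  have h1 : Real.cosh (a * t) ≤ Real.exp (|a| * t) := by
    rw [← Real.cosh_abs, abs_mul, abs_of_nonneg ht, Real.cosh_eq]
    have : Real.exp (-(|a| * t)) ≤ Real.exp (|a| * t) :=
      Real.exp_le_exp.2 (by have := mul_nonneg (abs_nonneg a) ht; linarith)
    linarith
  have h2 : Real.exp (|a| * t') ≤ 2 * Real.cosh (a * t') :=
    exp_le_two_mul_cosh (by rw [abs_mul, abs_mul, abs_abs])
  calc _ ≤ Real.exp (|a| * t) := h1
    _ = Real.exp (-((t' - t) * |a|)) * Real.exp (|a| * t') := by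
        rw [← Real.exp_add]; congr 1; ring
    _ ≤ Real.exp (-((t' - t) * |a|)) * (2 * Real.cosh (a * t')) := by gcongr
    _ = _ := by ring

/-- The quotient decays exponentially in the linear forms `4πη` and `4πη - j`, which together
control `|j|` and `|η|`. This is the source of all convergence in the interior of the domain. -/
theorem integrable_modeWeight_div {t t' s s' : ℝ} (ht : 0 ≤ t) (h : t < t') (hs : 0 ≤ s)
    (h' : s < s') : Integrable (fun q => modeWeight t s q / modeWeight t' s' q) modeMeasure := by
  -- Half of the decay in `|4πη|` pays for `|η|`; the other half, with the decay in `|4πη - j|`,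
  -- pays for `|j|`.
  set c := min ((t' - t) / 2) (min (s' - s) ((t' - t) / 2)) with hc
  have hc0 : 0 < c := by
    have := sub_pos.2 h
    have := sub_pos.2 h'
    simp only [hc, lt_min_iff]
    constructor <;> [skip; constructor] <;> linarith
  have hc1 : c ≤ (t' - t) / 2 := min_le_left _ _
  have hc2 : c ≤ s' - s := (min_le_right _ _).trans (min_le_left _ _)
  refine ((integrable_exp_neg_mode hc0).const_mul 4).mono'
    ((measurable_modeWeight t s).div (measurable_modeWeight t' s')).aestronglyMeasurable
    (ae_of_all _ fun q => ?_)
  rw [Real.norm_of_nonneg (div_pos (modeWeight_pos _ _ _) (modeWeight_pos _ _ _)).le,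
    div_le_iff₀ (modeWeight_pos _ _ _)]
  have hA := cosh_mul_div_le (a := 4 * Real.pi * q.2) (t' := t') ht
  have hB := cosh_mul_div_le (a := 4 * Real.pi * q.2 - q.1) (t' := s') hs
  have hexp : Real.exp (-((t' - t) * |4 * Real.pi * q.2|)) *
      Real.exp (-((s' - s) * |4 * Real.pi * q.2 - q.1|)) ≤
      Real.exp (-(c * |(q.1 : ℝ)|)) * Real.exp (-(c * |q.2|)) := by
    rw [← Real.exp_add, ← Real.exp_add, Real.exp_le_exp]
    have h1 : |(q.1 : ℝ)| ≤ |4 * Real.pi * q.2| + |4 * Real.pi * q.2 - q.1| := by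
      have := abs_sub (4 * Real.pi * q.2) (4 * Real.pi * q.2 - q.1)
      simpa using this
    have h2 : |q.2| ≤ |4 * Real.pi * q.2| := by
      rw [abs_mul, abs_of_pos (by positivity : 0 < 4 * Real.pi)]
      nlinarith [abs_nonneg q.2, Real.pi_gt_three]
    have h3 := abs_nonneg (4 * Real.pi * q.2)
    have h4 := abs_nonneg (4 * Real.pi * q.2 - q.1)
    have h5 : c * |(q.1 : ℝ)| ≤ c * (|4 * Real.pi * q.2| + |4 * Real.pi * q.2 - q.1|) := by gcongr
    have h6 : c * |q.2| ≤ c * |4 * Real.pi * q.2| := by gcongr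
    have h7 : c * |4 * Real.pi * q.2| ≤ (t' - t) / 2 * |4 * Real.pi * q.2| := by gcongr
    have h8 : c * |4 * Real.pi * q.2 - q.1| ≤ (s' - s) * |4 * Real.pi * q.2 - q.1| := by gcongr
    linarith
  unfold modeWeight
  have hpos := mul_pos (Real.cosh_pos (4 * Real.pi * q.2 * t'))
    (Real.cosh_pos ((4 * Real.pi * q.2 - q.1) * s'))
  calc _ = 4 * (Real.cosh (4 * Real.pi * q.2 * t) * Real.cosh ((4 * Real.pi * q.2 - q.1) * s)) := by
        ring
    _ ≤ 4 * ((2 * Real.exp (-((t' - t) * |4 * Real.pi * q.2|)) *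
          Real.cosh (4 * Real.pi * q.2 * t')) *
        (2 * Real.exp (-((s' - s) * |4 * Real.pi * q.2 - q.1|)) *
          Real.cosh ((4 * Real.pi * q.2 - q.1) * s'))) := by
        refine mul_le_mul_of_nonneg_left (mul_le_mul hA hB (Real.cosh_pos _).le ?_) (by norm_num)
        exact (Real.cosh_pos _).le.trans hA
    _ = 16 * (Real.exp (-((t' - t) * |4 * Real.pi * q.2|)) *
          Real.exp (-((s' - s) * |4 * Real.pi * q.2 - q.1|))) *
          (Real.cosh (4 * Real.pi * q.2 * t') * Real.cosh ((4 * Real.pi * q.2 - q.1) * s')) := by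
        ring
    _ ≤ 16 * (Real.exp (-(c * |(q.1 : ℝ)|)) * Real.exp (-(c * |q.2|))) *
          (Real.cosh (4 * Real.pi * q.2 * t') * Real.cosh ((4 * Real.pi * q.2 - q.1) * s')) := by
        gcongr
    _ = _ := by ring

theorem log_norm_sq_point (y u : ℝ) (p : ℝ × ℝ) : Real.log (‖(point y u p).2‖ ^ 2) = u := by
  have : ‖(point y u p).2‖ = Real.exp (u / 2) := by
    rw [point, norm_mul, Complex.norm_real, Real.norm_eq_abs, Real.abs_exp,
      show (2 * Real.pi * Complex.I * p.2 : ℂ) = ((2 * Real.pi * p.2 : ℝ) : ℂ) * Complex.I by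
        push_cast; ring, Complex.norm_exp_ofReal_mul_I, mul_one]
  rw [this, Real.log_pow, Real.log_exp]
  push_cast; ring

theorem point_mem_domain {β y u : ℝ} (h1 : |y - u| < Real.pi / 2) (h2 : |u| < β - Real.pi / 2)
    (p : ℝ × ℝ) : point y u p ∈ domain β := by
  refine ⟨?_, ?_, ?_⟩
  · simp [point]
  · rw [log_norm_sq_point]
    simpa [point] using h1
  · rwa [log_norm_sq_point]

theorem continuous_point (y u : ℝ) : Continuous (point y u) := by
  unfold point
  fun_prop

theorem mode_point (y u : ℝ) (p : ℝ × ℝ) (q : ℤ × ℝ) : mode (point y u p) q =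
    (modeAbs y u q : ℂ) * Complex.exp (2 * Real.pi * Complex.I * (q.1 * p.2 + q.2 * p.1)) := by
  simp only [mode, point, modeAbs]
  rw [mul_zpow, Complex.ofReal_exp, Complex.ofReal_exp, ← Complex.exp_int_mul,
    ← Complex.exp_int_mul, ← Complex.exp_add, ← Complex.exp_add, ← Complex.exp_add]
  congr 1
  push_cast
  linear_combination (2 * Real.pi * q.2 * y : ℂ) * Complex.I_mul_I

theorem exists_eq_point {z : ℂ × ℂ} (hz : z.2 ≠ 0) :
    ∃ p : ℝ × ℝ, z = point z.1.im (Real.log (‖z.2‖ ^ 2)) p := by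
  refine ⟨(z.1.re, z.2.arg / (2 * Real.pi)), Prod.ext ?_ ?_⟩
  · exact (Complex.re_add_im z.1).symm
  · have h1 : Real.exp (Real.log (‖z.2‖ ^ 2) / 2) = ‖z.2‖ := by
      rw [Real.log_pow, Nat.cast_ofNat, mul_div_cancel_left₀ _ two_ne_zero,
        Real.exp_log (norm_pos_iff.2 hz)]
    simp only [point, h1]
    conv_lhs => rw [← Complex.norm_mul_exp_arg_mul_I z.2]
    congr 2
    have := Real.pi_ne_zero
    push_cast
    field_simp

theorem norm_mode {z : ℂ × ℂ} (hz : z.2 ≠ 0) (q : ℤ × ℝ) :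
    ‖mode z q‖ = modeAbs z.1.im (Real.log (‖z.2‖ ^ 2)) q := by
  obtain ⟨p, hp⟩ := exists_eq_point hz
  conv_lhs => rw [hp]
  rw [mode_point, norm_mul, norm_character, mul_one, Complex.norm_real, Real.norm_eq_abs,
    abs_of_pos (modeAbs_pos _ _ _)]

end Modes

end Worm

namespace Worm

/-! ### From square-integrable modes to Hardy functions -/

section HardySynthesis

/-- The square-integrable families of modes on the distinguished boundary. -/
def IsHardyModes (β : ℝ) (g : ℤ × ℝ → ℂ) : Prop :=
  Measurable g ∧
    ∫⁻ q, ‖g q‖ₑ ^ 2 * ENNReal.ofReal (modeWeight (Real.pi / 2) (β - Real.pi / 2) q) ∂modeMeasure < ⊤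

/-- The function with the given modes. -/
noncomputable def hardySynthesis (g : ℤ × ℝ → ℂ) (z : ℂ × ℂ) : ℂ :=
  ∫ q, g q * mode z q ∂modeMeasure

theorem enorm_mul_ofReal_sq (z : ℂ) {a w : ℝ} (ha : 0 ≤ a) (h : a ^ 2 = w) :
    ‖z * (a : ℂ)‖ₑ ^ 2 = ‖z‖ₑ ^ 2 * ENNReal.ofReal w := by
  rw [enorm_mul, mul_pow, ← h, ENNReal.ofReal_pow ha, ← ofReal_norm (a : ℂ), Complex.norm_real,
    Real.norm_of_nonneg ha]

theorem IsHardyModes.integrable_sq {β : ℝ} {g : ℤ × ℝ → ℂ} (hg : IsHardyModes β g) :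
    Integrable (fun q => ‖g q‖ ^ 2 * modeWeight (Real.pi / 2) (β - Real.pi / 2) q)
      modeMeasure := by
  have hw := measurable_modeWeight (Real.pi / 2) (β - Real.pi / 2)
  refine ⟨((hg.1.norm.pow_const 2).mul hw).aestronglyMeasurable, ?_⟩
  rw [hasFiniteIntegral_iff_enorm]
  refine lt_of_eq_of_lt (lintegral_congr fun q => ?_) hg.2
  rw [Real.enorm_of_nonneg (mul_nonneg (sq_nonneg _) (modeWeight_pos _ _ _).le),
    ENNReal.ofReal_mul (sq_nonneg _), ENNReal.ofReal_pow (norm_nonneg _), ofReal_norm]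

variable {β t s y u : ℝ} {g : ℤ × ℝ → ℂ}

/-- Write `W` for the boundary weight and `w` for the weight at `(t, s)`. Then `‖g‖√w` is the
product of `‖g‖√W` and `√(w/W)`, whose squares are both integrable. -/
theorem IsHardyModes.integrable_dominating (hg : IsHardyModes β g) (ht : 0 ≤ t)
    (ht' : t < Real.pi / 2) (hs : 0 ≤ s) (hs' : s < β - Real.pi / 2) :
    Integrable (fun q => ‖g q‖ * √(modeWeight t s q)) modeMeasure := by
  refine (hg.integrable_sq.add (integrable_modeWeight_div ht ht' hs hs')).mono'
    (hg.1.norm.mul (measurable_modeWeight t s).sqrt).aestronglyMeasurable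
    (ae_of_all _ fun q => ?_)
  rw [Real.norm_of_nonneg (mul_nonneg (norm_nonneg _) (Real.sqrt_nonneg _))]
  set W := modeWeight (Real.pi / 2) (β - Real.pi / 2) q
  set w := modeWeight t s q
  have hW : 0 < W := modeWeight_pos _ _ _
  have hw : 0 < w := modeWeight_pos _ _ _
  have e : √w = √W * √(w / W) := by
    rw [← Real.sqrt_mul hW.le, mul_div_cancel₀ _ hW.ne']
  have h1 : (‖g q‖ * √W) ^ 2 = ‖g q‖ ^ 2 * W := by rw [mul_pow, Real.sq_sqrt hW.le]
  have h2 : √(w / W) ^ 2 = w / W := Real.sq_sqrt (div_pos hw hW).le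
  change ‖g q‖ * √w ≤ ‖g q‖ ^ 2 * W + w / W
  calc ‖g q‖ * √w = (‖g q‖ * √W) * √(w / W) := by rw [e, mul_assoc]
    _ ≤ (‖g q‖ * √W) ^ 2 + √(w / W) ^ 2 := by
        nlinarith [sq_nonneg (‖g q‖ * √W - √(w / W)), sq_nonneg (‖g q‖ * √W), sq_nonneg √(w / W)]
    _ = _ := by rw [h1, h2]

theorem modeAbs_le_sqrt (h1 : |y - u| ≤ t) (h2 : |u| ≤ s) (q : ℤ × ℝ) :
    modeAbs y u q ≤ √(modeWeight t s q) :=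
  Real.le_sqrt_of_sq_le (modeAbs_sq_le_of_abs_le h1 h2 q)

theorem IsHardyModes.integrable_mul_modeAbs (hg : IsHardyModes β g) (h1 : |y - u| < Real.pi / 2)
    (h2 : |u| < β - Real.pi / 2) :
    Integrable (fun q => g q * (modeAbs y u q : ℂ)) modeMeasure := by
  refine (hg.integrable_dominating (abs_nonneg _) h1 (abs_nonneg _) h2).mono'
    (hg.1.mul (measurable_modeAbs y u).complex_ofReal).aestronglyMeasurable
    (ae_of_all _ fun q => ?_)
  rw [norm_mul, Complex.norm_real, Real.norm_of_nonneg (modeAbs_pos _ _ _).le]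
  gcongr
  exact modeAbs_le_sqrt le_rfl le_rfl q

theorem IsHardyModes.memLp_mul_modeAbs (hg : IsHardyModes β g) (h1 : |y - u| ≤ Real.pi / 2)
    (h2 : |u| ≤ β - Real.pi / 2) :
    MemLp (fun q => g q * (modeAbs y u q : ℂ)) 2 modeMeasure := by
  refine memLp_two_of_lintegral
    (hg.1.mul (measurable_modeAbs y u).complex_ofReal).aestronglyMeasurable
    (lt_of_le_of_lt (lintegral_mono fun q => ?_) hg.2)
  rw [enorm_mul_ofReal_sq _ (modeAbs_pos _ _ _).le rfl]
  gcongr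
  exact modeAbs_sq_le_of_abs_le h1 h2 q

theorem hardySynthesis_point (g : ℤ × ℝ → ℂ) (y u : ℝ) (p : ℝ × ℝ) :
    hardySynthesis g (point y u p) = synthesis (fun q => g q * (modeAbs y u q : ℂ)) p := by
  simp only [hardySynthesis, synthesis, mode_point, mul_assoc]

/-- The subset of the worm domain on which the modes are uniformly dominated. -/
def subdomain (t s : ℝ) : Set (ℂ × ℂ) :=
  {z | z.2 ≠ 0 ∧ |z.1.im - Real.log (‖z.2‖ ^ 2)| < t ∧ |Real.log (‖z.2‖ ^ 2)| < s}

theorem isOpen_subdomain (t s : ℝ) : IsOpen (subdomain t s) := by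
  have h0 : IsOpen {z : ℂ × ℂ | z.2 ≠ 0} := isOpen_ne_fun continuous_snd continuous_const
  have hlog : ContinuousOn (fun z : ℂ × ℂ => Real.log (‖z.2‖ ^ 2)) {z : ℂ × ℂ | z.2 ≠ 0} :=
    ContinuousOn.log (by fun_prop) fun z hz => by simpa using hz
  have h1 : ContinuousOn (fun z : ℂ × ℂ => (|z.1.im - Real.log (‖z.2‖ ^ 2)|,
      |Real.log (‖z.2‖ ^ 2)|)) {z : ℂ × ℂ | z.2 ≠ 0} := by fun_prop
  exact h1.isOpen_inter_preimage h0 (isOpen_Iio.prod (isOpen_Iio (a := s)))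

theorem isOpen_domain (β : ℝ) : IsOpen (domain β) := isOpen_subdomain _ _

theorem differentiableAt_mode {z : ℂ × ℂ} (hz : z.2 ≠ 0) (q : ℤ × ℝ) :
    DifferentiableAt ℂ (fun z => mode z q) z := by
  unfold mode
  refine DifferentiableAt.mul ?_ (by fun_prop)
  exact (differentiableAt_zpow.2 (Or.inl hz)).comp z differentiableAt_snd

theorem IsHardyModes.differentiableOn (hg : IsHardyModes β g) :
    DifferentiableOn ℂ (hardySynthesis g) (domain β) := by
  intro z hz
  obtain ⟨t, ht, ht'⟩ := exists_between hz.2.1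
  obtain ⟨s, hs, hs'⟩ := exists_between hz.2.2
  have hmem : z ∈ subdomain t s := ⟨hz.1, ht, hs⟩
  have key := differentiableOn_integral_of_dominated (μ := modeMeasure)
    (f := fun z q => g q * mode z q) (isOpen_subdomain t s)
    (hg.integrable_dominating ((abs_nonneg _).trans ht.le) ht' ((abs_nonneg _).trans hs.le) hs')
    (fun p _ => (hg.1.mul (measurable_mode p)).aestronglyMeasurable)
    (fun q p hp => ((differentiableAt_mode hp.1 q).const_mul _).differentiableWithinAt)
    (fun p hp q => by
      rw [norm_mul, norm_mode hp.1]
      gcongr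
      exact modeAbs_le_sqrt hp.2.1.le hp.2.2.le q)
  exact (key.differentiableAt ((isOpen_subdomain t s).mem_nhds hmem)).differentiableWithinAt

theorem IsHardyModes.integrable_mul_mode (hg : IsHardyModes β g) {z : ℂ × ℂ}
    (hz : z ∈ domain β) : Integrable (fun q => g q * mode z q) modeMeasure := by
  refine (hg.integrable_dominating (abs_nonneg _) hz.2.1 (abs_nonneg _) hz.2.2).mono'
    (hg.1.mul (measurable_mode z)).aestronglyMeasurable (ae_of_all _ fun q => ?_)
  rw [norm_mul, norm_mode hz.1]
  gcongr
  exact modeAbs_le_sqrt le_rfl le_rfl q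

/-- Plancherel on each of the four slices; the weights add up to `modeWeight`. -/
theorem IsHardyModes.sliceIntegral_eq (hg : IsHardyModes β g)
    (ht : t ∈ Set.Ico (0 : ℝ) (Real.pi / 2)) (hs : s ∈ Set.Ico (0 : ℝ) (β - Real.pi / 2)) :
    sliceIntegral (hardySynthesis g) t s =
      ∫⁻ q, ‖g q‖ₑ ^ 2 * ENNReal.ofReal (modeWeight t s q) ∂modeMeasure := by
  have hk : ∀ k : Fin 4, ∫⁻ p, ‖hardySynthesis g (slice k t s p)‖ₑ ^ 2 ∂stripMeasure =
      ∫⁻ q, ‖g q‖ₑ ^ 2 * ENNReal.ofReal (modeAbs (sliceY k t s) (sliceU k s) q ^ 2)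
        ∂modeMeasure := by
    intro k
    have h1 : |sliceY k t s - sliceU k s| < Real.pi / 2 := by rw [abs_sliceY_sub k s ht.1]; exact ht.2
    have h2 : |sliceU k s| < β - Real.pi / 2 := by rw [abs_sliceU k hs.1]; exact hs.2
    simp only [slice_eq_point, hardySynthesis_point]
    rw [lintegral_synthesis_sq (hg.integrable_mul_modeAbs h1 h2)
      (hg.memLp_mul_modeAbs h1.le h2.le)]
    exact lintegral_congr fun q => enorm_mul_ofReal_sq _ (modeAbs_pos _ _ _).le rfl
  simp only [sliceIntegral, hk]
  rw [← lintegral_finsetSum]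
  · refine lintegral_congr fun q => ?_
    rw [← Finset.mul_sum, ← ENNReal.ofReal_sum_of_nonneg fun _ _ => sq_nonneg _, sum_modeAbs_sq]
  · exact fun k _ => (hg.1.enorm.pow_const 2).mul
      ((measurable_modeAbs _ _).pow_const 2).ennreal_ofReal

theorem IsHardyModes.memHardy (hg : IsHardyModes β g) : MemHardy β (hardySynthesis g) := by
  refine ⟨hg.differentiableOn, lt_of_le_of_lt ?_ hg.2⟩
  refine iSup₂_le fun t ht => iSup₂_le fun s hs => ?_
  rw [hg.sliceIntegral_eq ht hs]
  refine lintegral_mono fun q => ?_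
  gcongr
  exact modeWeight_mono ht.1 ht.2.le hs.1 hs.2.le q

/-- Dominated convergence on the Fourier side: the weights increase with `(t, s)`, so `(a - b)² ≤
2a² + 2b²` bounds the integrand by four times the integrand of the Hardy norm. -/
theorem IsHardyModes.tendsto_slice_modes (hg : IsHardyModes β g) (hβ : Real.pi / 2 < β)
    (k : Fin 4) :
    Tendsto (fun r : ℝ × ℝ => ∫⁻ q, ‖g q * (modeAbs (sliceY k r.1 r.2) (sliceU k r.2) q : ℂ) -
      g q * (modeAbs (sliceY k (Real.pi / 2) (β - Real.pi / 2))
        (sliceU k (β - Real.pi / 2)) q : ℂ)‖ₑ ^ 2 ∂modeMeasure)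
      (𝓝[<] (Real.pi / 2) ×ˢ 𝓝[<] (β - Real.pi / 2)) (𝓝 0) := by
  have hlim : ∀ q, Tendsto (fun r : ℝ × ℝ =>
      ‖g q * (modeAbs (sliceY k r.1 r.2) (sliceU k r.2) q : ℂ) -
      g q * (modeAbs (sliceY k (Real.pi / 2) (β - Real.pi / 2))
        (sliceU k (β - Real.pi / 2)) q : ℂ)‖ₑ ^ 2)
      (𝓝[<] (Real.pi / 2) ×ˢ 𝓝[<] (β - Real.pi / 2)) (𝓝 0) := by
    intro q
    have hc : Continuous fun r : ℝ × ℝ =>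
        ‖g q * (modeAbs (sliceY k r.1 r.2) (sliceU k r.2) q : ℂ) -
        g q * (modeAbs (sliceY k (Real.pi / 2) (β - Real.pi / 2))
          (sliceU k (β - Real.pi / 2)) q : ℂ)‖ₑ ^ 2 := by
      have : Continuous fun r : ℝ × ℝ => modeAbs (sliceY k r.1 r.2) (sliceU k r.2) q := by
        unfold modeAbs
        fin_cases k <;> simp [sliceY, sliceU] <;> fun_prop
      fun_prop
    have := hc.tendsto (Real.pi / 2, β - Real.pi / 2)
    simp only [sub_self, enorm_zero, ne_eq, OfNat.ofNat_ne_zero, not_false_eq_true,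
      zero_pow] at this
    refine this.mono_left ?_
    rw [nhds_prod_eq]
    exact Filter.prod_mono nhdsWithin_le_nhds nhdsWithin_le_nhds
  have key := tendsto_lintegral_filter_of_dominated_convergence (μ := modeMeasure)
    (l := 𝓝[<] (Real.pi / 2) ×ˢ 𝓝[<] (β - Real.pi / 2))
    (F := fun (r : ℝ × ℝ) q => ‖g q * (modeAbs (sliceY k r.1 r.2) (sliceU k r.2) q : ℂ) -
      g q * (modeAbs (sliceY k (Real.pi / 2) (β - Real.pi / 2))
        (sliceU k (β - Real.pi / 2)) q : ℂ)‖ₑ ^ 2) (f := fun _ => 0)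
    (fun q => 4 * (‖g q‖ₑ ^ 2 *
      ENNReal.ofReal (modeWeight (Real.pi / 2) (β - Real.pi / 2) q)))
    (Eventually.of_forall fun r => ?_) ?_ ?_ (ae_of_all _ hlim)
  · simpa using key
  · exact (((hg.1.mul (measurable_modeAbs _ _).complex_ofReal).sub
      (hg.1.mul (measurable_modeAbs _ _).complex_ofReal)).enorm.pow_const 2)
  · have e1 : ∀ᶠ x in 𝓝[<] (Real.pi / 2), x ∈ Set.Ioo 0 (Real.pi / 2) :=
      Ioo_mem_nhdsLT (by positivity)
    have e2 : ∀ᶠ x in 𝓝[<] (β - Real.pi / 2), x ∈ Set.Ioo 0 (β - Real.pi / 2) :=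
      Ioo_mem_nhdsLT (by linarith)
    filter_upwards [e1.prod_mk e2] with r hr
    refine ae_of_all _ fun q => ?_
    set W := modeWeight (Real.pi / 2) (β - Real.pi / 2) q with hW
    set a := modeAbs (sliceY k r.1 r.2) (sliceU k r.2) q with ha
    set b := modeAbs (sliceY k (Real.pi / 2) (β - Real.pi / 2)) (sliceU k (β - Real.pi / 2)) q with hb
    have ha2 : a ^ 2 ≤ W := (modeAbs_sq_le k _ _ q).trans
      (modeWeight_mono hr.1.1.le hr.1.2.le hr.2.1.le hr.2.2.le q)
    have hb2 : b ^ 2 ≤ W := modeAbs_sq_le k _ _ q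
    have hWp : 0 ≤ W := (modeWeight_pos _ _ _).le
    rw [← mul_sub, ← Complex.ofReal_sub, enorm_mul, mul_pow, ← ofReal_norm ((a - b : ℝ) : ℂ),
      Complex.norm_real, ← ENNReal.ofReal_pow (norm_nonneg _), Real.norm_eq_abs, sq_abs,
      mul_left_comm]
    gcongr
    rw [← ENNReal.ofReal_ofNat 4, ← ENNReal.ofReal_mul (by norm_num)]
    refine ENNReal.ofReal_le_ofReal ?_
    nlinarith [sq_nonneg (a + b)]
  · rw [lintegral_const_mul _ (by
      have := measurable_modeWeight (Real.pi / 2) (β - Real.pi / 2)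
      have := hg.1
      fun_prop)]
    exact ENNReal.mul_ne_top (by simp) hg.2.ne

/-- The boundary value functions of two functions with given modes, and their inner product. -/
theorem IsHardyModes.exists_boundaryValue (hβ : Real.pi / 2 < β) {g' : ℤ × ℝ → ℂ}
    (hg : IsHardyModes β g) (hg' : IsHardyModes β g') :
    ∃ A B, IsBoundaryValue β (hardySynthesis g) A ∧ IsBoundaryValue β (hardySynthesis g') B ∧
      boundaryInner A B = ∫ q, g q * conj (g' q) *
        (modeWeight (Real.pi / 2) (β - Real.pi / 2) q : ℂ) ∂modeMeasure := by
  obtain ⟨T, hT⟩ := exists_synthesis_isometry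
  have hb : 0 < β - Real.pi / 2 := by linarith
  have hpi : 0 < Real.pi / 2 := by positivity
  have hL2 : ∀ {g}, IsHardyModes β g → ∀ k : Fin 4, MemLp (fun q => g q *
      (modeAbs (sliceY k (Real.pi / 2) (β - Real.pi / 2)) (sliceU k (β - Real.pi / 2)) q : ℂ)) 2
      modeMeasure := fun hg k => hg.memLp_mul_modeAbs (abs_sliceY_sub k _ hpi.le).le
        (abs_sliceU k hb.le).le
  -- The isometry is defined on all of `L²`, hence also on the modes weighted at the boundary, which
  -- need not be integrable.
  have hbv : ∀ {g} (hg : IsHardyModes β g), IsBoundaryValue β (hardySynthesis g)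
      fun k => T ((hL2 hg k).toLp _) := by
    intro g hg k
    refine ⟨Lp.memLp _, ?_⟩
    -- The square root converts convergence of integrals of squares into convergence of `L²` norms.
    have h0 := (ENNReal.continuous_rpow_const (y := 1 / 2)).tendsto 0 |>.comp
      (hg.tendsto_slice_modes hβ k)
    rw [ENNReal.zero_rpow_of_pos (by norm_num)] at h0
    refine h0.congr' ?_
    have e1 : ∀ᶠ x in 𝓝[<] (Real.pi / 2), x ∈ Set.Ioo 0 (Real.pi / 2) :=
      Ioo_mem_nhdsLT (by positivity)
    have e2 : ∀ᶠ x in 𝓝[<] (β - Real.pi / 2), x ∈ Set.Ioo 0 (β - Real.pi / 2) :=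
      Ioo_mem_nhdsLT (by linarith)
    filter_upwards [e1.prod_mk e2] with r hr
    have h1 : |sliceY k r.1 r.2 - sliceU k r.2| < Real.pi / 2 := by
      rw [abs_sliceY_sub k _ hr.1.1.le]; exact hr.1.2
    have h2 : |sliceU k r.2| < β - Real.pi / 2 := by rw [abs_sliceU k hr.2.1.le]; exact hr.2.2
    have hm := hg.memLp_mul_modeAbs h1.le h2.le
    have hi := hg.integrable_mul_modeAbs h1 h2
    have e3 : eLpNorm (fun p => hardySynthesis g (slice k r.1 r.2 p) -
        T ((hL2 hg k).toLp _) p) 2 stripMeasure = ‖T (hm.toLp _) - T ((hL2 hg k).toLp _)‖ₑ := by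
      rw [Lp.enorm_def]
      refine eLpNorm_congr_ae ?_
      filter_upwards [Lp.coeFn_sub (T (hm.toLp _)) (T ((hL2 hg k).toLp _)),
        (memLp_synthesis hi hm).coeFn_toLp] with p hp1 hp2
      rw [hp1, Pi.sub_apply, hT _ hi hm, hp2, slice_eq_point, hardySynthesis_point]
    have e4 : ‖T (hm.toLp _) - T ((hL2 hg k).toLp _)‖ₑ =
        ‖(hm.sub (hL2 hg k)).toLp _‖ₑ := by
      rw [← map_sub, ← MemLp.toLp_sub]
      exact enorm_eq_iff_norm_eq.2 (T.norm_map _)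
    have h5 := enorm_toLp_sq (hm.sub (hL2 hg k))
    simp only [Pi.sub_apply] at h5
    rw [e3, e4, Function.comp_apply, ← h5, ← ENNReal.rpow_natCast,
      ← ENNReal.rpow_mul]
    norm_num
  refine ⟨_, _, hbv hg, hbv hg', ?_⟩
  have hk : ∀ k : Fin 4, ∫ p, T ((hL2 hg k).toLp _) p * conj (T ((hL2 hg' k).toLp _) p)
      ∂stripMeasure = ∫ q, g q * conj (g' q) *
        ((modeAbs (sliceY k (Real.pi / 2) (β - Real.pi / 2))
          (sliceU k (β - Real.pi / 2)) q ^ 2 : ℝ) : ℂ) ∂modeMeasure := by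
    intro k
    have h := T.inner_map_map ((hL2 hg' k).toLp _) ((hL2 hg k).toLp _)
    rw [L2.inner_def, L2.inner_def] at h
    simp only [RCLike.inner_apply] at h
    rw [h]
    refine integral_congr_ae ?_
    filter_upwards [(hL2 hg k).coeFn_toLp, (hL2 hg' k).coeFn_toLp] with q hq hq'
    rw [hq, hq', map_mul, Complex.conj_ofReal]
    push_cast; ring
  simp only [boundaryInner, hk]
  rw [← integral_finsetSum]
  · refine integral_congr_ae (ae_of_all _ fun q => ?_)
    simp only
    rw [← Finset.mul_sum, ← Complex.ofReal_sum, sum_modeAbs_sq]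
  · intro k _
    have := (hL2 hg' k).star.integrable_mul (hL2 hg k)
    refine this.congr (ae_of_all _ fun q => ?_)
    simp only [Pi.mul_apply, Pi.star_apply, RCLike.star_def, map_mul, Complex.conj_ofReal]
    push_cast; ring

end HardySynthesis

end Worm

namespace Worm

/-! ### From Hardy functions to their modes -/

section HardyAnalysis

open FourierTransform

variable {β t s y u : ℝ} {F : ℂ × ℂ → ℂ}

theorem mem_domain_of_norm_eq_exp {z₁ z₂ : ℂ} (h : ‖z₂‖ = Real.exp (u / 2))
    (h1 : |z₁.im - u| < Real.pi / 2) (h2 : |u| < β - Real.pi / 2) : (z₁, z₂) ∈ domain β := by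
  have hlog : Real.log (‖z₂‖ ^ 2) = u := by
    rw [h, Real.log_pow, Real.log_exp]; push_cast; ring
  refine ⟨?_, ?_, ?_⟩
  · rw [← norm_pos_iff, h]; exact Real.exp_pos _
  · simpa only [hlog] using h1
  · simpa only [hlog] using h2

/-- The `j`-th Laurent coefficient of `F(z₁, ·)`, computed on the circle `log |z₂|² = u`. -/
noncomputable def laurentCoeff (F : ℂ × ℂ → ℂ) (j : ℤ) (u : ℝ) (z₁ : ℂ) : ℂ :=
  (2 * Real.pi * Complex.I)⁻¹ *
    ∮ z in C(0, Real.exp (u / 2)), (z - 0)⁻¹ • (z ^ (-j) * F (z₁, z))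

/-- The function `F(z₁, ·)` on the circle `log |z₂|² = u`. -/
noncomputable def circleFun (F : ℂ × ℂ → ℂ) (u : ℝ) (z₁ : ℂ) (θ : AddCircle (1 : ℝ)) : ℂ :=
  F (z₁, (Real.exp (u / 2) : ℂ) * _root_.fourier 1 θ)

theorem circleFun_coe (F : ℂ × ℂ → ℂ) (y u x θ : ℝ) :
    circleFun F u (x + y * Complex.I) θ = F (point y u (x, θ)) := by
  rw [circleFun, fourier_one_apply, point]
  simp

theorem norm_exp_mul_fourier_one (u : ℝ) (θ : AddCircle (1 : ℝ)) :
    ‖(Real.exp (u / 2) : ℂ) * (_root_.fourier 1 : C(AddCircle (1 : ℝ), ℂ)) θ‖ = Real.exp (u / 2) := by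
  have h4 : ‖(_root_.fourier 1 : C(AddCircle (1 : ℝ), ℂ)) θ‖ = 1 := Circle.norm_coe _
  rw [norm_mul, h4, mul_one, Complex.norm_real, Real.norm_of_nonneg (Real.exp_nonneg _)]

theorem continuous_circleFun (hF : ContinuousOn F (domain β)) {z₁ : ℂ}
    (h1 : |z₁.im - u| < Real.pi / 2) (h2 : |u| < β - Real.pi / 2) :
    Continuous (circleFun F u z₁) :=
  hF.comp_continuous (by fun_prop) fun θ =>
    mem_domain_of_norm_eq_exp (norm_exp_mul_fourier_one u θ) h1 h2

/-- Substitution of the angle `2πθ` in the contour integral; the exponential factor is the `j`-th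
power of the radius `e^{u/2}`. -/
theorem fourierCoeff_circleFun (F : ℂ × ℂ → ℂ) (j : ℤ) (u : ℝ) (z₁ : ℂ) :
    fourierCoeff (circleFun F u z₁) j = laurentCoeff F j u z₁ * (Real.exp (j * u / 2) : ℂ) := by
  rw [fourierCoeff_eq_intervalIntegral _ _ 0, laurentCoeff, circleIntegral]
  have h2pi : (2 * Real.pi : ℝ) ≠ 0 := Real.two_pi_pos.ne'
  set G : ℝ → ℂ := fun φ => deriv (circleMap 0 (Real.exp (u / 2))) φ •
    ((circleMap 0 (Real.exp (u / 2)) φ - 0)⁻¹ • (circleMap 0 (Real.exp (u / 2)) φ ^ (-j) *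
      F (z₁, circleMap 0 (Real.exp (u / 2)) φ))) with hG
  have hsub := intervalIntegral.integral_comp_mul_left (a := 0) (b := 1) G h2pi
  simp only [mul_zero, mul_one] at hsub
  have hinv : (∫ φ in (0 : ℝ)..(2 * Real.pi), G φ) =
      (2 * Real.pi : ℂ) * ∫ θ in (0 : ℝ)..1, G (2 * Real.pi * θ) := by
    rw [hsub, Complex.real_smul]
    push_cast
    have := Complex.ofReal_ne_zero.2 Real.pi_ne_zero
    field_simp
  rw [hinv, zero_add, div_one, one_smul]
  have hpt : ∀ θ : ℝ, _root_.fourier (-j) (θ : AddCircle (1 : ℝ)) • circleFun F u z₁ θ =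
      (Complex.I⁻¹ * (Real.exp (j * u / 2) : ℂ)) * G (2 * Real.pi * θ) := by
    intro θ
    have hc : circleMap 0 (Real.exp (u / 2)) (2 * Real.pi * θ) =
        (Real.exp (u / 2) : ℂ) * Complex.exp (2 * Real.pi * Complex.I * θ) := by
      simp only [circleMap, zero_add]
      congr 2; push_cast; ring
    have hne : (Real.exp (u / 2) : ℂ) * Complex.exp (2 * Real.pi * Complex.I * θ) ≠ 0 :=
      mul_ne_zero (Complex.ofReal_ne_zero.2 (Real.exp_pos _).ne') (Complex.exp_ne_zero _)
    simp only [hG, deriv_circleMap, hc, sub_zero, smul_eq_mul, circleFun, fourier_one_apply]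
    have hz : ((Real.exp (u / 2) : ℂ) * Complex.exp (2 * Real.pi * Complex.I * θ)) ^ (-j) =
        (Real.exp (j * u / 2) : ℂ)⁻¹ * Complex.exp (2 * Real.pi * Complex.I * (-j : ℤ) * θ) := by
      rw [mul_zpow, Complex.ofReal_exp, Complex.ofReal_exp, ← Complex.exp_int_mul,
        ← Complex.exp_int_mul, ← Complex.exp_neg]
      congr 2 <;> push_cast <;> ring
    rw [hz]
    have he : (Real.exp (j * u / 2) : ℂ) ≠ 0 := Complex.ofReal_ne_zero.2 (Real.exp_pos _).ne'
    have hI := Complex.I_ne_zero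
    simp only [Int.cast_one, mul_one]
    field_simp
  simp only [hpt]
  rw [intervalIntegral.integral_const_mul]
  have hI := Complex.I_ne_zero
  have := Complex.ofReal_ne_zero.2 Real.pi_ne_zero
  field_simp

/-- Both conditions on `log |z₂|²` define intervals, so the closed annulus between two admissible
circles lies in the fibre over `z₁`, and Cauchy's theorem applies. -/
theorem laurentCoeff_eq_of_le (hF : DifferentiableOn ℂ F (domain β)) (j : ℤ) {z₁ : ℂ} {u' : ℝ}
    (hu : u ≤ u') (h1 : |z₁.im - u| < Real.pi / 2) (h2 : |u| < β - Real.pi / 2)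
    (h1' : |z₁.im - u'| < Real.pi / 2) (h2' : |u'| < β - Real.pi / 2) :
    laurentCoeff F j u z₁ = laurentCoeff F j u' z₁ := by
  have hmem : ∀ z : ℂ, Real.exp (u / 2) ≤ ‖z‖ → ‖z‖ ≤ Real.exp (u' / 2) → (z₁, z) ∈ domain β := by
    intro z hz hz'
    have hz0 : 0 < ‖z‖ := (Real.exp_pos _).trans_le hz
    have e : ‖z‖ = Real.exp (2 * Real.log ‖z‖ / 2) := by
      rw [mul_div_cancel_left₀ _ two_ne_zero, Real.exp_log hz0]
    have l1 : u ≤ 2 * Real.log ‖z‖ := by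
      have := (Real.le_log_iff_exp_le hz0).2 hz; linarith
    have l2 : 2 * Real.log ‖z‖ ≤ u' := by
      have := (Real.log_le_iff_le_exp hz0).2 hz'; linarith
    rw [abs_lt] at h1 h2 h1' h2'
    refine mem_domain_of_norm_eq_exp e (abs_lt.2 ⟨?_, ?_⟩) (abs_lt.2 ⟨?_, ?_⟩) <;> linarith
  have hd : ∀ z : ℂ, Real.exp (u / 2) ≤ ‖z‖ → ‖z‖ ≤ Real.exp (u' / 2) →
      DifferentiableAt ℂ (fun z => z ^ (-j) * F (z₁, z)) z := by
    intro z hz hz'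
    have hz0 : z ≠ 0 := norm_pos_iff.1 ((Real.exp_pos _).trans_le hz)
    refine (differentiableAt_zpow.2 (Or.inl hz0)).mul ?_
    exact (hF.differentiableAt ((isOpen_domain β).mem_nhds (hmem z hz hz'))).comp z (by fun_prop)
  rw [laurentCoeff, laurentCoeff]
  congr 1
  refine (Complex.circleIntegral_sub_center_inv_smul_eq_of_differentiable_on_annulus_off_countable
    (Real.exp_pos _) (Real.exp_le_exp.2 (by linarith)) (s := ∅) Set.countable_empty ?_ ?_).symm
  · intro z hz
    simp only [Set.mem_sdiff, Metric.mem_closedBall, dist_zero_right, Metric.mem_ball, not_lt] at hz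
    exact (hd z hz.2 hz.1).continuousAt.continuousWithinAt
  · intro z hz
    simp only [Set.mem_sdiff, Metric.mem_closedBall, dist_zero_right, Metric.mem_ball, not_le,
      Set.mem_empty_iff_false, not_false_eq_true, and_true] at hz
    exact hd z hz.2.le hz.1.le

theorem laurentCoeff_eq (hF : DifferentiableOn ℂ F (domain β)) (j : ℤ) {z₁ : ℂ} {u' : ℝ}
    (h1 : |z₁.im - u| < Real.pi / 2) (h2 : |u| < β - Real.pi / 2)
    (h1' : |z₁.im - u'| < Real.pi / 2) (h2' : |u'| < β - Real.pi / 2) :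
    laurentCoeff F j u z₁ = laurentCoeff F j u' z₁ := by
  rcases le_total u u' with h | h
  · exact laurentCoeff_eq_of_le hF j h h1 h2 h1' h2'
  · exact (laurentCoeff_eq_of_le hF j h h1' h2' h1 h2).symm

theorem differentiableAt_laurentCoeff (hF : DifferentiableOn ℂ F (domain β)) (j : ℤ) {z₁ : ℂ}
    (h1 : |z₁.im - u| < Real.pi / 2) (h2 : |u| < β - Real.pi / 2) :
    DifferentiableAt ℂ (laurentCoeff F j u) z₁ := by
  -- Half of the remaining margin: the product of the closed disc and the circle is then a compact
  -- subset of the domain, on which `F` is bounded.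
  set ρ := (Real.pi / 2 - |z₁.im - u|) / 2 with hρ
  have hρ0 : 0 < ρ := by rw [hρ]; linarith
  set R := Real.exp (u / 2) with hR
  have hR0 : 0 < R := Real.exp_pos _
  have hmem : ∀ w ∈ Metric.closedBall z₁ ρ, ∀ z ∈ Metric.sphere (0 : ℂ) R, (w, z) ∈ domain β := by
    intro w hw z hz
    refine mem_domain_of_norm_eq_exp (u := u) (by simpa using hz) ?_ h2
    have h3 : |w.im - z₁.im| ≤ ρ := by
      rw [← Complex.sub_im]
      exact (Complex.abs_im_le_norm _).trans (by rwa [mem_closedBall_iff_norm] at hw)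
    have h4 : |w.im - u| ≤ |w.im - z₁.im| + |z₁.im - u| := abs_sub_le _ _ _
    linarith
  obtain ⟨C, hC⟩ := ((isCompact_closedBall z₁ ρ).prod (isCompact_sphere (0 : ℂ) R)).exists_bound_of_continuousOn
    (f := F) (hF.continuousOn.mono fun p hp => hmem p.1 hp.1 p.2 hp.2)
  have hsph : ∀ φ : ℝ, circleMap 0 R φ ∈ Metric.sphere (0 : ℂ) R := fun φ =>
    circleMap_mem_sphere _ hR0.le _
  have hne : ∀ φ : ℝ, circleMap 0 R φ ≠ 0 := fun φ => circleMap_ne_center hR0.ne'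
  have key := differentiableOn_integral_of_dominated
    (μ := (volume : Measure ℝ).restrict (Set.Ioc 0 (2 * Real.pi)))
    (f := fun (w : ℂ) (φ : ℝ) => deriv (circleMap 0 R) φ • ((circleMap 0 R φ - 0)⁻¹ •
      (circleMap 0 R φ ^ (-j) * F (w, circleMap 0 R φ))))
    (Ω := Metric.ball z₁ ρ) Metric.isOpen_ball (g := fun _ => R * (R⁻¹ * (R ^ (-j) * C)))
    (integrable_const _) ?_ ?_ ?_
  · have hd := key.differentiableAt (Metric.ball_mem_nhds z₁ hρ0)
    refine (hd.const_mul (2 * (Real.pi : ℂ) * Complex.I)⁻¹).congr_of_eventuallyEq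
      (Eventually.of_forall fun w => ?_)
    rw [laurentCoeff, circleIntegral, intervalIntegral.integral_of_le Real.two_pi_pos.le]
  · intro w hw
    have hc : Continuous fun φ : ℝ => F (w, circleMap 0 R φ) :=
      hF.continuousOn.comp_continuous (by fun_prop) fun φ =>
        hmem w (Metric.ball_subset_closedBall hw) _ (hsph φ)
    have hz : Continuous fun φ : ℝ => circleMap 0 R φ ^ (-j) :=
      (continuous_circleMap 0 R).zpow₀ _ fun φ => Or.inl (hne φ)
    have hi : Continuous fun φ : ℝ => (circleMap 0 R φ - 0)⁻¹ :=
      ((continuous_circleMap 0 R).sub continuous_const).inv₀ fun φ => by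
        simpa using hne φ
    have hd : Continuous fun φ : ℝ => deriv (circleMap 0 R) φ := by
      simp only [deriv_circleMap]
      exact (continuous_circleMap 0 R).mul continuous_const
    exact (hd.smul (hi.smul (hz.mul hc))).aestronglyMeasurable
  · intro φ
    have hFφ : DifferentiableOn ℂ (fun w => F (w, circleMap 0 R φ)) (Metric.ball z₁ ρ) :=
      hF.comp (f := fun w : ℂ => (w, circleMap 0 R φ)) (by fun_prop)
        fun w hw => hmem w (Metric.ball_subset_closedBall hw) _ (hsph φ)
    simp only [smul_eq_mul]
    exact ((hFφ.const_mul _).const_mul _).const_mul _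
  · intro w hw φ
    have h3 := hC (w, circleMap 0 R φ) ⟨Metric.ball_subset_closedBall hw, hsph φ⟩
    have h4 : ‖circleMap 0 R φ‖ = R := by simpa using hsph φ
    rw [norm_smul, norm_smul, norm_mul, norm_zpow, norm_inv, sub_zero, h4, deriv_circleMap,
      norm_mul, h4, Complex.norm_I, mul_one]
    gcongr

/-- Dividing `y` in the ratio of `π/2` to `β - π/2` gives an admissible circle over every point of
the strip `|Im z₁| < β`, the projection of the domain. -/
theorem abs_mul_div_lt (hβ : Real.pi / 2 < β) (hy : |y| < β) :
    |y - y * ((β - Real.pi / 2) / β)| < Real.pi / 2 ∧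
      |y * ((β - Real.pi / 2) / β)| < β - Real.pi / 2 := by
  have hpi := Real.pi_pos
  have hβ0 : 0 < β := by linarith
  have e : y - y * ((β - Real.pi / 2) / β) = y * (Real.pi / 2 / β) := by field_simp; ring
  rw [e, abs_mul, abs_mul, abs_of_pos (by positivity : 0 < Real.pi / 2 / β),
    abs_of_pos (div_pos (by linarith : 0 < β - Real.pi / 2) hβ0)]
  constructor
  · rw [mul_div_assoc', div_lt_iff₀ hβ0]; nlinarith
  · rw [mul_div_assoc', div_lt_iff₀ hβ0]; nlinarith

/-- The `j`-th Laurent coefficient of `F` as a function on the strip `|Im z₁| < β`. -/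
noncomputable def stripCoeff (β : ℝ) (F : ℂ × ℂ → ℂ) (j : ℤ) (z₁ : ℂ) : ℂ :=
  laurentCoeff F j (z₁.im * ((β - Real.pi / 2) / β)) z₁

/-- The circle in the definition moves with `Im z₁`; this allows it to be frozen near a given point,
which is what holomorphy of the coefficient needs. -/
theorem stripCoeff_eq (hF : DifferentiableOn ℂ F (domain β)) (hβ : Real.pi / 2 < β) (j : ℤ)
    {z₁ : ℂ} (h1 : |z₁.im - u| < Real.pi / 2) (h2 : |u| < β - Real.pi / 2) :
    stripCoeff β F j z₁ = laurentCoeff F j u z₁ := by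
  have hy : |z₁.im| < β := by
    have := abs_add_le (z₁.im - u) u
    rw [sub_add_cancel] at this
    linarith
  obtain ⟨h3, h4⟩ := abs_mul_div_lt hβ hy
  exact laurentCoeff_eq hF j h3 h4 h1 h2

theorem differentiableOn_stripCoeff (hF : DifferentiableOn ℂ F (domain β))
    (hβ : Real.pi / 2 < β) (j : ℤ) :
    DifferentiableOn ℂ (stripCoeff β F j) {z | |z.im| < β} := by
  intro z hz
  obtain ⟨h1, h2⟩ := abs_mul_div_lt hβ hz
  refine DifferentiableAt.differentiableWithinAt ?_
  refine (differentiableAt_laurentCoeff hF j h1 h2).congr_of_eventuallyEq ?_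
  have : ∀ᶠ w : ℂ in 𝓝 z, |w.im - z.im * ((β - Real.pi / 2) / β)| < Real.pi / 2 :=
    (isOpen_lt (by fun_prop) continuous_const).mem_nhds h1
  filter_upwards [this] with w hw
  exact stripCoeff_eq hF hβ j hw h2

theorem fourierCoeff_circleFun_eq (hF : DifferentiableOn ℂ F (domain β)) (hβ : Real.pi / 2 < β)
    (j : ℤ) {z₁ : ℂ} (h1 : |z₁.im - u| < Real.pi / 2) (h2 : |u| < β - Real.pi / 2) :
    fourierCoeff (circleFun F u z₁) j = stripCoeff β F j z₁ * (Real.exp (j * u / 2) : ℂ) := by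
  rw [fourierCoeff_circleFun, stripCoeff_eq hF hβ j h1 h2]

theorem lintegral_point_sq (hF : DifferentiableOn ℂ F (domain β)) (hβ : Real.pi / 2 < β)
    (h1 : |y - u| < Real.pi / 2) (h2 : |u| < β - Real.pi / 2) :
    ∫⁻ p, ‖F (point y u p)‖ₑ ^ 2 ∂stripMeasure =
      ∑' j : ℤ, ∫⁻ x : ℝ, ‖stripCoeff β F j (x + y * Complex.I) *
        (Real.exp (j * u / 2) : ℂ)‖ₑ ^ 2 := by
  have hcont : Continuous fun p => F (point y u p) :=
    hF.continuousOn.comp_continuous (continuous_point y u) fun p => point_mem_domain h1 h2 p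
  have h1' : ∀ x : ℝ, |((x : ℂ) + y * Complex.I).im - u| < Real.pi / 2 := fun x => by simpa using h1
  have hy : |y| < β := by
    have := abs_add_le (y - u) u
    rw [sub_add_cancel] at this
    linarith
  rw [stripMeasure, lintegral_prod _ (hcont.measurable.enorm.pow_const 2).aemeasurable]
  have hx : ∀ x : ℝ, ∫⁻ θ in Set.Icc (0 : ℝ) 1, ‖F (point y u (x, θ))‖ₑ ^ 2 =
      ∑' j : ℤ, ‖stripCoeff β F j (x + y * Complex.I) * (Real.exp (j * u / 2) : ℂ)‖ₑ ^ 2 := by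
    intro x
    have := lintegral_sq_eq_tsum_fourierCoeff
      ⟨_, continuous_circleFun hF.continuousOn (h1' x) h2⟩
    simp only [ContinuousMap.coe_mk, circleFun_coe, fourierCoeff_circleFun_eq hF hβ _ (h1' x) h2]
      at this
    exact this
  simp only [hx]
  refine lintegral_tsum fun j => ?_
  have : Continuous fun x : ℝ => stripCoeff β F j (x + y * Complex.I) :=
    (differentiableOn_stripCoeff hF hβ j).continuousOn.comp_continuous (by fun_prop)
      fun x => by simpa using hy
  exact ((this.mul continuous_const).measurable.enorm.pow_const 2).aemeasurable

/-- This family is itself one of the slices, with `s + t = |y|`: the first one for `y ≥ 0` and the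
second one for `y ≤ 0`. -/
theorem lintegral_point_sq_le (hβ : Real.pi / 2 < β) (hy : |y| < β) :
    ∫⁻ p, ‖F (point y (y * ((β - Real.pi / 2) / β)) p)‖ₑ ^ 2 ∂stripMeasure ≤
      hardyNormSq β F := by
  have hpi := Real.pi_pos
  have hβ0 : 0 < β := by linarith
  have hs : |y| * ((β - Real.pi / 2) / β) ∈ Set.Ico 0 (β - Real.pi / 2) := by
    refine ⟨mul_nonneg (abs_nonneg _) (div_nonneg (by linarith) hβ0.le), ?_⟩
    rw [mul_div_assoc', div_lt_iff₀ hβ0]; nlinarith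
  have ht : |y| * (Real.pi / 2 / β) ∈ Set.Ico 0 (Real.pi / 2) := by
    refine ⟨by positivity, ?_⟩
    rw [mul_div_assoc', div_lt_iff₀ hβ0]; nlinarith
  have hsum : |y| * ((β - Real.pi / 2) / β) + |y| * (Real.pi / 2 / β) = |y| := by field_simp; ring
  refine le_trans ?_ (le_iSup₂_of_le _ ht (le_iSup₂_of_le (f := fun s _ => sliceIntegral F _ s)
    _ hs le_rfl))
  have hk : ∃ k : Fin 4, slice k (|y| * (Real.pi / 2 / β)) (|y| * ((β - Real.pi / 2) / β)) =
      point y (y * ((β - Real.pi / 2) / β)) := by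
    rcases le_total 0 y with h | h
    · refine ⟨0, ?_⟩
      rw [slice_eq_point]
      simp only [sliceY, sliceU, Matrix.cons_val]
      rw [hsum, abs_of_nonneg h]
    · refine ⟨1, ?_⟩
      rw [slice_eq_point]
      simp only [sliceY, sliceU, Matrix.cons_val]
      rw [hsum, abs_of_nonpos h, neg_neg, neg_mul, neg_neg]
  obtain ⟨k, hk⟩ := hk
  rw [← hk]
  exact Finset.single_le_sum (f := fun k => ∫⁻ p, ‖F (slice k _ _ p)‖ₑ ^ 2 ∂stripMeasure)
    (fun _ _ => zero_le) (Finset.mem_univ k)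

/-- A single term of Parseval's sum is at most the whole. The dependence of the constant on `j` is
harmless: the bound only serves to apply Paley–Wiener to each coefficient. -/
theorem lintegral_stripCoeff_sq_le (hF : DifferentiableOn ℂ F (domain β)) (hβ : Real.pi / 2 < β)
    (j : ℤ) (hy : |y| < β) :
    ∫⁻ x : ℝ, ‖stripCoeff β F j (x + y * Complex.I)‖ₑ ^ 2 ≤
      ENNReal.ofReal (Real.exp (|(j : ℝ)| * (β - Real.pi / 2))) * hardyNormSq β F := by
  obtain ⟨h1, h2⟩ := abs_mul_div_lt hβ hy
  set u := y * ((β - Real.pi / 2) / β) with hu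
  have h3 := (ENNReal.le_tsum j).trans_eq (lintegral_point_sq hF hβ h1 h2).symm
  have h4 := h3.trans (lintegral_point_sq_le hβ hy)
  refine le_trans ?_ (mul_le_mul_right h4 _)
  simp only [enorm_mul_ofReal_sq _ (Real.exp_nonneg _) rfl]
  rw [lintegral_mul_const' _ _ ENNReal.ofReal_ne_top, mul_left_comm,
    ← ENNReal.ofReal_mul (Real.exp_nonneg _)]
  refine le_mul_of_one_le_right zero_le ?_
  rw [ENNReal.one_le_ofReal, ← Real.exp_nat_mul, ← Real.exp_add, Real.one_le_exp_iff]
  have h5 : -(j * u) ≤ |(j : ℝ)| * (β - Real.pi / 2) := by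
    refine (neg_le_abs _).trans ?_
    rw [abs_mul]
    gcongr
  push_cast
  linarith

/-- Every function of the Hardy space is the synthesis of its modes. -/
theorem MemHardy.exists_modes (hβ : Real.pi / 2 < β) (hF : MemHardy β F) :
    ∃ g, IsHardyModes β g ∧ ∀ z ∈ domain β, F z = hardySynthesis g z := by
  have hpi := Real.pi_pos
  have hβ0 : 0 < β := by linarith
  have hPW : ∀ j : ℤ, _ := fun j => exists_paleyWiener hβ0
    (M := ENNReal.ofReal (Real.exp (|(j : ℝ)| * (β - Real.pi / 2))) * hardyNormSq β F)
    (ENNReal.mul_lt_top ENNReal.ofReal_lt_top hF.2) (differentiableOn_stripCoeff hF.1 hβ j)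
    fun y hy => lintegral_stripCoeff_sq_le hF.1 hβ j hy
  choose g hgm hg using hPW
  have hmeas : Measurable fun q : ℤ × ℝ => g q.1 q.2 :=
    measurable_from_prod_countable_right hgm
  have habs : ∀ {y u : ℝ}, |y - u| < Real.pi / 2 → |u| < β - Real.pi / 2 → |y| < β := by
    intro y u h1 h2
    have := abs_add_le (y - u) u
    rw [sub_add_cancel] at this
    linarith
  have hmul : ∀ (j : ℤ) (y u η : ℝ), (Real.exp (-(2 * Real.pi * η * y)) : ℂ) *
      (Real.exp (j * u / 2) : ℂ) = (modeAbs y u (j, η) : ℂ) := by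
    intro j y u η
    rw [← Complex.ofReal_mul, ← Real.exp_add, modeAbs]
    congr 2; ring
  have hcoef : ∀ (j : ℤ) {y u : ℝ}, |y - u| < Real.pi / 2 → |u| < β - Real.pi / 2 → ∀ x : ℝ,
      stripCoeff β F j (x + y * Complex.I) * (Real.exp (j * u / 2) : ℂ) =
        𝓕⁻ (fun η => g j η * (modeAbs y u (j, η) : ℂ)) x := by
    intro j y u h1 h2 x
    rw [(hg j y (habs h1 h2)).2.2 x, Real.fourierInv_eq', Real.fourierInv_eq',
      ← integral_mul_const]
    refine integral_congr_ae (ae_of_all _ fun η => ?_)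
    simp only [← hmul, smul_eq_mul]
    ring
  have hL : ∀ (j : ℤ) {y u : ℝ}, |y - u| < Real.pi / 2 → |u| < β - Real.pi / 2 →
      Integrable (fun η => g j η * (modeAbs y u (j, η) : ℂ)) ∧
      MemLp (fun η => g j η * (modeAbs y u (j, η) : ℂ)) 2 := by
    intro j y u h1 h2
    have h3 := hg j y (habs h1 h2)
    have e : (fun η => g j η * (modeAbs y u (j, η) : ℂ)) = fun η =>
        (g j η * (Real.exp (-(2 * Real.pi * η * y)) : ℂ)) * (Real.exp (j * u / 2) : ℂ) := by
      funext η; simp only [← hmul]; ring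
    rw [e]
    exact ⟨h3.1.mul_const _, by simpa [mul_comm] using h3.2.1.const_mul (Real.exp (j * u / 2) : ℂ)⟩
  have hslice : ∀ {y u : ℝ}, |y - u| < Real.pi / 2 → |u| < β - Real.pi / 2 →
      ∫⁻ p, ‖F (point y u p)‖ₑ ^ 2 ∂stripMeasure =
        ∫⁻ q, ‖g q.1 q.2‖ₑ ^ 2 * ENNReal.ofReal (modeAbs y u q ^ 2) ∂modeMeasure := by
    intro y u h1 h2
    have hm := measurable_modeAbs y u
    rw [lintegral_point_sq hF.1 hβ h1 h2, lintegral_modeMeasure (by fun_prop)]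
    refine tsum_congr fun j => ?_
    simp only [hcoef j h1 h2]
    rw [lintegral_fourierInv_sq (hL j h1 h2).1 (hL j h1 h2).2]
    exact lintegral_congr fun η => enorm_mul_ofReal_sq _ (modeAbs_pos _ _ _).le rfl
  -- In contrast to the bounds for individual coefficients, this one is uniform in `j`, `t` and `s`.
  have hsum : ∀ {t s : ℝ}, t ∈ Set.Ico 0 (Real.pi / 2) → s ∈ Set.Ico 0 (β - Real.pi / 2) →
      ∫⁻ q, ‖g q.1 q.2‖ₑ ^ 2 * ENNReal.ofReal (modeWeight t s q) ∂modeMeasure ≤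
        hardyNormSq β F := by
    intro t s ht hs
    refine le_trans (le_of_eq ?_) (le_iSup₂_of_le _ ht
      (le_iSup₂_of_le (f := fun s _ => sliceIntegral F _ s) _ hs le_rfl))
    have hk : ∀ k : Fin 4, ∫⁻ p, ‖F (slice k t s p)‖ₑ ^ 2 ∂stripMeasure =
        ∫⁻ q, ‖g q.1 q.2‖ₑ ^ 2 * ENNReal.ofReal (modeAbs (sliceY k t s) (sliceU k s) q ^ 2)
          ∂modeMeasure := by
      intro k
      simp only [slice_eq_point]
      exact hslice (by rw [abs_sliceY_sub k s ht.1]; exact ht.2)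
        (by rw [abs_sliceU k hs.1]; exact hs.2)
    simp only [sliceIntegral, hk]
    rw [← lintegral_finsetSum]
    · refine lintegral_congr fun q => ?_
      rw [← Finset.mul_sum, ← ENNReal.ofReal_sum_of_nonneg fun _ _ => sq_nonneg _, sum_modeAbs_sq]
    · exact fun k _ => (hmeas.enorm.pow_const 2).mul
        ((measurable_modeAbs _ _).pow_const 2).ennreal_ofReal
  have hmodes : IsHardyModes β fun q => g q.1 q.2 := by
    refine ⟨hmeas, lt_of_le_of_lt ?_ hF.2⟩
    -- Fatou's lemma along interior slices approaching the distinguished boundary. The value `c 0 =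
    -- 0` is admissible because the parameter intervals contain zero.
    set c : ℕ → ℝ := fun n => 1 - 1 / (n + 1) with hc
    have hc0 : ∀ n, 0 ≤ c n ∧ c n < 1 := fun n => by
      have h1 : (0 : ℝ) < n + 1 := by positivity
      have h2 : 1 / ((n : ℝ) + 1) ≤ 1 := by
        rw [div_le_one h1]; linarith [(Nat.cast_nonneg n : (0 : ℝ) ≤ n)]
      have h3 : 0 < 1 / ((n : ℝ) + 1) := by positivity
      constructor <;> simp only [hc] <;> linarith
    have hclim : Tendsto c atTop (𝓝 1) := by
      simpa [hc] using tendsto_const_nhds.sub (tendsto_one_div_add_atTop_nhds_zero_nat (𝕜 := ℝ))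
    have hb : 0 < β - Real.pi / 2 := by linarith
    calc _ = ∫⁻ q, liminf (fun n => ‖g q.1 q.2‖ₑ ^ 2 * ENNReal.ofReal
          (modeWeight (c n * (Real.pi / 2)) (c n * (β - Real.pi / 2)) q)) atTop ∂modeMeasure := by
          refine lintegral_congr fun q => (Tendsto.liminf_eq ?_).symm
          refine ENNReal.Tendsto.const_mul (ENNReal.tendsto_ofReal ?_) (Or.inr (by simp))
          have hcw : Continuous fun r : ℝ =>
              modeWeight (r * (Real.pi / 2)) (r * (β - Real.pi / 2)) q := by
            unfold modeWeight
            have := Real.continuous_cosh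
            fun_prop
          have hlim := (hcw.tendsto 1).comp hclim
          simp only [one_mul] at hlim
          exact hlim
      _ ≤ liminf (fun n => ∫⁻ q, ‖g q.1 q.2‖ₑ ^ 2 * ENNReal.ofReal
          (modeWeight (c n * (Real.pi / 2)) (c n * (β - Real.pi / 2)) q) ∂modeMeasure) atTop :=
          lintegral_liminf_le fun n => (hmeas.enorm.pow_const 2).mul
            (measurable_modeWeight _ _).ennreal_ofReal
      _ ≤ hardyNormSq β F := by
          refine liminf_le_of_le (by isBoundedDefault) fun b hb' => ?_
          obtain ⟨n, hn⟩ := hb'.exists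
          refine hn.trans (hsum ⟨?_, ?_⟩ ⟨?_, ?_⟩)
          · exact mul_nonneg (hc0 n).1 (by positivity)
          · exact mul_lt_of_lt_one_left (by positivity) (hc0 n).2
          · exact mul_nonneg (hc0 n).1 hb.le
          · exact mul_lt_of_lt_one_left hb (hc0 n).2
  refine ⟨_, hmodes, fun z hz => ?_⟩
  obtain ⟨⟨x, θ⟩, hp⟩ := exists_eq_point hz.1
  set y := z.1.im
  set u := Real.log (‖z.2‖ ^ 2)
  have h1 : |y - u| < Real.pi / 2 := hz.2.1
  have h2 : |u| < β - Real.pi / 2 := hz.2.2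
  have h1' : |((x : ℂ) + y * Complex.I).im - u| < Real.pi / 2 := by simpa using h1
  have hint := hmodes.integrable_mul_modeAbs h1 h2
  rw [hp, hardySynthesis_point, synthesis_eq_tsum hint, ← circleFun_coe F y u x θ]
  -- Integrability of the modes makes the Fourier series on the circle absolutely convergent, so it
  -- represents `F` at every point.
  have hsm : Summable (fourierCoeff (⟨_, continuous_circleFun hF.1.continuousOn h1' h2⟩ :
      C(AddCircle (1 : ℝ), ℂ))) := by
    refine Summable.of_norm ((summable_mode_norm hint).of_nonneg_of_le
      (fun _ => norm_nonneg _) fun j => ?_)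
    rw [ContinuousMap.coe_mk, fourierCoeff_circleFun_eq hF.1 hβ j h1' h2, hcoef j h1 h2]
    exact norm_fourierInv_le _ x
  have := has_pointwise_sum_fourier_series_of_summable hsm θ
  rw [ContinuousMap.coe_mk] at this
  rw [← this.tsum_eq]
  refine tsum_congr fun j => ?_
  rw [fourierCoeff_circleFun_eq hF.1 hβ j h1' h2, hcoef j h1 h2, fourier_one_apply, smul_eq_mul]

end HardyAnalysis

end Worm

namespace Worm

/-! ### Existence and uniqueness of the Szegő kernel -/

section SzegoKernel

variable {β t s : ℝ} {z w : ℂ × ℂ}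

/-- The modes of the Szegő kernel `K(·, z)`. -/
noncomputable def kernelModes (β : ℝ) (z : ℂ × ℂ) (q : ℤ × ℝ) : ℂ :=
  conj (mode z q) / (modeWeight (Real.pi / 2) (β - Real.pi / 2) q : ℂ)

/-- The explicit Szegő kernel. -/
noncomputable def szegoKernel (β : ℝ) (w z : ℂ × ℂ) : ℂ := hardySynthesis (kernelModes β z) w

/-- The weighted square of the modes is `|mode|²` divided by the boundary weight, which is
integrable since `z` lies strictly inside. -/
theorem isHardyModes_kernelModes (hz : z ∈ domain β) : IsHardyModes β (kernelModes β z) := by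
  have hW := measurable_modeWeight (Real.pi / 2) (β - Real.pi / 2)
  have hm : Measurable (kernelModes β z) :=
    (Complex.continuous_conj.measurable.comp (measurable_mode z)).div
      (Complex.measurable_ofReal.comp hW)
  refine ⟨hm, ?_⟩
  set t := |z.1.im - Real.log (‖z.2‖ ^ 2)| with ht
  set s := |Real.log (‖z.2‖ ^ 2)| with hs
  have hi := integrable_modeWeight_div (abs_nonneg _) hz.2.1 (abs_nonneg _) hz.2.2
  refine lt_of_le_of_lt (lintegral_mono fun q => ?_) hi.lintegral_lt_top
  have hW0 := modeWeight_pos (Real.pi / 2) (β - Real.pi / 2) q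
  rw [← ofReal_norm, ← ENNReal.ofReal_pow (norm_nonneg _), ← ENNReal.ofReal_mul (by positivity)]
  refine ENNReal.ofReal_le_ofReal ?_
  rw [kernelModes, norm_div, RCLike.norm_conj, norm_mode hz.1, Complex.norm_real,
    Real.norm_of_nonneg hW0.le, div_pow, sq (modeWeight _ _ _), ← div_div, div_mul_cancel₀ _ hW0.ne']
  gcongr
  exact modeAbs_sq_le_of_abs_le le_rfl le_rfl q

theorem slice_mem_domain {k : Fin 4} (ht : t ∈ Set.Ico 0 (Real.pi / 2))
    (hs : s ∈ Set.Ico 0 (β - Real.pi / 2)) (p : ℝ × ℝ) : slice k t s p ∈ domain β := by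
  rw [slice_eq_point]
  refine point_mem_domain ?_ ?_ p
  · rw [abs_sliceY_sub k s ht.1]; exact ht.2
  · rw [abs_sliceU k hs.1]; exact hs.2

theorem eventually_slice_parameters (hβ : Real.pi / 2 < β) :
    ∀ᶠ q : ℝ × ℝ in 𝓝[<] (Real.pi / 2) ×ˢ 𝓝[<] (β - Real.pi / 2),
      q.1 ∈ Set.Ico 0 (Real.pi / 2) ∧ q.2 ∈ Set.Ico 0 (β - Real.pi / 2) :=
  (Filter.Eventually.prod_mk (Ico_mem_nhdsLT (by positivity))
    (Ico_mem_nhdsLT (by linarith)))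

theorem IsBoundaryValue.congr (hβ : Real.pi / 2 < β) {F G : ℂ × ℂ → ℂ} {B : Fin 4 → ℝ × ℝ → ℂ}
    (hB : IsBoundaryValue β F B) (h : Set.EqOn F G (domain β)) : IsBoundaryValue β G B := by
  refine fun k => ⟨(hB k).1, (hB k).2.congr' ?_⟩
  filter_upwards [eventually_slice_parameters hβ] with q hq
  congr 1
  ext p
  rw [h (slice_mem_domain hq.1 hq.2 p)]

theorem MemHardy.continuous_slice {F : ℂ × ℂ → ℂ} (hF : MemHardy β F) {k : Fin 4}
    (ht : t ∈ Set.Ico 0 (Real.pi / 2)) (hs : s ∈ Set.Ico 0 (β - Real.pi / 2)) :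
    Continuous fun p => F (slice k t s p) := by
  refine hF.1.continuousOn.comp_continuous ?_ (slice_mem_domain ht hs)
  rw [slice_eq_point]
  exact continuous_point _ _

/-- `IsSzegoKernel` only provides some boundary values for each pair of functions; their uniqueness
makes inner products from different applications comparable. -/
theorem IsBoundaryValue.ae_eq (hβ : Real.pi / 2 < β) {F : ℂ × ℂ → ℂ} (hF : MemHardy β F)
    {A B : Fin 4 → ℝ × ℝ → ℂ} (hA : IsBoundaryValue β F A) (hB : IsBoundaryValue β F B)
    (k : Fin 4) : A k =ᵐ[stripMeasure] B k := by
  have h : Tendsto (fun q : ℝ × ℝ =>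
      eLpNorm (fun p => F (slice k q.1 q.2 p) - A k p) 2 stripMeasure +
      eLpNorm (fun p => F (slice k q.1 q.2 p) - B k p) 2 stripMeasure)
      (𝓝[<] (Real.pi / 2) ×ˢ 𝓝[<] (β - Real.pi / 2)) (𝓝 (0 + 0)) := (hA k).2.add (hB k).2
  rw [add_zero] at h
  have h0 : eLpNorm (B k - A k) 2 stripMeasure ≤ 0 := by
    refine ge_of_tendsto h ?_
    filter_upwards [eventually_slice_parameters hβ] with q hq
    have hc := (hF.continuous_slice (k := k) hq.1 hq.2).aestronglyMeasurable (μ := stripMeasure)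
    refine le_trans (le_of_eq ?_) (eLpNorm_sub_le (p := 2) (hc.sub (hA k).1.1) (hc.sub (hB k).1.1)
      one_le_two)
    congr 1
    ext p
    simp
  have h1 := (eLpNorm_eq_zero_iff ((hB k).1.1.sub (hA k).1.1) two_ne_zero).1
    (nonpos_iff_eq_zero.1 h0)
  filter_upwards [h1] with p hp
  exact (sub_eq_zero.1 hp).symm

theorem boundaryInner_congr {A A' B B' : Fin 4 → ℝ × ℝ → ℂ}
    (hA : ∀ k, A k =ᵐ[stripMeasure] A' k) (hB : ∀ k, B k =ᵐ[stripMeasure] B' k) :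
    boundaryInner A B = boundaryInner A' B' := by
  refine Finset.sum_congr rfl fun k _ => integral_congr_ae ?_
  filter_upwards [hA k, hB k] with p h1 h2
  rw [h1, h2]

theorem conj_boundaryInner (A B : Fin 4 → ℝ × ℝ → ℂ) :
    conj (boundaryInner A B) = boundaryInner B A := by
  simp only [boundaryInner, map_sum, ← integral_conj, map_mul, Complex.conj_conj, mul_comm]

/-- In the inner product with the kernel modes the boundary weight cancels and the synthesis
integral of `F` at `z` remains. -/
theorem isSzegoKernel_szegoKernel (hβ : Real.pi / 2 < β) : IsSzegoKernel β (szegoKernel β) := by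
  intro z hz
  have hg' := isHardyModes_kernelModes hz
  refine ⟨hg'.memHardy, fun F hF => ?_⟩
  obtain ⟨g, hg, hFg⟩ := hF.exists_modes hβ
  obtain ⟨A, B, hA, hB, hAB⟩ := IsHardyModes.exists_boundaryValue hβ hg hg'
  refine ⟨A, B, hA.congr hβ fun w hw => (hFg w hw).symm, hB, ?_⟩
  rw [hAB, hFg z hz, hardySynthesis]
  refine integral_congr_ae (ae_of_all _ fun q => ?_)
  have : (modeWeight (Real.pi / 2) (β - Real.pi / 2) q : ℂ) ≠ 0 := by
    exact_mod_cast (modeWeight_pos _ _ _).ne'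
  simp only [kernelModes, map_div₀, Complex.conj_conj, Complex.conj_ofReal]
  rw [mul_assoc, div_mul_cancel₀ _ this]

theorem szegoKernel_conj (β : ℝ) (w z : ℂ × ℂ) :
    conj (szegoKernel β w z) = szegoKernel β z w := by
  simp only [szegoKernel, hardySynthesis, kernelModes, ← integral_conj, map_mul, map_div₀,
    Complex.conj_conj, Complex.conj_ofReal]
  congr 1
  ext q
  ring

/-- Evaluate the inner product of `S(·, z)` with the explicit kernel at `w` twice, reproducing once
with each kernel; the explicit kernel is Hermitian. -/
theorem IsSzegoKernel.eq_szegoKernel (hβ : Real.pi / 2 < β) {S : ℂ × ℂ → ℂ × ℂ → ℂ}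
    (hS : IsSzegoKernel β S) (hw : w ∈ domain β) (hz : z ∈ domain β) :
    S w z = szegoKernel β w z := by
  have hK := isSzegoKernel_szegoKernel hβ
  obtain ⟨A, B, hA, hB, h1⟩ := (hK w hw).2 _ (hS z hz).1
  obtain ⟨A', B', hA', hB', h2⟩ := (hS z hz).2 _ (hK w hw).1
  rw [← szegoKernel_conj, h1, h2, conj_boundaryInner]
  exact boundaryInner_congr (hA.ae_eq hβ (hS z hz).1 hB') (hB.ae_eq hβ (hK w hw).1 hA')

end SzegoKernel

end Worm

namespace Worm

/-! ### Estimates and integrals of the reciprocal hyperbolic cosine -/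

section Cosh

theorem norm_cosh_sq (z : ℂ) : ‖Complex.cosh z‖ ^ 2 = Real.sinh z.re ^ 2 + Real.cos z.im ^ 2 := by
  conv_lhs => rw [← Complex.re_add_im z, Complex.cosh_add, Complex.cosh_mul_I, Complex.sinh_mul_I,
    ← Complex.ofReal_cosh, ← Complex.ofReal_sinh, ← Complex.ofReal_cos, ← Complex.ofReal_sin]
  rw [Complex.sq_norm, Complex.normSq_apply]
  simp only [Complex.add_re, Complex.add_im, Complex.mul_re, Complex.mul_im, Complex.ofReal_re,
    Complex.ofReal_im, Complex.I_re, Complex.I_im]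
  have h1 := Real.cosh_sq z.re
  have h2 := Real.sin_sq_add_cos_sq z.im
  have h3 : Real.sin z.im ^ 2 = 1 - Real.cos z.im ^ 2 := by linarith
  linear_combination (Real.cos z.im ^ 2) * h1 + Real.sinh z.re ^ 2 * h3

theorem abs_cos_mul_cosh_le (z : ℂ) : |Real.cos z.im| * Real.cosh z.re ≤ ‖Complex.cosh z‖ := by
  refine le_of_sq_le_sq ?_ (norm_nonneg _)
  rw [norm_cosh_sq, mul_pow, sq_abs, Real.cosh_sq]
  nlinarith [Real.cos_sq_le_one z.im, sq_nonneg (Real.sinh z.re)]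

/-- A lower bound that is uniform in the imaginary part, hence usable on a strip containing a zero,
away from its real part. -/
theorem cosh_le_two_mul_norm_cosh {z : ℂ} (hz : 1 ≤ |z.re|) :
    Real.cosh z.re ≤ 2 * ‖Complex.cosh z‖ := by
  refine le_of_sq_le_sq ?_ (by positivity)
  rw [mul_pow, norm_cosh_sq, Real.cosh_sq]
  have h1 : 1 ≤ |Real.sinh z.re| := by
    rw [Real.abs_sinh]
    exact hz.trans (Real.self_le_sinh_iff.2 (abs_nonneg _))
  have h2 : 1 ≤ Real.sinh z.re ^ 2 := (one_le_sq_iff_one_le_abs _).2 h1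
  nlinarith [sq_nonneg (Real.cos z.im)]

theorem exp_abs_le_two_mul_cosh (x : ℝ) : Real.exp |x| ≤ 2 * Real.cosh x := by
  rw [← Real.cosh_abs, Real.cosh_eq]
  linarith [Real.exp_pos (-|x|)]

theorem cosh_ne_zero_of_cos_ne_zero {z : ℂ} (hz : Real.cos z.im ≠ 0) : Complex.cosh z ≠ 0 := by
  rw [← norm_pos_iff]
  exact (mul_pos (abs_pos.2 hz) (Real.cosh_pos _)).trans_le (abs_cos_mul_cosh_le z)

theorem inv_norm_cosh_le {z : ℂ} {m : ℝ} (hm : 0 < m) (hz : m ≤ |Real.cos z.im|) :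
    ‖(Complex.cosh z)⁻¹‖ ≤ 2 / m * Real.exp (-|z.re|) := by
  have h1 := abs_cos_mul_cosh_le z
  have h2 := exp_abs_le_two_mul_cosh z.re
  have h3 : m / 2 * Real.exp |z.re| ≤ ‖Complex.cosh z‖ := by
    refine le_trans ?_ h1
    calc m / 2 * Real.exp |z.re| ≤ m / 2 * (2 * Real.cosh z.re) := by gcongr
      _ = m * Real.cosh z.re := by ring
      _ ≤ _ := mul_le_mul_of_nonneg_right hz (Real.cosh_pos _).le
  rw [norm_inv]
  refine (inv_anti₀ (by positivity) h3).trans (le_of_eq ?_)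
  rw [mul_inv, inv_div, Real.exp_neg]

/-- The first two terms of the expansion of `1 / cosh` at `+∞`. -/
theorem norm_inv_cosh_sub_le {z : ℂ} {m : ℝ} (hm : 0 < m) (hz : m ≤ |Real.cos z.im|)
    (hre : 0 ≤ z.re) :
    ‖(Complex.cosh z)⁻¹ - 2 * Complex.exp (-z)‖ ≤ 2 / m * Real.exp (-(3 * z.re)) := by
  have h0 : Complex.cosh z ≠ 0 :=
    cosh_ne_zero_of_cos_ne_zero (abs_pos.1 (hm.trans_le hz))
  have h1 : (Complex.cosh z)⁻¹ - 2 * Complex.exp (-z) =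
      -(Complex.exp (-(2 * z)) * (Complex.cosh z)⁻¹) := by
    have h2 : Complex.exp (-z) * Complex.exp z = 1 := by rw [← Complex.exp_add]; simp
    have h3 : Complex.exp (-(2 * z)) = Complex.exp (-z) * Complex.exp (-z) := by
      rw [← Complex.exp_add]; ring_nf
    have h4 : 2 * Complex.cosh z = Complex.exp z + Complex.exp (-z) := by
      rw [Complex.cosh]; ring
    field_simp
    rw [h3]
    linear_combination (-Complex.exp (-z)) * h4 - h2
  rw [h1, norm_neg, norm_mul, Complex.norm_exp]
  refine (mul_le_mul_of_nonneg_left (inv_norm_cosh_le hm hz) (Real.exp_pos _).le).trans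
    (le_of_eq ?_)
  rw [abs_of_nonneg hre, mul_left_comm, ← Real.exp_add]
  congr 2
  simp
  ring

theorem differentiableAt_inv_cosh {z : ℂ} (hz : Real.cos z.im ≠ 0) :
    DifferentiableAt ℂ (fun z => (Complex.cosh z)⁻¹) z :=
  Complex.differentiable_cosh.differentiableAt.inv (cosh_ne_zero_of_cos_ne_zero hz)

theorem integral_horizontal_line_eq_of_exp_bound {H : ℂ → ℂ} {y₁ y₂ C c : ℝ} (hc : 0 < c)
    (hH : DifferentiableOn ℂ H {z | z.im ∈ Set.uIcc y₁ y₂})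
    (hb : ∀ x : ℝ, ∀ y ∈ Set.uIcc y₁ y₂,
      ‖H (x + y * Complex.I)‖ ≤ C * Real.exp (-(c * |x|))) :
    Integrable (fun x : ℝ => H (x + y₁ * Complex.I)) ∧
      Integrable (fun x : ℝ => H (x + y₂ * Complex.I)) ∧
      ∫ x : ℝ, H (x + y₁ * Complex.I) = ∫ x : ℝ, H (x + y₂ * Complex.I) := by
  have hline : ∀ y ∈ Set.uIcc y₁ y₂, Integrable (fun x : ℝ => H (x + y * Complex.I)) := by
    intro y hy
    have hcont : Continuous fun x : ℝ => H (x + y * Complex.I) :=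
      hH.continuousOn.comp_continuous (by fun_prop) fun x => by simpa using hy
    exact ((integrable_exp_neg_mul_abs hc).const_mul C).mono' hcont.aestronglyMeasurable
      (ae_of_all _ fun x => hb x y hy)
  have h1 := hline _ Set.left_mem_uIcc
  have h2 := hline _ Set.right_mem_uIcc
  refine ⟨h1, h2, integral_horizontal_line_eq hH h1 h2 ?_⟩
  have hcont : ContinuousOn (fun p : ℝ × ℝ => H (p.1 + p.2 * Complex.I))
      (Set.univ ×ˢ Set.uIoc y₁ y₂) := by
    refine hH.continuousOn.comp (by fun_prop) fun p hp => ?_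
    simpa using Set.uIoc_subset_uIcc hp.2
  have hmeas : AEStronglyMeasurable (fun p : ℝ × ℝ => H (p.1 + p.2 * Complex.I))
      ((volume : Measure ℝ).prod (volume.restrict (Set.uIoc y₁ y₂))) := by
    have := hcont.aestronglyMeasurable (μ := (volume : Measure ℝ).prod volume)
      (MeasurableSet.univ.prod measurableSet_uIoc)
    rwa [← Measure.prod_restrict, Measure.restrict_univ] at this
  have : IsFiniteMeasure ((volume : Measure ℝ).restrict (Set.uIoc y₁ y₂)) := by
    rw [Set.uIoc]; infer_instance
  have hdom := ((integrable_exp_neg_mul_abs hc).const_mul C).mul_prod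
    (integrable_const (μ := (volume : Measure ℝ).restrict (Set.uIoc y₁ y₂)) (1 : ℝ))
  refine hdom.mono' hmeas ?_
  have hae : ∀ᵐ p : ℝ × ℝ ∂((volume : Measure ℝ).prod (volume.restrict (Set.uIoc y₁ y₂))),
      p.2 ∈ Set.uIoc y₁ y₂ :=
    Measure.quasiMeasurePreserving_snd.ae (ae_restrict_mem measurableSet_uIoc)
  filter_upwards [hae] with p hp
  rw [mul_one]
  exact hb p.1 p.2 (Set.uIoc_subset_uIcc hp)

theorem integral_inv_cosh : ∫ x : ℝ, (Real.cosh x)⁻¹ = Real.pi := by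
  have hderiv : ∀ x : ℝ, HasDerivAt (fun x => 2 * Real.arctan (Real.exp x)) (Real.cosh x)⁻¹ x := by
    intro x
    refine (((Real.hasDerivAt_arctan _).comp x (Real.hasDerivAt_exp x)).const_mul 2).congr_deriv ?_
    have h : Real.exp (-x) * Real.exp x = 1 := by rw [← Real.exp_add]; simp
    have := Real.exp_pos x
    have := Real.exp_pos (-x)
    rw [Real.cosh_eq]
    field_simp
    linear_combination h
  have hint : Integrable fun x : ℝ => (Real.cosh x)⁻¹ := by
    refine ((integrable_exp_neg_mul_abs one_pos).const_mul 2).mono'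
      (Real.continuous_cosh.inv₀ fun x => (Real.cosh_pos x).ne').aestronglyMeasurable
      (ae_of_all _ fun x => ?_)
    have h1 := exp_abs_le_two_mul_cosh x
    have h2 := Real.cosh_pos x
    rw [Real.norm_of_nonneg (inv_nonneg.2 h2.le), one_mul, Real.exp_neg, inv_le_iff_one_le_mul₀ h2]
    have := Real.exp_pos |x|
    field_simp
    linarith
  rw [integral_of_hasDerivAt_of_tendsto hderiv hint (m := 0) (n := Real.pi)]
  · simp
  · have h := (Real.continuous_arctan.tendsto 0).comp Real.tendsto_exp_atBot
    simpa using h.const_mul 2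
  · have h := (Real.tendsto_arctan_atTop.mono_right nhdsWithin_le_nhds).comp Real.tendsto_exp_atTop
    have h' := h.const_mul 2
    rwa [mul_div_cancel₀ _ two_ne_zero] at h'

/-- The zeros of `cosh` nearest to the real axis are `±iπ/2`, so the line can be moved to the axis,
where the primitive is `2 arctan(eˣ)`. -/
theorem integral_inv_cosh_add_mul_I {u : ℝ} (hu : |u| < Real.pi / 2) :
    ∫ x : ℝ, (Complex.cosh (x + u * Complex.I))⁻¹ = Real.pi := by
  have hm : 0 < Real.cos u := Real.cos_pos_of_mem_Ioo (abs_lt.1 hu)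
  have hcos : ∀ y ∈ Set.uIcc u 0, Real.cos u ≤ |Real.cos y| := by
    intro y hy
    have hyu : |y| ≤ |u| := by
      have := Set.abs_sub_right_of_mem_uIcc hy
      simpa using this
    rw [← Real.cos_abs u, ← Real.cos_abs y]
    refine le_trans ?_ (le_abs_self _)
    exact Real.cos_le_cos_of_nonneg_of_le_pi (abs_nonneg _)
      (by linarith [Real.pi_pos]) hyu
  have h := integral_horizontal_line_eq_of_exp_bound (H := fun z => (Complex.cosh z)⁻¹)
    (C := 2 / Real.cos u) one_pos
    (fun z hz => (differentiableAt_inv_cosh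
      (abs_pos.1 (hm.trans_le (hcos _ hz)))).differentiableWithinAt)
    (fun x y hy => by
      have := inv_norm_cosh_le (z := x + y * Complex.I) hm (by simpa using hcos y hy)
      simpa using this)
  rw [h.2.2]
  simp only [Complex.ofReal_zero, zero_mul, add_zero, ← Complex.ofReal_cosh, ← Complex.ofReal_inv]
  rw [integral_complex_ofReal, integral_inv_cosh]

end Cosh

end Worm

namespace Worm

/-! ### Raising the line of integration past one pole -/

section ContourShift

/-- The integrand of the `j`-th coefficient of the Szegő kernel. -/
noncomputable def coeffIntegrand (b : ℝ) (τ : ℂ) (j : ℤ) (z : ℂ) : ℂ :=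
  Complex.exp (Complex.I * z * τ) * (Complex.cosh (Real.pi * z))⁻¹ *
    (Complex.cosh ((2 * z - j) * b))⁻¹

variable {b h ν : ℝ} {τ : ℂ}

theorem coeff_arg_re (b : ℝ) (j : ℤ) (x y : ℝ) :
    ((2 * ((x : ℂ) + y * Complex.I) - j) * b).re = (2 * x - j) * b := by simp

theorem coeff_arg_im (b : ℝ) (j : ℤ) (x y : ℝ) :
    ((2 * ((x : ℂ) + y * Complex.I) - j) * b).im = 2 * b * y := by simp; ring

theorem exp_neg_abs_affine_le (hb : 0 < b) (j : ℤ) (x : ℝ) :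
    Real.exp (-|(2 * x - j) * b|) ≤ Real.exp (|(j : ℝ)| * b) * Real.exp (-(2 * b * |x|)) := by
  rw [← Real.exp_add, Real.exp_le_exp, abs_mul, abs_of_pos hb]
  have h1 : |2 * x| ≤ |2 * x - j| + |(j : ℝ)| := by
    simpa using abs_add_le (2 * x - j) (j : ℝ)
  rw [abs_mul, abs_two] at h1
  nlinarith

theorem norm_exp_I_mul_le (x y : ℝ) (τ : ℂ) :
    ‖Complex.exp (Complex.I * (x + y * Complex.I) * τ)‖ ≤
      Real.exp (|y| * |τ.re|) * Real.exp (|τ.im| * |x|) := by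
  rw [Complex.norm_exp, ← Real.exp_add, Real.exp_le_exp]
  have e : (Complex.I * (x + y * Complex.I) * τ).re = -(y * τ.re) - τ.im * x := by
    simp; ring
  rw [e]
  have h1 := neg_abs_le (y * τ.re)
  have h2 := neg_abs_le (τ.im * x)
  rw [abs_mul] at h1 h2
  linarith

theorem integral_inv_cosh_affine (hb : 0 < b) (j : ℤ) (y : ℝ) :
    ∫ x : ℝ, (Complex.cosh ((2 * ((x : ℂ) + y * Complex.I) - j) * b))⁻¹ =
      (2 * b)⁻¹ * ∫ x : ℝ, (Complex.cosh (x + (2 * b * y : ℝ) * Complex.I))⁻¹ := by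
  have h1 := Measure.integral_comp_mul_left
    (fun x : ℝ => (Complex.cosh ((x - j * b : ℝ) + (2 * b * y : ℝ) * Complex.I))⁻¹) (2 * b)
  rw [integral_sub_right_eq_self
    (fun x : ℝ => (Complex.cosh ((x : ℝ) + (2 * b * y : ℝ) * Complex.I))⁻¹) (j * b : ℝ),
    abs_of_pos (by positivity)] at h1
  rw [Complex.real_smul] at h1
  push_cast at h1 ⊢
  rw [← h1]
  congr 1
  ext x
  congr 2
  ring

theorem integrable_inv_cosh_affine (hb : 0 < b) (j : ℤ) {y : ℝ} (hy : Real.cos (2 * b * y) ≠ 0) :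
    Integrable fun x : ℝ => (Complex.cosh ((2 * ((x : ℂ) + y * Complex.I) - j) * b))⁻¹ := by
  have hm := abs_pos.2 hy
  have hne : ∀ x : ℝ, Complex.cosh ((2 * ((x : ℂ) + y * Complex.I) - j) * b) ≠ 0 := fun x =>
    cosh_ne_zero_of_cos_ne_zero (by rwa [coeff_arg_im])
  refine ((integrable_exp_neg_mul_abs (by positivity : 0 < 2 * b)).const_mul
    (2 / |Real.cos (2 * b * y)| * Real.exp (|(j : ℝ)| * b))).mono'
    (Continuous.aestronglyMeasurable (Continuous.inv₀ (by fun_prop) hne)) (ae_of_all _ fun x => ?_)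
  have h1 := inv_norm_cosh_le (z := (2 * ((x : ℂ) + y * Complex.I) - j) * b) hm
    (by rw [coeff_arg_im])
  rw [coeff_arg_re] at h1
  exact h1.trans ((mul_le_mul_of_nonneg_left (exp_neg_abs_affine_le hb j x)
    (by positivity)).trans_eq (mul_assoc _ _ _).symm)

theorem norm_inv_cosh_affine_le (hb : 0 < b) {j : ℤ} {x : ℝ} (y : ℝ) (hx : 1 / b ≤ |2 * x - j|) :
    ‖(Complex.cosh ((2 * ((x : ℂ) + y * Complex.I) - j) * b))⁻¹‖ ≤
      4 * Real.exp (|(j : ℝ)| * b) * Real.exp (-(2 * b * |x|)) := by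
  have hX : 1 ≤ |((2 * ((x : ℂ) + y * Complex.I) - j) * b).re| := by
    rwa [coeff_arg_re, abs_mul, abs_of_pos hb, ← div_le_iff₀ hb]
  have h4 := cosh_le_two_mul_norm_cosh hX
  have h5 := exp_abs_le_two_mul_cosh ((2 * ((x : ℂ) + y * Complex.I) - j) * b).re
  have h6 : Real.exp |((2 * ((x : ℂ) + y * Complex.I) - j) * b).re| / 4 ≤
      ‖Complex.cosh ((2 * ((x : ℂ) + y * Complex.I) - j) * b)‖ := by linarith
  rw [norm_inv]
  refine (inv_anti₀ (by positivity) h6).trans ?_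
  rw [inv_div, coeff_arg_re, div_eq_mul_inv, ← Real.exp_neg, mul_assoc]
  exact mul_le_mul_of_nonneg_left (exp_neg_abs_affine_le hb j x) (by norm_num)

theorem norm_exp_mul_inv_cosh_le {x y : ℝ} (τ : ℂ) (hy : 0 ≤ y) (hyh : y ≤ h) (hh : h < 1 / 2) :
    ‖Complex.exp (Complex.I * (x + y * Complex.I) * τ) *
        (Complex.cosh (Real.pi * (x + y * Complex.I)))⁻¹‖ ≤
      Real.exp (h * |τ.re|) * (2 / Real.cos (Real.pi * h)) *
        Real.exp ((|τ.im| - Real.pi) * |x|) := by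
  have hpi := Real.pi_pos
  have hm : 0 < Real.cos (Real.pi * h) :=
    Real.cos_pos_of_mem_Ioo ⟨by nlinarith, by nlinarith⟩
  have h4 := norm_exp_I_mul_le x y τ
  have h5 := inv_norm_cosh_le (z := Real.pi * (x + y * Complex.I)) hm (by
    have : (Real.pi * ((x : ℂ) + y * Complex.I)).im = Real.pi * y := by simp
    rw [this]
    refine le_trans ?_ (le_abs_self _)
    exact Real.cos_le_cos_of_nonneg_of_le_pi (mul_nonneg hpi.le hy) (by nlinarith)
      (by nlinarith))
  have h6 : (Real.pi * ((x : ℂ) + y * Complex.I)).re = Real.pi * x := by simp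
  rw [h6, abs_mul, abs_of_pos hpi] at h5
  rw [norm_mul]
  have h7 : Real.exp (|y| * |τ.re|) ≤ Real.exp (h * |τ.re|) := by
    rw [abs_of_nonneg hy]
    gcongr
  have e : Real.exp ((|τ.im| - Real.pi) * |x|) =
      Real.exp (|τ.im| * |x|) * Real.exp (-(Real.pi * |x|)) := by
    rw [← Real.exp_add]; ring_nf
  calc _ ≤ (Real.exp (|y| * |τ.re|) * Real.exp (|τ.im| * |x|)) *
        (2 / Real.cos (Real.pi * h) * Real.exp (-(Real.pi * |x|))) :=
        mul_le_mul h4 h5 (norm_nonneg _) (by positivity)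
    _ ≤ (Real.exp (h * |τ.re|) * Real.exp (|τ.im| * |x|)) *
        (2 / Real.cos (Real.pi * h) * Real.exp (-(Real.pi * |x|))) := by gcongr
    _ = _ := by rw [e]; ring

/-- Past the pole `cosh` is brought back to the central strip by `cosh(z - πi) = -cosh z`, so the
two integrals are `π/(2b)` and `-π/(2b)`. This replaces the residue theorem. -/
theorem integral_inv_cosh_affine_sub (hb : 0 < b) (j : ℤ) (h1 : Real.pi / 2 < 2 * b * h)
    (h2 : 2 * b * h < 3 * Real.pi / 2) :
    (∫ x : ℝ, (Complex.cosh ((2 * ((x : ℂ) + (0 : ℝ) * Complex.I) - j) * b))⁻¹) -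
      ∫ x : ℝ, (Complex.cosh ((2 * ((x : ℂ) + h * Complex.I) - j) * b))⁻¹ = Real.pi / b := by
  have hb' : (b : ℂ) ≠ 0 := by exact_mod_cast hb.ne'
  have e : ∀ x : ℝ, (Complex.cosh (x + (2 * b * h : ℝ) * Complex.I))⁻¹ =
      -(Complex.cosh (x + (2 * b * h - Real.pi : ℝ) * Complex.I))⁻¹ := by
    intro x
    have : (x : ℂ) + (2 * b * h - Real.pi : ℝ) * Complex.I =
        x + (2 * b * h : ℝ) * Complex.I - Real.pi * Complex.I := by push_cast; ring
    rw [this, Complex.cosh_sub_pi_mul_I, inv_neg, neg_neg]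
  rw [integral_inv_cosh_affine hb, integral_inv_cosh_affine hb]
  simp only [e]
  rw [integral_neg, integral_inv_cosh_add_mul_I (u := 2 * b * h - Real.pi) (abs_lt.2 ⟨by linarith, by linarith⟩),
    integral_inv_cosh_add_mul_I (u := 2 * b * 0) (by rw [mul_zero, abs_zero]; positivity)]
  push_cast
  field_simp
  ring

set_option maxHeartbeats 800000 in
/-- Moving the line of integration across the only pole between the two lines. -/
theorem integral_coeffIntegrand_shift (hb : 0 < b) (hν : 2 * b * ν = Real.pi) (h1 : ν / 2 < h)
    (h2 : h < 1 / 2) (h3 : h < 3 * ν / 2) (hτ : |τ.im| < Real.pi + 2 * b) (j : ℤ) :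
    ∫ x : ℝ, coeffIntegrand b τ j x =
      Real.pi / b * (Complex.exp (Complex.I * (j / 2 + ν / 2 * Complex.I) * τ) *
        (Complex.cosh (Real.pi * (j / 2 + ν / 2 * Complex.I)))⁻¹) +
      ∫ x : ℝ, coeffIntegrand b τ j (x + h * Complex.I) := by
  have hpi := Real.pi_pos
  have hν0 : 0 < ν := by
    by_contra hcon
    have : 2 * b * ν ≤ 0 := mul_nonpos_of_nonneg_of_nonpos (by positivity) (not_lt.1 hcon)
    linarith
  have h0 : 0 < h := by linarith
  set ξ₀ : ℂ := j / 2 + ν / 2 * Complex.I with hξ₀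
  have hξim : ξ₀.im = ν / 2 := by simp [hξ₀]
  set G : ℂ → ℂ := fun z => Complex.exp (Complex.I * z * τ) * (Complex.cosh (Real.pi * z))⁻¹ with hG
  set D : ℂ → ℂ := fun z => Complex.cosh ((2 * z - j) * b) with hD
  have hξarg : (2 * ξ₀ - j) * b = (Real.pi / 2 : ℂ) * Complex.I := by
    have : (Real.pi : ℂ) = 2 * b * ν := by exact_mod_cast hν.symm
    rw [hξ₀, this]; ring
  have hD0 : D ξ₀ = 0 := by
    simp only [hD, hξarg, Complex.cosh_mul_I, Complex.cos_pi_div_two]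
  -- An open strip containing both lines, in which `cosh(πz)` has no zero and `ξ₀` is the only zero
  -- of `D`.
  set S : Set ℂ := {z | -(1 / 2) < z.im ∧ z.im < 1 / 2 ∧ -(ν / 2) < z.im ∧ z.im < 3 * ν / 2} with hS
  have hSo : IsOpen S := by
    refine (isOpen_lt continuous_const Complex.continuous_im).inter
      ((isOpen_lt Complex.continuous_im continuous_const).inter
      ((isOpen_lt continuous_const Complex.continuous_im).inter
      (isOpen_lt Complex.continuous_im continuous_const)))
  have hξS : ξ₀ ∈ S := by
    simp only [hS, Set.mem_ofPred_eq, hξim]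
    refine ⟨by linarith, by linarith, by linarith, by linarith⟩
  have hSn : S ∈ 𝓝 ξ₀ := hSo.mem_nhds hξS
  have hcosπ : ∀ {z : ℂ}, -(1 / 2) < z.im → z.im < 1 / 2 → 0 < Real.cos (Real.pi * z).im := by
    intro z hz1 hz2
    rw [Complex.im_ofReal_mul]
    refine Real.cos_pos_of_mem_Ioo ⟨by nlinarith, by nlinarith⟩
  have hGd : DifferentiableOn ℂ G S := by
    intro z hz
    refine DifferentiableAt.differentiableWithinAt ?_
    refine DifferentiableAt.mul (by fun_prop) (DifferentiableAt.inv (by fun_prop) ?_)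
    exact cosh_ne_zero_of_cos_ne_zero (hcosπ hz.1 hz.2.1).ne'
  have hDd : Differentiable ℂ D := by fun_prop
  have hDeriv : deriv D ξ₀ ≠ 0 := by
    have : HasDerivAt D (Complex.sinh ((2 * ξ₀ - j) * b) * (2 * 1 * b)) ξ₀ :=
      ((((hasDerivAt_id ξ₀).const_mul (2 : ℂ)).sub_const (j : ℂ)).mul_const (b : ℂ)).ccosh
    rw [this.deriv, hξarg, Complex.sinh_mul_I, Complex.sin_pi_div_two]
    simp [hb.ne']
  have hDne : ∀ z ∈ S, z ≠ ξ₀ → D z ≠ 0 := by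
    intro z hz hne hz0
    have hn := norm_cosh_sq ((2 * z - j) * b)
    have hz0' : Complex.cosh ((2 * z - j) * b) = 0 := hz0
    rw [hz0', norm_zero] at hn
    have hs : Real.sinh ((2 * z - j) * b).re = 0 := by nlinarith [sq_nonneg (Real.cos ((2 * z - j) * b).im), sq_nonneg (Real.sinh ((2 * z - j) * b).re)]
    have hc : Real.cos ((2 * z - j) * b).im = 0 := by nlinarith [sq_nonneg (Real.cos ((2 * z - j) * b).im), sq_nonneg (Real.sinh ((2 * z - j) * b).re)]
    rw [← Complex.re_add_im z, coeff_arg_re, Real.sinh_eq_zero] at hs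
    rw [← Complex.re_add_im z, coeff_arg_im] at hc
    have hre : z.re = j / 2 := by
      rcases mul_eq_zero.1 hs with h | h
      · linarith
      · exact absurd h hb.ne'
    have him : z.im = ν / 2 := by
      by_contra hcon
      rcases lt_or_gt_of_ne hcon with hlt | hgt
      · refine (Real.cos_pos_of_mem_Ioo ⟨?_, ?_⟩).ne' hc
        · nlinarith [hz.2.2.1]
        · nlinarith
      · refine (Real.cos_neg_of_pi_div_two_lt_of_lt ?_ ?_).ne hc
        · nlinarith
        · nlinarith [hz.2.2.2]
    refine hne (Complex.ext ?_ ?_)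
    · rw [hre, hξ₀]; simp
    · rw [him, hξim]
  -- This is `(G - G ξ₀) / D` with its singularity removed. The subtracted multiple of `1 / D` is
  -- integrated explicitly and gives the residue term.
  set H : ℂ → ℂ := fun z => dslope G ξ₀ z * (dslope D ξ₀ z)⁻¹ with hH
  have hHeq : ∀ z, z ≠ ξ₀ → H z = (G z - G ξ₀) * (D z)⁻¹ := by
    intro z hz
    have : z - ξ₀ ≠ 0 := sub_ne_zero.2 hz
    simp only [hH, dslope_of_ne _ hz, slope_def_field, hD0, sub_zero]
    rw [inv_div]
    field_simp
  have hHd : DifferentiableOn ℂ H S := by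
    refine ((Complex.differentiableOn_dslope hSn).2 hGd).mul
      (((Complex.differentiableOn_dslope hSn).2 hDd.differentiableOn).inv fun z hz => ?_)
    rcases eq_or_ne z ξ₀ with rfl | hne
    · rwa [dslope_same]
    · rw [dslope_of_ne _ hne, slope_def_field, hD0, sub_zero]
      exact div_ne_zero (hDne z hz hne) (sub_ne_zero.2 hne)
  have hsub : {z : ℂ | z.im ∈ Set.uIcc 0 h} ⊆ S := by
    intro z hz
    rw [Set.mem_ofPred_eq, Set.uIcc_of_le h0.le] at hz
    exact ⟨by linarith [hz.1], by linarith [hz.2], by linarith [hz.1], by linarith [hz.2]⟩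
  -- The decay rates of `G / D` and `1 / D` respectively, the first one after the growth of
  -- `e^{iξτ}` is deducted.
  set c := min (Real.pi + 2 * b - |τ.im|) (2 * b) with hc
  have hc0 : 0 < c := lt_min (by linarith) (by positivity)
  -- For `|x| > R` the real part of `(2z - j)b` is at least `1` in absolute value; the remaining
  -- rectangle is compact.
  set R := |(j : ℝ)| / 2 + 1 / (2 * b) with hR
  have hcomp : IsCompact (Set.Icc (-R) R ×ℂ Set.Icc 0 h) := isCompact_Icc.reProdIm isCompact_Icc
  obtain ⟨C₁, hC₁⟩ := hcomp.exists_bound_of_continuousOn (f := H) (hHd.continuousOn.mono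
    fun z hz => hsub (by rw [Set.mem_ofPred_eq, Set.uIcc_of_le h0.le]; exact hz.2))
  have hm : 0 < Real.cos (Real.pi * h) :=
    Real.cos_pos_of_mem_Ioo ⟨by nlinarith, by nlinarith⟩
  set K := Real.exp (h * |τ.re|) * (2 / Real.cos (Real.pi * h)) with hK
  have hbound : ∀ x : ℝ, ∀ y ∈ Set.uIcc 0 h, ‖H (x + y * Complex.I)‖ ≤
      (|C₁| * Real.exp (c * R) + 4 * Real.exp (|(j : ℝ)| * b) * (K + ‖G ξ₀‖)) *
        Real.exp (-(c * |x|)) := by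
    intro x y hy
    have hy' : y ∈ Set.Icc 0 h := by rwa [Set.uIcc_of_le h0.le] at hy
    rcases le_or_gt |x| R with hx | hx
    · have hh := hC₁ (x + y * Complex.I) ⟨by simpa using abs_le.1 hx, by simpa using hy'⟩
      have h4 : 1 ≤ Real.exp (c * R) * Real.exp (-(c * |x|)) := by
        rw [← Real.exp_add]
        exact Real.one_le_exp (by nlinarith)
      have h5 : 0 ≤ 4 * Real.exp (|(j : ℝ)| * b) * (K + ‖G ξ₀‖) * Real.exp (-(c * |x|)) := by
        positivity
      nlinarith [le_abs_self C₁, abs_nonneg C₁]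
    · set z : ℂ := x + y * Complex.I with hz
      have hX : 1 / b ≤ |2 * x - j| := by
        have h4 : |2 * x| ≤ |2 * x - j| + |(j : ℝ)| := by
          simpa using abs_add_le (2 * x - j) (j : ℝ)
        rw [abs_mul, abs_two] at h4
        have : 2 * R = |(j : ℝ)| + 1 / b := by rw [hR]; field_simp
        linarith
      have hDb := norm_inv_cosh_affine_le hb y hX
      have hGb := norm_exp_mul_inv_cosh_le (x := x) τ hy'.1 hy'.2 h2
      change ‖(D z)⁻¹‖ ≤ _ at hDb
      change ‖G z‖ ≤ K * _ at hGb
      have hzne : z ≠ ξ₀ := by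
        intro hcon
        have h4 : (2 * x - j : ℝ) = 0 := by
          have : z.re = j / 2 := by rw [hcon, hξ₀]; simp
          have h5 : z.re = x := by simp [hz]
          linarith
        rw [h4, abs_zero] at hX
        exact (one_div_pos.2 hb).not_ge hX
      rw [hHeq z hzne, norm_mul]
      have e1 : Real.exp ((|τ.im| - Real.pi) * |x|) * Real.exp (-(2 * b * |x|)) ≤
          Real.exp (-(c * |x|)) := by
        rw [← Real.exp_add, Real.exp_le_exp]
        nlinarith [min_le_left (Real.pi + 2 * b - |τ.im|) (2 * b), abs_nonneg x]
      have e2 : Real.exp (-(2 * b * |x|)) ≤ Real.exp (-(c * |x|)) := by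
        rw [Real.exp_le_exp]
        nlinarith [min_le_right (Real.pi + 2 * b - |τ.im|) (2 * b), abs_nonneg x]
      have hK0 : 0 ≤ K := by positivity
      calc ‖G z - G ξ₀‖ * ‖(D z)⁻¹‖
          ≤ (K * Real.exp ((|τ.im| - Real.pi) * |x|) + ‖G ξ₀‖) *
            (4 * Real.exp (|(j : ℝ)| * b) * Real.exp (-(2 * b * |x|))) := by
            gcongr
            exact (norm_sub_le _ _).trans (by gcongr)
        _ = 4 * Real.exp (|(j : ℝ)| * b) * (K * (Real.exp ((|τ.im| - Real.pi) * |x|) *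
              Real.exp (-(2 * b * |x|))) + ‖G ξ₀‖ * Real.exp (-(2 * b * |x|))) := by ring
        _ ≤ 4 * Real.exp (|(j : ℝ)| * b) * (K * Real.exp (-(c * |x|)) +
              ‖G ξ₀‖ * Real.exp (-(c * |x|))) := by gcongr
        _ = 4 * Real.exp (|(j : ℝ)| * b) * (K + ‖G ξ₀‖) * Real.exp (-(c * |x|)) := by ring
        _ ≤ _ := by
            rw [add_mul]
            have : 0 ≤ |C₁| * Real.exp (c * R) * Real.exp (-(c * |x|)) := by positivity
            linarith
  obtain ⟨i0, ih, hshift⟩ := integral_horizontal_line_eq_of_exp_bound hc0 (hHd.mono hsub) hbound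
  have hne : ∀ (y : ℝ), y ≠ ν / 2 → ∀ x : ℝ, (x : ℂ) + y * Complex.I ≠ ξ₀ := by
    intro y hy x hcon
    apply hy
    rw [← hξim, ← hcon]
    simp
  have hkey : ∀ (y : ℝ), y ≠ ν / 2 → Real.cos (2 * b * y) ≠ 0 →
      Integrable (fun x : ℝ => H (x + y * Complex.I)) →
      ∫ x : ℝ, H (x + y * Complex.I) = (∫ x : ℝ, coeffIntegrand b τ j (x + y * Complex.I)) -
        G ξ₀ * ∫ x : ℝ, (Complex.cosh ((2 * ((x : ℂ) + y * Complex.I) - j) * b))⁻¹ := by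
    intro y hy hcy hi
    have hi' := (integrable_inv_cosh_affine hb j hcy).const_mul (G ξ₀)
    have e : ∀ x : ℝ, H (x + y * Complex.I) = coeffIntegrand b τ j (x + y * Complex.I) -
        G ξ₀ * (Complex.cosh ((2 * ((x : ℂ) + y * Complex.I) - j) * b))⁻¹ := by
      intro x
      rw [hHeq _ (hne y hy x), sub_mul]
      rfl
    have hi'' : Integrable (fun x : ℝ => coeffIntegrand b τ j (x + y * Complex.I)) := by
      refine (hi.add hi').congr (ae_of_all _ fun x => ?_)
      simp only [Pi.add_apply, e]
      ring
    simp only [e]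
    rw [integral_sub hi'' hi', integral_const_mul]
  have hcosh : Real.cos (2 * b * h) ≠ 0 := by
    refine (Real.cos_neg_of_pi_div_two_lt_of_lt ?_ ?_).ne <;> nlinarith
  rw [hkey 0 (by linarith) (by simp) i0, hkey h h1.ne' hcosh ih] at hshift
  have hsub := integral_inv_cosh_affine_sub (h := h) hb j (by nlinarith) (by nlinarith)
  have hfin : ∫ x : ℝ, coeffIntegrand b τ j x =
      ∫ x : ℝ, coeffIntegrand b τ j (x + (0 : ℝ) * Complex.I) := by simp
  rw [hfin, ← hsub]
  change _ = _ * G ξ₀ + _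
  linear_combination hshift

end ContourShift

end Worm

namespace Worm

/-! ### The region of pairs `(τ, μ)` -/

section Region

/-- The region of the pairs `(τ, μ)` on which the kernel is studied. -/
def region (b δ : ℝ) : Set (ℂ × ℂ) :=
  {p | p.2 ≠ 0 ∧ |p.1.im - 2 * Real.log ‖p.2‖| < Real.pi + 2 * δ ∧ |Real.log ‖p.2‖| < b + δ}

theorem isOpen_region (b δ : ℝ) : IsOpen (region b δ) := by
  have h0 : IsOpen {p : ℂ × ℂ | p.2 ≠ 0} := isOpen_ne_fun continuous_snd continuous_const
  have hlog : ContinuousOn (fun p : ℂ × ℂ => Real.log ‖p.2‖) {p : ℂ × ℂ | p.2 ≠ 0} :=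
    ContinuousOn.log (by fun_prop) fun p hp => by simpa using hp
  have h1 : ContinuousOn (fun p : ℂ × ℂ => (|p.1.im - 2 * Real.log ‖p.2‖|, |Real.log ‖p.2‖|))
      {p : ℂ × ℂ | p.2 ≠ 0} := by fun_prop
  exact h1.isOpen_inter_preimage h0 (isOpen_Iio.prod (isOpen_Iio (a := b + δ)))

theorem region_mono {b δ δ' : ℝ} (h : δ ≤ δ') : region b δ ⊆ region b δ' :=
  fun _ hp => ⟨hp.1, hp.2.1.trans_le (by linarith), hp.2.2.trans_le (by linarith)⟩

/-- The involution `(τ, μ) ↦ (-τ, μ⁻¹)`. -/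
noncomputable def flip (p : ℂ × ℂ) : ℂ × ℂ := (-p.1, p.2⁻¹)

theorem flip_mem_region {b δ : ℝ} {p : ℂ × ℂ} (hp : p ∈ region b δ) : flip p ∈ region b δ := by
  refine ⟨inv_ne_zero hp.1, ?_, ?_⟩
  · have h := hp.2.1
    rw [← abs_neg] at h
    simp only [flip, norm_inv, Real.log_inv, Complex.neg_im]
    convert h using 2
    ring
  · simpa [flip] using hp.2.2

theorem differentiableOn_flip (b δ : ℝ) : DifferentiableOn ℂ flip (region b δ) :=
  differentiable_fst.neg.differentiableOn.prodMk
    (differentiable_snd.differentiableOn.inv fun _ hp => hp.1)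

/-- The function `μʲ e^{iξτ}`. -/
noncomputable def pairMode (p : ℂ × ℂ) (q : ℤ × ℝ) : ℂ :=
  p.2 ^ q.1 * Complex.exp (Complex.I * q.2 * p.1)

theorem pairMode_flip (p : ℂ × ℂ) (q : ℤ × ℝ) : pairMode (flip p) q = pairMode p (-q) := by
  simp [pairMode, flip]

theorem norm_zpow_eq_exp {z : ℂ} (hz : z ≠ 0) (n : ℤ) :
    ‖z ^ n‖ = Real.exp (Real.log ‖z‖ * n) := by
  rw [norm_zpow, ← Real.rpow_intCast, Real.rpow_def_of_pos (norm_pos_iff.2 hz)]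

/-- In the coordinates `ξ` and `2ξ - j` the growth rates are exactly the two quantities bounded in
`region`. -/
theorem norm_pairMode {p : ℂ × ℂ} (hp : p.2 ≠ 0) (q : ℤ × ℝ) :
    ‖pairMode p q‖ = Real.exp ((2 * Real.log ‖p.2‖ - p.1.im) * q.2 -
      Real.log ‖p.2‖ * (2 * q.2 - q.1)) := by
  have e : (Complex.I * q.2 * p.1).re = -(q.2 * p.1.im) := by simp
  rw [pairMode, norm_mul, norm_zpow_eq_exp hp, Complex.norm_exp, e, ← Real.exp_add]
  congr 1
  ring

theorem measurable_zpow_fst (z : ℂ) : Measurable fun q : ℤ × ℝ => z ^ q.1 :=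
  (measurable_from_top (f := fun j : ℤ => z ^ j)).comp measurable_fst

theorem measurable_pairMode (p : ℂ × ℂ) : Measurable (pairMode p) := by
  have := measurable_zpow_fst p.2
  unfold pairMode
  fun_prop

theorem differentiableOn_pairMode (b δ : ℝ) (q : ℤ × ℝ) :
    DifferentiableOn ℂ (fun p => pairMode p q) (region b δ) := by
  unfold pairMode
  refine DifferentiableOn.mul (fun p hp => ?_) (by fun_prop)
  exact ((differentiableAt_zpow.2 (Or.inl hp.1)).comp p
    differentiableAt_snd).differentiableWithinAt

theorem integrable_exp_neg_cone {κ₁ κ₂ : ℝ} (h₁ : 0 < κ₁) (h₂ : 0 < κ₂) :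
    Integrable (fun q : ℤ × ℝ => Real.exp (-(κ₁ * |q.2|)) * Real.exp (-(κ₂ * |2 * q.2 - q.1|)))
      modeMeasure := by
  have hm := measurable_intCast_fst
  -- From `|j| ≤ 2|ξ| + |2ξ - j|`, decay at rate `c` in both `|j|` and `|ξ|` costs `3c` in `|ξ|` and
  -- `c` in `|2ξ - j|`.
  set c := min (κ₁ / 3) κ₂ with hc
  have hc0 : 0 < c := lt_min (by positivity) h₂
  refine (integrable_exp_neg_mode hc0).mono' (by fun_prop) (ae_of_all _ fun q => ?_)
  rw [Real.norm_of_nonneg (by positivity), ← Real.exp_add, ← Real.exp_add, Real.exp_le_exp]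
  have h3 : |(q.1 : ℝ)| ≤ 2 * |q.2| + |2 * q.2 - q.1| := by
    have := abs_sub (2 * q.2) (2 * q.2 - q.1)
    rw [sub_sub_cancel, abs_mul, abs_two] at this
    exact this
  have h4 : c ≤ κ₁ / 3 := min_le_left _ _
  have h5 : c ≤ κ₂ := min_le_right _ _
  have h6 := abs_nonneg q.2
  have h7 := abs_nonneg (2 * q.2 - (q.1 : ℝ))
  nlinarith

end Region

/-! ### Fourier integrals over a cone -/

section Cone

/-- Measurable functions vanishing on the negative half-line and of exponential decay at
infinity. -/
def HalfLineDecay (R : ℝ → ℂ) (k : ℝ) : Prop :=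
  Measurable R ∧ (∀ x ≤ 0, R x = 0) ∧ ∃ C, ∀ x, 0 < x → ‖R x‖ ≤ C * Real.exp (-(k * x))

/-- The exponential function `e^{-kx}` on the positive half-line. -/
noncomputable def halfExp (k : ℝ) : ℝ → ℂ := (Set.Ioi 0).indicator fun x => Complex.exp (-(k * x))

theorem halfExp_of_pos (k : ℝ) {x : ℝ} (hx : 0 < x) : halfExp k x = Complex.exp (-(k * x)) :=
  Set.indicator_of_mem hx _

theorem halfExp_of_nonpos (k : ℝ) {x : ℝ} (hx : x ≤ 0) : halfExp k x = 0 :=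
  Set.indicator_of_notMem (by simpa using hx) _

theorem halfLineDecay_halfExp (k : ℝ) : HalfLineDecay (halfExp k) k := by
  refine ⟨Measurable.indicator (by fun_prop) measurableSet_Ioi, fun x hx => halfExp_of_nonpos k hx,
    1, fun x hx => ?_⟩
  rw [halfExp_of_pos k hx, Complex.norm_exp, one_mul]
  simp

theorem HalfLineDecay.mono {R : ℝ → ℂ} {k k' : ℝ} (hR : HalfLineDecay R k) (h : k' ≤ k) :
    HalfLineDecay R k' := by
  obtain ⟨h1, h2, C, hC⟩ := hR
  refine ⟨h1, h2, |C|, fun x hx => (hC x hx).trans ?_⟩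
  gcongr
  exact le_abs_self C

theorem HalfLineDecay.exists_bound {R : ℝ → ℂ} {k : ℝ} (hR : HalfLineDecay R k) :
    ∃ C, 0 ≤ C ∧ ∀ x, ‖R x‖ ≤ C * Real.exp (-(k * x)) := by
  obtain ⟨h1, h2, C, hC⟩ := hR
  refine ⟨|C|, abs_nonneg C, fun x => ?_⟩
  rcases le_or_gt x 0 with hx | hx
  · rw [h2 x hx, norm_zero]; positivity
  · exact (hC x hx).trans (by gcongr; exact le_abs_self C)

/-- The part of the Fourier integral supported in one cone. -/
noncomputable def coneTerm (s : ℝ) (P Q : ℝ → ℂ) (p : ℂ × ℂ) : ℂ :=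
  ∫ q, pairMode p q * (P q.2 * Q (s * (2 * q.2 - q.1))) ∂modeMeasure

variable {b s k₁ k₂ κ₁ κ₂ : ℝ} {P Q P' Q' : ℝ → ℂ} {p : ℂ × ℂ}

theorem measurable_coneTerm (hP : Measurable P) (hQ : Measurable Q) :
    Measurable fun q : ℤ × ℝ => pairMode p q * (P q.2 * Q (s * (2 * q.2 - q.1))) := by
  have := measurable_intCast_fst
  exact (measurable_pairMode p).mul ((hP.comp measurable_snd).mul (hQ.comp (by fun_prop)))

/-- The integrand lives where `ξ > 0` and `s(2ξ - j) > 0`; there both absolute values open with a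
fixed sign and the rates simply subtract. The constant does not depend on `p`. -/
theorem HalfLineDecay.exists_cone_bound (hP : HalfLineDecay P k₁) (hQ : HalfLineDecay Q k₂)
    (hs : s = 1 ∨ s = -1) (κ₁ κ₂ : ℝ) :
    ∃ C, 0 ≤ C ∧ ∀ p : ℂ × ℂ, p.2 ≠ 0 → κ₁ ≤ k₁ - (2 * Real.log ‖p.2‖ - p.1.im) →
      κ₂ ≤ k₂ + s * Real.log ‖p.2‖ → ∀ q : ℤ × ℝ,
      ‖pairMode p q * (P q.2 * Q (s * (2 * q.2 - q.1)))‖ ≤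
        C * (Real.exp (-(κ₁ * |q.2|)) * Real.exp (-(κ₂ * |2 * q.2 - q.1|))) := by
  obtain ⟨C₁, hC₁, hPb⟩ := hP.exists_bound
  obtain ⟨C₂, hC₂, hQb⟩ := hQ.exists_bound
  refine ⟨C₁ * C₂, by positivity, fun p hp h1 h2 q => ?_⟩
  rcases le_or_gt q.2 0 with h3 | h3
  · rw [hP.2.1 _ h3, zero_mul, mul_zero, norm_zero]; positivity
  rcases le_or_gt (s * (2 * q.2 - q.1)) 0 with h4 | h4
  · rw [hQ.2.1 _ h4, mul_zero, mul_zero, norm_zero]; positivity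
  set x := s * (2 * q.2 - q.1) with hx
  have hx' : 2 * q.2 - (q.1 : ℝ) = s * x := by
    rw [hx, ← mul_assoc]; rcases hs with rfl | rfl <;> ring
  have hsx : |s * x| = x := by
    rw [abs_mul, abs_of_pos h4]; rcases hs with rfl | rfl <;> simp
  rw [norm_mul, norm_mul, norm_pairMode hp, hx', hsx, abs_of_pos h3]
  calc _ ≤ Real.exp ((2 * Real.log ‖p.2‖ - p.1.im) * q.2 - Real.log ‖p.2‖ * (s * x)) *
        ((C₁ * Real.exp (-(k₁ * q.2))) * (C₂ * Real.exp (-(k₂ * x)))) := by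
        gcongr
        · exact hPb _
        · exact hQb _
    _ = C₁ * C₂ * (Real.exp ((2 * Real.log ‖p.2‖ - p.1.im) * q.2 - Real.log ‖p.2‖ * (s * x)) *
        (Real.exp (-(k₁ * q.2)) * Real.exp (-(k₂ * x)))) := by ring
    _ ≤ _ := by
        gcongr C₁ * C₂ * ?_
        rw [← Real.exp_add, ← Real.exp_add, ← Real.exp_add, Real.exp_le_exp]
        nlinarith

theorem integrable_coneTerm (hP : HalfLineDecay P k₁) (hQ : HalfLineDecay Q k₂)
    (hs : s = 1 ∨ s = -1) (hp : p ∈ region b 0) (h1 : Real.pi ≤ k₁) (h2 : b ≤ k₂) :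
    Integrable (fun q => pairMode p q * (P q.2 * Q (s * (2 * q.2 - q.1)))) modeMeasure := by
  have h3 := (abs_lt.1 hp.2.1).1
  have h4 := abs_lt.1 hp.2.2
  have h5 : 0 < k₂ + s * Real.log ‖p.2‖ := by rcases hs with rfl | rfl <;> linarith
  obtain ⟨C, -, hC⟩ := hP.exists_cone_bound hQ hs (k₁ - (2 * Real.log ‖p.2‖ - p.1.im))
    (k₂ + s * Real.log ‖p.2‖)
  exact ((integrable_exp_neg_cone (by linarith) h5).const_mul C).mono'
    (measurable_coneTerm hP.1 hQ.1).aestronglyMeasurable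
    (ae_of_all _ (hC p hp.1 le_rfl le_rfl))

end Cone

end Worm

namespace Worm

/-! ### Geometric series over half-lines of integers -/

section GeometricSums

variable {Z : ℂ}

theorem hasSum_zpow_Ioi (hZ : Z ≠ 0) (h : ‖Z‖ < 1) (t : ℝ) :
    HasSum (fun j : ℤ => if t < j then Z ^ j else 0) (Z ^ (⌊t⌋ + 1) / (1 - Z)) := by
  have hinj : Function.Injective fun n : ℕ => ⌊t⌋ + 1 + (n : ℤ) := fun m n hmn => by
    simpa using hmn
  refine (hinj.hasSum_iff fun j hj => if_neg fun hlt => hj ?_).1 ?_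
  · have : ⌊t⌋ < j := Int.floor_lt.2 hlt
    exact ⟨(j - (⌊t⌋ + 1)).toNat, by simp only; omega⟩
  · rw [div_eq_mul_inv]
    refine ((hasSum_geometric_of_norm_lt_one h).mul_left (Z ^ (⌊t⌋ + 1))).congr_fun fun n => ?_
    have : t < ((⌊t⌋ + 1 + (n : ℤ) : ℤ) : ℝ) := Int.floor_lt.1 (by omega)
    rw [Function.comp_apply, if_pos this, zpow_add₀ hZ (⌊t⌋ + 1), zpow_natCast]

theorem hasSum_zpow_Iio (h : 1 < ‖Z‖) (t : ℝ) :
    HasSum (fun j : ℤ => if (j : ℝ) < t then Z ^ j else 0) (Z ^ ⌈t⌉ / (Z - 1)) := by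
  have hZ : Z ≠ 0 := norm_pos_iff.1 (one_pos.trans h)
  have hinj : Function.Injective fun n : ℕ => ⌈t⌉ - 1 - (n : ℤ) := fun m n hmn => by
    simpa using hmn
  refine (hinj.hasSum_iff fun j hj => if_neg fun hlt => hj ?_).1 ?_
  · have : j < ⌈t⌉ := Int.lt_ceil.2 hlt
    exact ⟨(⌈t⌉ - 1 - j).toNat, by simp only; omega⟩
  · have hZ1 : Z - 1 ≠ 0 := fun hcon => by
      rw [sub_eq_zero.1 hcon, norm_one] at h
      exact lt_irrefl _ h
    have e : Z ^ ⌈t⌉ / (Z - 1) = Z ^ (⌈t⌉ - 1) * (1 - Z⁻¹)⁻¹ := by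
      rw [zpow_sub_one₀ hZ, show 1 - Z⁻¹ = (Z - 1) / Z by field_simp, inv_div]
      field_simp
    rw [e]
    refine ((hasSum_geometric_of_norm_lt_one (ξ := Z⁻¹) ?_).mul_left
      (Z ^ (⌈t⌉ - 1))).congr_fun fun n => ?_
    · rw [norm_inv]; exact inv_lt_one_of_one_lt₀ h
    · have : ((⌈t⌉ - 1 - (n : ℤ) : ℤ) : ℝ) < t := Int.lt_ceil.1 (by omega)
      rw [Function.comp_apply, if_pos this, zpow_sub₀ hZ (⌈t⌉ - 1), zpow_natCast, inv_pow,
        div_eq_mul_inv]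

/-- Away from half-integers the sums over `j < 2x` and `j > 2x` both involve the power `⌊2x⌋ + 1`,
so both signs of `s` share one formula. -/
theorem ae_ceil_two_mul : ∀ᵐ x : ℝ, ⌈2 * x⌉ = ⌊2 * x⌋ + 1 := by
  have hc : (Set.range fun n : ℤ => (n : ℝ) / 2).Countable := Set.countable_range _
  filter_upwards [hc.ae_notMem volume] with x hx
  refine (Int.ceil_eq_floor_add_one_iff_notMem _).2 ?_
  rintro ⟨n, hn⟩
  exact hx ⟨n, by simp only; rw [hn]; ring⟩

theorem integral_modeMeasure_eq_of_hasSum {γ : ℤ × ℝ → ℂ} {S : ℝ → ℂ}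
    (hγ : Integrable γ modeMeasure) (hS : ∀ᵐ x : ℝ, HasSum (fun j : ℤ => γ (j, x)) (S x)) :
    ∫ q, γ q ∂modeMeasure = ∫ x, S x := by
  rw [modeMeasure, integral_prod_symm _ hγ]
  refine integral_congr_ae ?_
  filter_upwards [hS, hγ.prod_left_ae] with x hx hi
  rw [integral_countable hi]
  simp only [Measure.real, Measure.count_singleton, ENNReal.toReal_one, one_smul]
  exact hx.tsum_eq

/-- At fixed `j` this inverts the substitution `x = s(2ξ - j)`, and `dx = 2 dξ` up to orientation.
-/
theorem map_shear_modeMeasure {s : ℝ} (hs : s = 1 ∨ s = -1) :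
    Measure.map (fun q : ℤ × ℝ => (q.1, (q.1 + s * q.2) / 2)) modeMeasure =
      (2 : ℝ≥0∞) • modeMeasure := by
  have hm := measurable_intCast_fst
  have hs2 : s / 2 ≠ 0 := by rcases hs with rfl | rfl <;> norm_num
  have habs : ENNReal.ofReal |(s / 2)⁻¹| = 2 := by
    have : |(s / 2)⁻¹| = 2 := by rcases hs with rfl | rfl <;> norm_num
    rw [this, ENNReal.ofReal_ofNat]
  have hmp : MeasurePreserving (fun q : ℤ × ℝ => (id q.1, (fun (j : ℤ) (x : ℝ) =>
      ((j : ℝ) + s * x) / 2) q.1 q.2)) ((Measure.count : Measure ℤ).prod (volume : Measure ℝ))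
      ((Measure.count : Measure ℤ).prod ((2 : ℝ≥0∞) • (volume : Measure ℝ))) := by
    refine (MeasurePreserving.id _).skew_product (g := fun (j : ℤ) (x : ℝ) =>
      ((j : ℝ) + s * x) / 2) (by unfold Function.uncurry; fun_prop) (ae_of_all _ fun j => ?_)
    have e : (fun x : ℝ => ((j : ℝ) + s * x) / 2) =
        (fun x => (j : ℝ) / 2 + x) ∘ fun x => (s / 2) * x := by
      ext x; simp only [Function.comp_apply]; ring
    rw [e, ← Measure.map_map (by fun_prop) (by fun_prop), Real.map_volume_mul_left hs2, habs,
      Measure.map_smul, map_add_left_eq_self]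
  rw [Measure.prod_smul_right] at hmp
  exact hmp.map_eq

theorem integral_modeMeasure_shear {γ : ℤ × ℝ → ℂ} {s : ℝ} (hs : s = 1 ∨ s = -1)
    (hγ : Integrable γ modeMeasure) :
    Integrable (fun q : ℤ × ℝ => γ (q.1, (q.1 + s * q.2) / 2)) modeMeasure ∧
      ∫ q, γ q ∂modeMeasure =
        1 / 2 * ∫ q : ℤ × ℝ, γ (q.1, (q.1 + s * q.2) / 2) ∂modeMeasure := by
  have hm := measurable_intCast_fst
  have hmeas : Measurable fun q : ℤ × ℝ => (q.1, ((q.1 : ℝ) + s * q.2) / 2) := by fun_prop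
  have h2 : Integrable γ (Measure.map (fun q : ℤ × ℝ => (q.1, (q.1 + s * q.2) / 2)) modeMeasure) := by
    rw [map_shear_modeMeasure hs]
    exact hγ.smul_measure (by simp)
  refine ⟨(integrable_map_measure h2.aestronglyMeasurable hmeas.aemeasurable).1 h2, ?_⟩
  have h3 := integral_map (μ := modeMeasure) hmeas.aemeasurable h2.aestronglyMeasurable
  rw [← h3, map_shear_modeMeasure hs, integral_smul_measure]
  simp

end GeometricSums

/-! ### Summing a cone along one of its edges -/

section ConeTerms

variable {b s k : ℝ} {P Q : ℝ → ℂ} {p : ℂ × ℂ}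

/-- The quotient of consecutive terms when a cone is summed at constant `ξ`. -/
noncomputable def ratioY (b s : ℝ) (p : ℂ × ℂ) : ℂ := p.2 * Complex.exp (s * b)

/-- The quotient of consecutive terms when a cone is summed at constant `2ξ - j`. -/
noncomputable def ratioX (p : ℂ × ℂ) : ℂ :=
  p.2 * Complex.exp ((Complex.I * p.1 - Real.pi) / 2)

theorem ratioY_ne_zero (b s : ℝ) (hp : p.2 ≠ 0) : ratioY b s p ≠ 0 :=
  mul_ne_zero hp (Complex.exp_ne_zero _)

theorem ratioX_ne_zero (hp : p.2 ≠ 0) : ratioX p ≠ 0 := mul_ne_zero hp (Complex.exp_ne_zero _)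

theorem log_norm_ratioY (b s : ℝ) (hp : p.2 ≠ 0) :
    Real.log ‖ratioY b s p‖ = Real.log ‖p.2‖ + s * b := by
  rw [ratioY, norm_mul, Real.log_mul (norm_ne_zero_iff.2 hp) (by simp), Complex.norm_exp,
    Real.log_exp]
  simp

theorem log_norm_ratioX (hp : p.2 ≠ 0) :
    Real.log ‖ratioX p‖ = (2 * Real.log ‖p.2‖ - p.1.im - Real.pi) / 2 := by
  rw [ratioX, norm_mul, Real.log_mul (norm_ne_zero_iff.2 hp) (by simp), Complex.norm_exp,
    Real.log_exp]
  simp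
  ring

theorem norm_ratioX_lt_one (hp : p ∈ region b 0) : ‖ratioX p‖ < 1 := by
  rw [← Real.log_neg_iff (norm_pos_iff.2 (ratioX_ne_zero hp.1)), log_norm_ratioX hp.1]
  linarith [(abs_lt.1 hp.2.1).1]

theorem norm_ratioY_neg_one_lt_one (hp : p ∈ region b 0) : ‖ratioY b (-1) p‖ < 1 := by
  rw [← Real.log_neg_iff (norm_pos_iff.2 (ratioY_ne_zero _ _ hp.1)), log_norm_ratioY _ _ hp.1]
  linarith [(abs_lt.1 hp.2.2).2]

theorem one_lt_norm_ratioY_one (hp : p ∈ region b 0) : 1 < ‖ratioY b 1 p‖ := by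
  rw [← Real.log_pos_iff (norm_nonneg _), log_norm_ratioY _ _ hp.1]
  linarith [(abs_lt.1 hp.2.2).1]

/-- Summation of a cone at constant `ξ`. -/
theorem coneTerm_halfExp_right (hs : s = 1 ∨ s = -1) (hP : HalfLineDecay P k) (hk : Real.pi ≤ k)
    (hp : p ∈ region b 0) :
    coneTerm s P (halfExp b) p = s / (ratioY b s p - 1) *
      ∫ x : ℝ, P x * (Complex.exp ((Complex.I * p.1 - 2 * b * s) * x) *
        ratioY b s p ^ (⌊2 * x⌋ + 1)) := by
  have hi := integrable_coneTerm hP (halfLineDecay_halfExp b) hs hp hk le_rfl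
  rw [coneTerm, integral_modeMeasure_eq_of_hasSum hi (S := fun x => s / (ratioY b s p - 1) *
    (P x * (Complex.exp ((Complex.I * p.1 - 2 * b * s) * x) * ratioY b s p ^ (⌊2 * x⌋ + 1)))),
    integral_const_mul]
  filter_upwards [ae_ceil_two_mul] with x hx
  have hterm : ∀ j : ℤ, 0 < s * (2 * x - j) →
      pairMode p (j, x) * (P x * halfExp b (s * (2 * x - j))) =
      P x * Complex.exp ((Complex.I * p.1 - 2 * b * s) * x) * ratioY b s p ^ j := by
    intro j hj
    rw [halfExp_of_pos _ hj, pairMode, ratioY, mul_zpow, ← Complex.exp_int_mul]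
    have : Complex.exp (Complex.I * x * p.1) * Complex.exp (-(b * (s * (2 * x - j) : ℝ))) =
        Complex.exp ((Complex.I * p.1 - 2 * b * s) * x) * Complex.exp (j * (s * b)) := by
      rw [← Complex.exp_add, ← Complex.exp_add]
      congr 1
      push_cast
      ring
    linear_combination (p.2 ^ j * P x) * this
  have hzero : ∀ j : ℤ, ¬ 0 < s * (2 * x - j) →
      pairMode p (j, x) * (P x * halfExp b (s * (2 * x - j))) = 0 := by
    intro j hj
    rw [halfExp_of_nonpos _ (not_lt.1 hj), mul_zero, mul_zero]
  rcases hs with rfl | rfl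
  · have h := (hasSum_zpow_Iio (one_lt_norm_ratioY_one hp) (2 * x)).mul_left
      (P x * Complex.exp ((Complex.I * p.1 - 2 * b * (1 : ℝ)) * x))
    rw [hx] at h
    have e : ((1 : ℝ) : ℂ) / (ratioY b 1 p - 1) * (P x * (Complex.exp ((Complex.I * p.1 -
        2 * b * (1 : ℝ)) * x) * ratioY b 1 p ^ (⌊2 * x⌋ + 1))) =
        P x * Complex.exp ((Complex.I * p.1 - 2 * b * (1 : ℝ)) * x) *
          (ratioY b 1 p ^ (⌊2 * x⌋ + 1) / (ratioY b 1 p - 1)) := by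
      push_cast; ring
    rw [e]
    refine h.congr_fun fun j => ?_
    split_ifs with hj
    · exact hterm j (by linarith)
    · rw [mul_zero]; exact hzero j (by linarith)
  · have h := (hasSum_zpow_Ioi (ratioY_ne_zero b (-1) hp.1) (norm_ratioY_neg_one_lt_one hp)
      (2 * x)).mul_left (P x * Complex.exp ((Complex.I * p.1 - 2 * b * (-1 : ℝ)) * x))
    rw [← neg_sub (ratioY b (-1) p) 1, div_neg] at h
    have e : ((-1 : ℝ) : ℂ) / (ratioY b (-1) p - 1) * (P x * (Complex.exp ((Complex.I * p.1 -
        2 * b * (-1 : ℝ)) * x) * ratioY b (-1) p ^ (⌊2 * x⌋ + 1))) =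
        P x * Complex.exp ((Complex.I * p.1 - 2 * b * (-1 : ℝ)) * x) *
          -(ratioY b (-1) p ^ (⌊2 * x⌋ + 1) / (ratioY b (-1) p - 1)) := by
      push_cast; ring
    rw [e]
    refine h.congr_fun fun j => ?_
    split_ifs with hj
    · exact hterm j (by linarith)
    · rw [mul_zero]; exact hzero j (by linarith)

/-- Summation of a cone at constant `2ξ - j`. -/
theorem coneTerm_halfExp_left (hs : s = 1 ∨ s = -1) (hQ : HalfLineDecay Q k) (hk : b ≤ k)
    (hp : p ∈ region b 0) :
    coneTerm s (halfExp Real.pi) Q p = (1 - ratioX p)⁻¹ * (1 / 2 *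
      ∫ x : ℝ, Q x * (Complex.exp ((Complex.I * p.1 - Real.pi) * s * x / 2) *
        ratioX p ^ (⌊-(s * x)⌋ + 1))) := by
  have hi := integrable_coneTerm (halfLineDecay_halfExp Real.pi) hQ hs hp le_rfl hk
  obtain ⟨hi', he⟩ := integral_modeMeasure_shear hs hi
  rw [coneTerm, he, integral_modeMeasure_eq_of_hasSum hi' (S := fun x => (1 - ratioX p)⁻¹ *
    (Q x * (Complex.exp ((Complex.I * p.1 - Real.pi) * s * x / 2) *
      ratioX p ^ (⌊-(s * x)⌋ + 1)))), integral_const_mul]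
  · ring
  refine ae_of_all _ fun x => ?_
  have harg : ∀ j : ℤ, s * (2 * (((j : ℝ) + s * x) / 2) - j) = x := by
    intro j; rcases hs with rfl | rfl <;> ring
  have h := (hasSum_zpow_Ioi (ratioX_ne_zero hp.1) (norm_ratioX_lt_one hp) (-(s * x))).mul_left
    (Q x * Complex.exp ((Complex.I * p.1 - Real.pi) * s * x / 2))
  have e : (1 - ratioX p)⁻¹ * (Q x * (Complex.exp ((Complex.I * p.1 - Real.pi) * s * x / 2) *
      ratioX p ^ (⌊-(s * x)⌋ + 1))) = Q x * Complex.exp ((Complex.I * p.1 - Real.pi) * s * x / 2) *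
        (ratioX p ^ (⌊-(s * x)⌋ + 1) / (1 - ratioX p)) := by ring
  rw [e]
  refine h.congr_fun fun j => ?_
  simp only [harg]
  split_ifs with hj
  · rw [halfExp_of_pos _ (by linarith), pairMode, ratioX, mul_zpow, ← Complex.exp_int_mul]
    have : Complex.exp (Complex.I * (((j + s * x) / 2 : ℝ) : ℂ) * p.1) *
        Complex.exp (-((Real.pi : ℂ) * ((j + s * x) / 2 : ℝ))) =
        Complex.exp ((Complex.I * p.1 - Real.pi) * s * x / 2) *
          Complex.exp (j * ((Complex.I * p.1 - Real.pi) / 2)) := by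
      rw [← Complex.exp_add, ← Complex.exp_add]
      congr 1
      push_cast
      ring
    linear_combination (p.2 ^ j * Q x) * this
  · rw [halfExp_of_nonpos _ (by linarith), zero_mul, mul_zero, mul_zero]

/-- The exponents `⌊t⌋ + 1` and `t` differ by at most one. -/
theorem zpow_floor_norm_le {z : ℂ} (hz : z ≠ 0) (t : ℝ) :
    ‖z ^ (⌊t⌋ + 1)‖ ≤ Real.exp (|Real.log ‖z‖|) * Real.exp (Real.log ‖z‖ * t) := by
  rw [norm_zpow_eq_exp hz, ← Real.exp_add, Real.exp_le_exp]
  have h1 := Int.floor_le t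
  have h2 := (Int.lt_floor_add_one t).le
  push_cast
  have h3 : Real.log ‖z‖ * (⌊t⌋ + 1 - t) ≤ |Real.log ‖z‖| * 1 := by
    refine (le_abs_self _).trans ?_
    rw [abs_mul]
    gcongr
    rw [abs_le]
    constructor <;> linarith
  linarith

/-- The contributions `±2bx` of the exponential and of the power of the ratio cancel. The decay rate
thus depends on `2 log |μ| - Im τ` alone, and the integral continues across the zero of `ratioY -
1`. -/
theorem norm_rowIntegrand_le {C : ℝ}
    (hC : ∀ x, 0 < x → ‖P x‖ ≤ C * Real.exp (-(k * x))) (hp : p.2 ≠ 0) {x : ℝ} (hx : 0 < x) :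
    ‖P x * (Complex.exp ((Complex.I * p.1 - 2 * b * s) * x) * ratioY b s p ^ (⌊2 * x⌋ + 1))‖ ≤
      C * Real.exp |Real.log ‖p.2‖ + s * b| *
        Real.exp (-((k - (2 * Real.log ‖p.2‖ - p.1.im)) * x)) := by
  have h1 := zpow_floor_norm_le (ratioY_ne_zero b s hp) (2 * x)
  rw [log_norm_ratioY b s hp] at h1
  have e : ((Complex.I * p.1 - 2 * b * s) * x).re = -(p.1.im + 2 * b * s) * x := by
    simp
    exact Or.inl (by ring)
  rw [norm_mul, norm_mul, Complex.norm_exp, e]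
  have hC0 : 0 ≤ C := by
    have := (norm_nonneg _).trans (hC x hx)
    exact nonneg_of_mul_nonneg_left this (Real.exp_pos _)
  calc _ ≤ (C * Real.exp (-(k * x))) * (Real.exp (-(p.1.im + 2 * b * s) * x) *
        (Real.exp |Real.log ‖p.2‖ + s * b| * Real.exp ((Real.log ‖p.2‖ + s * b) * (2 * x)))) := by
        gcongr
        exact hC x hx
    _ = C * Real.exp |Real.log ‖p.2‖ + s * b| * (Real.exp (-(k * x)) *
        (Real.exp (-(p.1.im + 2 * b * s) * x) *
          Real.exp ((Real.log ‖p.2‖ + s * b) * (2 * x)))) := by ring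
    _ = _ := by
        rw [← Real.exp_add, ← Real.exp_add]
        congr 2
        ring

/-- As for the rows, but now all terms in `Im τ` and `π` cancel in the rate and only `log |μ|`
remains. -/
theorem norm_diagIntegrand_le {C : ℝ}
    (hC : ∀ x, 0 < x → ‖Q x‖ ≤ C * Real.exp (-(k * x))) (hp : p.2 ≠ 0) {x : ℝ} (hx : 0 < x) :
    ‖Q x * (Complex.exp ((Complex.I * p.1 - Real.pi) * s * x / 2) *
        ratioX p ^ (⌊-(s * x)⌋ + 1))‖ ≤
      C * Real.exp |(2 * Real.log ‖p.2‖ - p.1.im - Real.pi) / 2| *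
        Real.exp (-((k + s * Real.log ‖p.2‖) * x)) := by
  have h1 := zpow_floor_norm_le (ratioX_ne_zero hp) (-(s * x))
  rw [log_norm_ratioX hp] at h1
  have e : ((Complex.I * p.1 - Real.pi) * s * x / 2).re = -(p.1.im + Real.pi) * s * x / 2 := by
    simp
    exact Or.inl (Or.inl (by ring))
  rw [norm_mul, norm_mul, Complex.norm_exp, e]
  have hC0 : 0 ≤ C := by
    have := (norm_nonneg _).trans (hC x hx)
    exact nonneg_of_mul_nonneg_left this (Real.exp_pos _)
  calc _ ≤ (C * Real.exp (-(k * x))) * (Real.exp (-(p.1.im + Real.pi) * s * x / 2) *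
        (Real.exp |(2 * Real.log ‖p.2‖ - p.1.im - Real.pi) / 2| *
          Real.exp ((2 * Real.log ‖p.2‖ - p.1.im - Real.pi) / 2 * (-(s * x))))) := by
        gcongr
        exact hC x hx
    _ = C * Real.exp |(2 * Real.log ‖p.2‖ - p.1.im - Real.pi) / 2| * (Real.exp (-(k * x)) *
        (Real.exp (-(p.1.im + Real.pi) * s * x / 2) *
          Real.exp ((2 * Real.log ‖p.2‖ - p.1.im - Real.pi) / 2 * (-(s * x))))) := by ring
    _ = _ := by
        rw [← Real.exp_add, ← Real.exp_add]
        congr 2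
        ring

theorem measurable_zpow_floor (z : ℂ) {f : ℝ → ℝ} (hf : Measurable f) :
    Measurable fun x => z ^ (⌊f x⌋ + 1) :=
  (measurable_from_top (f := fun n : ℤ => z ^ (n + 1))).comp (Int.measurable_floor.comp hf)

/-- The leading part of a cone. -/
theorem coneTerm_halfExp_halfExp (hs : s = 1 ∨ s = -1) (hp : p ∈ region b 0) :
    coneTerm s (halfExp Real.pi) (halfExp b) p = s / (ratioY b s p - 1) *
      (ratioY b s p * (1 - ratioX p)⁻¹ * ∫ x in (0 : ℝ)..(1 / 2),
        Complex.exp ((Complex.I * p.1 - Real.pi - 2 * b * s) * x)) := by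
  rw [coneTerm_halfExp_right hs (halfLineDecay_halfExp Real.pi) le_rfl hp]
  congr 1
  set Y := ratioY b s p with hY
  have hY0 : Y ≠ 0 := ratioY_ne_zero b s hp.1
  set c : ℂ := Complex.I * p.1 - Real.pi - 2 * b * s with hc
  set f : ℝ → ℂ := fun x => Complex.exp (c * x) * Y ^ (⌊2 * x⌋ + 1) with hf
  have hX1 : 1 - ratioX p ≠ 0 := fun hcon => by
    have := norm_ratioX_lt_one hp
    rw [← sub_eq_zero.1 hcon, norm_one] at this
    exact lt_irrefl _ this
  have hfm : Measurable f := by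
    have := measurable_zpow_floor Y (f := fun x => 2 * x) (by fun_prop)
    fun_prop
  have e1 : ∀ x, halfExp Real.pi x * (Complex.exp ((Complex.I * p.1 - 2 * b * s) * x) *
      Y ^ (⌊2 * x⌋ + 1)) = (Set.Ioi (0 : ℝ)).indicator f x := by
    intro x
    rcases le_or_gt x 0 with hx | hx
    · rw [halfExp_of_nonpos _ hx, zero_mul, Set.indicator_of_notMem (by simpa using hx)]
    · rw [halfExp_of_pos _ hx, Set.indicator_of_mem (by simpa using hx), ← mul_assoc,
        ← Complex.exp_add]
      simp only [hf, hc]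
      congr 2
      ring
  simp only [e1]
  rw [integral_indicator measurableSet_Ioi]
  have hκ : 0 < Real.pi - (2 * Real.log ‖p.2‖ - p.1.im) := by linarith [(abs_lt.1 hp.2.1).1]
  have hfi : IntegrableOn f (Set.Ioi 0) := by
    rw [← integrable_indicator_iff measurableSet_Ioi]
    refine ((integrable_exp_neg_mul_abs hκ).const_mul
      (1 * Real.exp |Real.log ‖p.2‖ + s * b|)).mono'
      (hfm.indicator measurableSet_Ioi).aestronglyMeasurable (ae_of_all _ fun x => ?_)
    rw [← e1]
    rcases le_or_gt x 0 with hx | hx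
    · rw [halfExp_of_nonpos _ hx, zero_mul, norm_zero]; positivity
    · rw [abs_of_pos hx]
      refine norm_rowIntegrand_le (P := halfExp Real.pi) (k := Real.pi) (fun x hx => ?_) hp.1 hx
      rw [halfExp_of_pos _ hx, Complex.norm_exp]
      simp
  -- The integrand is self-similar under translation by `1/2`, so the half-line integral is that
  -- over `(0, 1/2)` divided by `1 - ratioX p`.
  have hshift : ∀ x : ℝ, f (x + 1 / 2) = ratioX p * f x := by
    intro x
    have h1 : ⌊2 * (x + 1 / 2)⌋ = ⌊2 * x⌋ + 1 := by
      rw [← Int.floor_add_one]; congr 1; ring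
    have h2 : Complex.exp (c * ((x + 1 / 2 : ℝ) : ℂ)) * Y =
        ratioX p * Complex.exp (c * x) := by
      have : Complex.exp (c * ((x + 1 / 2 : ℝ) : ℂ)) * Complex.exp (s * b) =
          Complex.exp ((Complex.I * p.1 - Real.pi) / 2) * Complex.exp (c * x) := by
        rw [← Complex.exp_add, ← Complex.exp_add]
        congr 1
        rw [hc]
        push_cast
        ring
      rw [hY, ratioY, ratioX]
      linear_combination p.2 * this
    simp only [hf]
    rw [h1, zpow_add_one₀ hY0 (⌊2 * x⌋ + 1)]
    linear_combination (Y ^ (⌊2 * x⌋ + 1)) * h2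
  have hsplit : ∫ x in Set.Ioi (0 : ℝ), f x =
      (∫ x in (0 : ℝ)..(1 / 2), f x) + ∫ x in Set.Ioi (1 / 2 : ℝ), f x := by
    rw [intervalIntegral.integral_of_le (by norm_num), ← setIntegral_union
      (Set.Ioc_disjoint_Ioi le_rfl) measurableSet_Ioi
      (hfi.mono_set Set.Ioc_subset_Ioi_self) (hfi.mono_set (Set.Ioi_subset_Ioi (by norm_num))),
      Set.Ioc_union_Ioi_eq_Ioi (by norm_num)]
  have htail : ∫ x in Set.Ioi (1 / 2 : ℝ), f x = ratioX p * ∫ x in Set.Ioi (0 : ℝ), f x := by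
    have h1 := (measurePreserving_add_right (volume : Measure ℝ) (1 / 2)).setIntegral_preimage_emb
      (measurableEmbedding_addRight (1 / 2)) f (Set.Ioi (1 / 2))
    rw [Set.preimage_add_const_Ioi, sub_self] at h1
    rw [← h1, ← integral_const_mul]
    simp only [hshift]
  have hhead : ∫ x in (0 : ℝ)..(1 / 2), f x = Y * ∫ x in (0 : ℝ)..(1 / 2), Complex.exp (c * x) := by
    rw [← intervalIntegral.integral_const_mul, intervalIntegral.integral_of_le (by norm_num),
      intervalIntegral.integral_of_le (by norm_num), integral_Ioc_eq_integral_Ioo,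
      integral_Ioc_eq_integral_Ioo]
    refine setIntegral_congr_fun measurableSet_Ioo fun x hx => ?_
    have : ⌊2 * x⌋ = 0 := Int.floor_eq_zero_iff.2 ⟨by linarith [hx.1], by linarith [hx.2]⟩
    simp only [hf, this, zero_add, zpow_one]
    ring
  rw [htail, hhead] at hsplit
  field_simp
  linear_combination hsplit

end ConeTerms

end Worm

namespace Worm

/-! ### Bounded holomorphic coefficients -/

section Good

/-- Bounded holomorphic functions of `(τ, μ)` on a fixed enlargement of the region. -/
def IsGood (b : ℝ) (f : ℂ × ℂ → ℂ) : Prop :=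
  DifferentiableOn ℂ f (region b (Real.pi / 4)) ∧ ∃ C, ∀ p ∈ region b (Real.pi / 4), ‖f p‖ ≤ C

variable {b s k : ℝ} {f g : ℂ × ℂ → ℂ} {P Q : ℝ → ℂ}

theorem isGood_const (b : ℝ) (c : ℂ) : IsGood b fun _ => c :=
  ⟨differentiableOn_const _, ‖c‖, fun _ _ => le_rfl⟩

theorem IsGood.add (hf : IsGood b f) (hg : IsGood b g) : IsGood b fun p => f p + g p := by
  obtain ⟨hf, C, hC⟩ := hf
  obtain ⟨hg, C', hC'⟩ := hg
  exact ⟨hf.add hg, C + C', fun p hp => (norm_add_le _ _).trans (add_le_add (hC p hp) (hC' p hp))⟩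

theorem IsGood.mul (hf : IsGood b f) (hg : IsGood b g) : IsGood b fun p => f p * g p := by
  obtain ⟨hf, C, hC⟩ := hf
  obtain ⟨hg, C', hC'⟩ := hg
  refine ⟨hf.mul hg, C * C', fun p hp => ?_⟩
  rw [norm_mul]
  exact mul_le_mul (hC p hp) (hC' p hp) (norm_nonneg _) ((norm_nonneg _).trans (hC p hp))

theorem IsGood.neg (hf : IsGood b f) : IsGood b fun p => -f p := by
  obtain ⟨hf, C, hC⟩ := hf
  exact ⟨hf.neg, C, fun p hp => by rw [norm_neg]; exact hC p hp⟩

theorem IsGood.sub (hf : IsGood b f) (hg : IsGood b g) : IsGood b fun p => f p - g p := by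
  simpa only [sub_eq_add_neg] using hf.add hg.neg

theorem IsGood.comp_flip (hf : IsGood b f) : IsGood b fun p => f (flip p) := by
  obtain ⟨hf, C, hC⟩ := hf
  exact ⟨hf.comp (differentiableOn_flip b _) fun p hp => flip_mem_region hp, C,
    fun p hp => hC _ (flip_mem_region hp)⟩

theorem abs_im_lt_of_mem_region {δ : ℝ} {p : ℂ × ℂ} (hp : p ∈ region b δ) :
    |p.1.im| < Real.pi + 2 * b + 4 * δ := by
  have h1 := abs_add_le (p.1.im - 2 * Real.log ‖p.2‖) (2 * Real.log ‖p.2‖)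
  rw [sub_add_cancel, abs_mul, abs_two] at h1
  linarith [hp.2.1, hp.2.2]

theorem isGood_snd (b : ℝ) : IsGood b fun p => p.2 := by
  refine ⟨differentiable_snd.differentiableOn, Real.exp (b + Real.pi / 4), fun p hp => ?_⟩
  rw [← Real.log_le_iff_le_exp (norm_pos_iff.2 hp.1)]
  exact (le_abs_self _).trans hp.2.2.le

theorem isGood_exp (b r : ℝ) : IsGood b fun p => Complex.exp (Complex.I * p.1 * r) := by
  refine ⟨by fun_prop, Real.exp ((Real.pi + 2 * b + 4 * (Real.pi / 4)) * |r|), fun p hp => ?_⟩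
  have e : (Complex.I * p.1 * r).re = -(p.1.im * r) := by simp
  rw [Complex.norm_exp, e, Real.exp_le_exp]
  have h1 := neg_abs_le (p.1.im * r)
  rw [abs_mul] at h1
  nlinarith [(abs_im_lt_of_mem_region hp).le, abs_nonneg r]

/-- Kept as an integral, the expression needs no division by `iτ - c`, which may vanish on the
region. -/
theorem isGood_integral_exp (b : ℝ) (c : ℝ) : IsGood b fun p =>
    ∫ x in (0 : ℝ)..(1 / 2), Complex.exp ((Complex.I * p.1 - c) * x) := by
  have hb : ∀ p ∈ region b (Real.pi / 4), ∀ x ∈ Set.Ioc (0 : ℝ) (1 / 2),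
      ‖Complex.exp ((Complex.I * p.1 - c) * x)‖ ≤
        Real.exp (Real.pi + 2 * b + 4 * (Real.pi / 4) + |c|) := by
    intro p hp x hx
    have e : ((Complex.I * p.1 - c) * x).re = -(p.1.im + c) * x := by
      simp
      exact Or.inl (by ring)
    rw [Complex.norm_exp, e, Real.exp_le_exp]
    have h1 := abs_im_lt_of_mem_region hp
    have h2 : |p.1.im + c| ≤ Real.pi + 2 * b + 4 * (Real.pi / 4) + |c| :=
      (abs_add_le _ _).trans (by linarith)
    have h3 := neg_abs_le (p.1.im + c)
    have h4 := abs_nonneg (p.1.im + c)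
    nlinarith [hx.1, hx.2]
  refine ⟨?_, Real.exp (Real.pi + 2 * b + 4 * (Real.pi / 4) + |c|) * |1 / 2 - 0|, fun p hp => ?_⟩
  · have key := differentiableOn_integral_of_dominated
      (μ := (volume : Measure ℝ))
      (f := fun (p : ℂ × ℂ) (x : ℝ) => (Set.Ioc (0 : ℝ) (1 / 2)).indicator
        (fun x => Complex.exp ((Complex.I * p.1 - c) * x)) x) (isOpen_region b (Real.pi / 4))
      (g := (Set.Ioc (0 : ℝ) (1 / 2)).indicator
        (fun _ => Real.exp (Real.pi + 2 * b + 4 * (Real.pi / 4) + |c|)))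
      ((integrable_indicator_iff measurableSet_Ioc).2 (integrableOn_const (by simp)))
      (fun p _ => ((Continuous.measurable (by fun_prop)).indicator
        measurableSet_Ioc).aestronglyMeasurable) ?_ ?_
    · refine key.congr fun p _ => ?_
      rw [integral_indicator measurableSet_Ioc, intervalIntegral.integral_of_le (by norm_num)]
    · intro x
      by_cases hx : x ∈ Set.Ioc (0 : ℝ) (1 / 2)
      · simp only [Set.indicator_of_mem hx]
        fun_prop
      · simp only [Set.indicator_of_notMem hx]
        fun_prop
    · intro p hp x
      by_cases hx : x ∈ Set.Ioc (0 : ℝ) (1 / 2)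
      · simp only [Set.indicator_of_mem hx]
        exact hb p hp x hx
      · simp only [Set.indicator_of_notMem hx]
        simp
  · exact intervalIntegral.norm_integral_le_of_norm_le_const fun x hx =>
      hb p hp x (by rwa [Set.uIoc_of_le (by norm_num)] at hx)

theorem isGood_integral_of_dominated {X : Type*} [MeasurableSpace X] {μ : Measure X}
    {F : ℂ × ℂ → X → ℂ} {G : X → ℝ} (hG : Integrable G μ) (hm : ∀ p, AEStronglyMeasurable (F p) μ)
    (hd : ∀ x, DifferentiableOn ℂ (fun p => F p x) (region b (Real.pi / 4)))
    (hb : ∀ p ∈ region b (Real.pi / 4), ∀ x, ‖F p x‖ ≤ G x) :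
    IsGood b fun p => ∫ x, F p x ∂μ :=
  ⟨differentiableOn_integral_of_dominated (isOpen_region _ _) hG (fun p _ => hm p) hd hb,
    ∫ x, G x ∂μ, fun p hp => norm_integral_le_of_norm_le hG (ae_of_all _ (hb p hp))⟩

theorem differentiableOn_zpow_of_ne_zero {E : Type*} [NormedAddCommGroup E] [NormedSpace ℂ E]
    {S : Set E} {f : E → ℂ} (hf : DifferentiableOn ℂ f S) (h0 : ∀ p ∈ S, f p ≠ 0) (n : ℤ) :
    DifferentiableOn ℂ (fun p => f p ^ n) S := fun p hp =>
  (differentiableAt_zpow.2 (Or.inl (h0 p hp))).comp_differentiableWithinAt p (hf p hp)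

/-- On the enlarged region the rate `3π` loses less than `π + π/2`, which leaves `3π/2`. -/
theorem isGood_rowIntegral (hs : s = 1 ∨ s = -1) (hP : HalfLineDecay P (3 * Real.pi)) :
    IsGood b fun p => ∫ x : ℝ, P x * (Complex.exp ((Complex.I * p.1 - 2 * b * s) * x) *
      ratioY b s p ^ (⌊2 * x⌋ + 1)) := by
  have hpi := Real.pi_pos
  obtain ⟨C, hC0, hC⟩ := hP.exists_bound
  have hc : 0 < 3 * Real.pi / 2 := by positivity
  refine isGood_integral_of_dominated ((integrable_exp_neg_mul_abs hc).const_mul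
    (C * Real.exp (|b| + Real.pi / 4 + |b| + |b|))) (fun p => ?_) (fun x => ?_)
    (fun p hp x => ?_)
  · have h1 := measurable_zpow_floor (ratioY b s p) (f := fun x => 2 * x) (by fun_prop)
    exact (hP.1.mul (Measurable.mul (by fun_prop) h1)).aestronglyMeasurable
  · refine (DifferentiableOn.mul (by fun_prop) (differentiableOn_zpow_of_ne_zero ?_
      (fun p hp => ratioY_ne_zero b s hp.1) _)).const_mul _
    unfold ratioY
    fun_prop
  · rcases le_or_gt x 0 with hx | hx
    · rw [hP.2.1 x hx, zero_mul, norm_zero]; positivity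
    · refine (norm_rowIntegrand_le (fun x _ => hC x) hp.1 hx).trans ?_
      rw [abs_of_pos hx]
      have h1 := (abs_lt.1 hp.2.1).1
      have h2 : |Real.log ‖p.2‖ + s * b| ≤ |b| + Real.pi / 4 + |b| + |b| := by
        have e : |s * b| = |b| := by rw [abs_mul]; rcases hs with rfl | rfl <;> simp
        have := abs_add_le (Real.log ‖p.2‖) (s * b)
        rw [e] at this
        linarith [hp.2.2, le_abs_self b, abs_nonneg b]
      gcongr
      linarith

/-- On the enlarged region the rate `3b` loses less than `b + π/4`; since `b > π/2`, at least `b` is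
left. -/
theorem isGood_diagIntegral (hs : s = 1 ∨ s = -1) (hb : Real.pi / 2 < b)
    (hQ : HalfLineDecay Q (3 * b)) :
    IsGood b fun p => ∫ x : ℝ, Q x * (Complex.exp ((Complex.I * p.1 - Real.pi) * s * x / 2) *
        ratioX p ^ (⌊-(s * x)⌋ + 1)) := by
  have hpi := Real.pi_pos
  obtain ⟨C, hC0, hC⟩ := hQ.exists_bound
  have hb0 : 0 < b := by linarith
  refine isGood_integral_of_dominated ((integrable_exp_neg_mul_abs hb0).const_mul
    (C * Real.exp (2 * Real.pi))) (fun p => ?_) (fun x => ?_) (fun p hp x => ?_)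
  · have h1 := measurable_zpow_floor (ratioX p) (f := fun x => -(s * x)) (by fun_prop)
    exact (hQ.1.mul (Measurable.mul (by fun_prop) h1)).aestronglyMeasurable
  · refine (DifferentiableOn.mul (by fun_prop) (differentiableOn_zpow_of_ne_zero ?_
      (fun p hp => ratioX_ne_zero hp.1) _)).const_mul _
    unfold ratioX
    fun_prop
  · rcases le_or_gt x 0 with hx | hx
    · rw [hQ.2.1 x hx, zero_mul, norm_zero]; positivity
    · refine (norm_diagIntegrand_le (fun x _ => hC x) hp.1 hx).trans ?_
      rw [abs_of_pos hx]
      have h1 := abs_lt.1 hp.2.1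
      have h3 := abs_lt.1 hp.2.2
      have h2 : |(2 * Real.log ‖p.2‖ - p.1.im - Real.pi) / 2| ≤ 2 * Real.pi := by
        rw [abs_le]
        constructor <;> linarith
      have h4 : b ≤ 3 * b + s * Real.log ‖p.2‖ := by
        rcases hs with rfl | rfl <;> linarith
      gcongr

theorem isGood_coneTerm (hs : s = 1 ∨ s = -1) (hb : Real.pi / 2 < b)
    (hP : HalfLineDecay P (3 * Real.pi)) (hQ : HalfLineDecay Q (3 * b)) :
    IsGood b (coneTerm s P Q) := by
  have hpi := Real.pi_pos
  have hb0 : 0 < b := by linarith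
  obtain ⟨C, hC0, hC⟩ := hP.exists_cone_bound hQ hs (3 * Real.pi / 2) b
  refine isGood_integral_of_dominated ((integrable_exp_neg_cone
    (by positivity : 0 < 3 * Real.pi / 2) hb0).const_mul C)
    (fun p => (measurable_coneTerm hP.1 hQ.1).aestronglyMeasurable)
    (fun q => (differentiableOn_pairMode b _ q).mul_const _) (fun p hp q => hC p hp.1 ?_ ?_ q)
  · linarith [(abs_lt.1 hp.2.1).1]
  · have h3 := abs_lt.1 hp.2.2
    rcases hs with rfl | rfl <;> linarith

end Good

end Worm

namespace Worm

/-! ### The singular factors of the shifted integral -/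

section Form

/-- `e^{(π - iτ)/2} - μ`. -/
noncomputable def pairP (p : ℂ × ℂ) : ℂ :=
  Complex.exp (((Real.pi : ℂ) - Complex.I * p.1) / 2) - p.2

/-- `e^{-(iτ + π)/2} - μ`. -/
noncomputable def pairQ (p : ℂ × ℂ) : ℂ :=
  Complex.exp (-((Complex.I * p.1 + (Real.pi : ℂ)) / 2)) - p.2

/-- `e^a - μ`. -/
noncomputable def pairExp (a : ℝ) (p : ℂ × ℂ) : ℂ := (Real.exp a : ℂ) - p.2

/-- `iτ + r`. -/
noncomputable def pairLin (r : ℝ) (p : ℂ × ℂ) : ℂ := Complex.I * p.1 + (r : ℂ)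

/-- The singular factors of the kernel. -/
noncomputable def singularFactor (b : ℝ) (i : Fin 9) (p : ℂ × ℂ) : ℂ :=
  ![(pairLin (2 * b + Real.pi) p * pairExp b p)⁻¹,
    (pairQ p * pairLin (2 * b + Real.pi) p)⁻¹,
    (pairP p * pairExp b p)⁻¹,
    (pairP p * pairLin (-(2 * b + Real.pi)) p)⁻¹,
    (pairLin (-(2 * b + Real.pi)) p * pairExp (-b) p)⁻¹,
    (pairQ p * pairExp (-b) p)⁻¹,
    (pairP p)⁻¹, (pairQ p)⁻¹, 1] i

/-- Combinations of the singular factors with good coefficients. -/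
def HasForm (b : ℝ) (F : ℂ × ℂ → ℂ) : Prop :=
  ∃ g : Fin 9 → ℂ × ℂ → ℂ, (∀ i, IsGood b (g i)) ∧
    ∀ p ∈ region b 0, F p = ∑ i, g i p * singularFactor b i p

variable {b s : ℝ} {F G f : ℂ × ℂ → ℂ} {P Q : ℝ → ℂ} {p : ℂ × ℂ}

theorem HasForm.congr (hF : HasForm b F) (h : ∀ p ∈ region b 0, G p = F p) : HasForm b G := by
  obtain ⟨g, hg, he⟩ := hF
  exact ⟨g, hg, fun p hp => (h p hp).trans (he p hp)⟩

theorem HasForm.add (hF : HasForm b F) (hG : HasForm b G) : HasForm b fun p => F p + G p := by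
  obtain ⟨g, hg, he⟩ := hF
  obtain ⟨g', hg', he'⟩ := hG
  refine ⟨fun i p => g i p + g' i p, fun i => (hg i).add (hg' i), fun p hp => ?_⟩
  simp only [he p hp, he' p hp, add_mul, Finset.sum_add_distrib]

theorem IsGood.hasForm_mul (hf : IsGood b f) (i : Fin 9) :
    HasForm b fun p => f p * singularFactor b i p := by
  refine ⟨fun j => if j = i then f else fun _ => 0, fun j => ?_, fun p _ => ?_⟩
  · by_cases hj : j = i
    · simpa only [hj, if_true] using hf
    · simpa only [hj, if_false] using isGood_const b 0
  · rw [Finset.sum_eq_single i]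
    · simp
    · intro j _ hj
      simp [hj]
    · simp

theorem hasForm_sum {ι : Type*} (S : Finset ι) {F : ι → ℂ × ℂ → ℂ} (h : ∀ i, HasForm b (F i)) :
    HasForm b fun p => ∑ i ∈ S, F i p := by
  classical
  induction S using Finset.induction_on with
  | empty => simpa using (isGood_const b 0).hasForm_mul 0
  | insert a S ha ih =>
    simp only [Finset.sum_insert ha]
    exact (h a).add ih

theorem HasForm.const_mul (hF : HasForm b F) (c : ℂ) : HasForm b fun p => c * F p := by
  obtain ⟨g, hg, he⟩ := hF
  refine ⟨fun i p => c * g i p, fun i => (isGood_const b c).mul (hg i), fun p hp => ?_⟩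
  simp only [he p hp, Finset.mul_sum, mul_assoc]

theorem isGood_exp_half (b r₁ r₂ : ℝ) :
    IsGood b fun p => Complex.exp ((r₁ + Complex.I * p.1 * r₂) / 2) := by
  have h := (isGood_const b (Complex.exp (r₁ / 2))).mul (isGood_exp b (r₂ / 2))
  have e : (fun p : ℂ × ℂ => Complex.exp ((r₁ + Complex.I * p.1 * r₂) / 2)) =
      fun p => Complex.exp (r₁ / 2) * Complex.exp (Complex.I * p.1 * (r₂ / 2 : ℝ)) := by
    ext p
    rw [← Complex.exp_add]
    congr 1
    push_cast
    ring
  rwa [e]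

theorem isGood_pairP (b : ℝ) : IsGood b pairP := by
  have h := (isGood_exp_half b Real.pi (-1)).sub (isGood_snd b)
  have e : pairP = fun p => Complex.exp ((Real.pi + Complex.I * p.1 * (-1 : ℝ)) / 2) - p.2 := by
    ext p
    rw [pairP]
    congr 3
    push_cast
    ring
  rwa [e]

theorem isGood_pairQ (b : ℝ) : IsGood b pairQ := by
  have h := (isGood_exp_half b (-Real.pi) (-1)).sub (isGood_snd b)
  have e : pairQ = fun p =>
      Complex.exp (((-Real.pi : ℝ) + Complex.I * p.1 * (-1 : ℝ)) / 2) - p.2 := by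
    ext p
    rw [pairQ]
    congr 2
    push_cast
    ring
  rwa [e]

theorem pairLin_flip (r : ℝ) (p : ℂ × ℂ) : pairLin r (flip p) = -pairLin (-r) p := by
  simp only [pairLin, flip]; push_cast; ring

theorem pairExp_flip (a : ℝ) (hp : p.2 ≠ 0) :
    pairExp a (flip p) = -(Complex.exp a * p.2⁻¹) * pairExp (-a) p := by
  have h : Complex.exp a * Complex.exp (-a) = 1 := by rw [← Complex.exp_add]; simp
  simp only [pairExp, flip]
  push_cast
  field_simp
  linear_combination h

theorem pairP_flip (hp : p.2 ≠ 0) :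
    pairP (flip p) = -(Complex.exp ((Real.pi + Complex.I * p.1) / 2) * p.2⁻¹) * pairQ p := by
  have h : Complex.exp ((Real.pi + Complex.I * p.1) / 2) *
      Complex.exp (-((Complex.I * p.1 + (Real.pi : ℂ)) / 2)) = 1 := by
    rw [← Complex.exp_add, ← Complex.exp_zero]
    congr 1
    ring
  have e : ((Real.pi : ℂ) - Complex.I * -p.1) / 2 = (Real.pi + Complex.I * p.1) / 2 := by ring
  simp only [pairP, pairQ, flip, e]
  field_simp
  linear_combination h

theorem pairQ_flip (hp : p.2 ≠ 0) :
    pairQ (flip p) = -(Complex.exp (-((Real.pi - Complex.I * p.1) / 2)) * p.2⁻¹) * pairP p := by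
  have h : Complex.exp (-((Real.pi - Complex.I * p.1) / 2)) *
      Complex.exp (((Real.pi : ℂ) - Complex.I * p.1) / 2) = 1 := by
    rw [← Complex.exp_add, neg_add_cancel, Complex.exp_zero]
  have e : -((Complex.I * -p.1 + (Real.pi : ℂ)) / 2) = -((Real.pi - Complex.I * p.1) / 2) := by
    ring
  simp only [pairP, pairQ, flip, e]
  field_simp
  linear_combination h

theorem inv_pairExp_flip (a : ℝ) (hp : p.2 ≠ 0) :
    (pairExp a (flip p))⁻¹ = -(Complex.exp (-a) * p.2) * (pairExp (-a) p)⁻¹ := by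
  rw [pairExp_flip a hp, mul_inv, inv_neg, mul_inv, inv_inv, Complex.exp_neg]

theorem inv_pairP_flip (hp : p.2 ≠ 0) : (pairP (flip p))⁻¹ =
    -(Complex.exp (((-Real.pi : ℝ) + Complex.I * p.1 * (-1 : ℝ)) / 2) * p.2) * (pairQ p)⁻¹ := by
  rw [pairP_flip hp, mul_inv, inv_neg, mul_inv, inv_inv, ← Complex.exp_neg]
  congr 5
  push_cast
  ring

theorem inv_pairQ_flip (hp : p.2 ≠ 0) : (pairQ (flip p))⁻¹ =
    -(Complex.exp (((Real.pi : ℝ) + Complex.I * p.1 * (-1 : ℝ)) / 2) * p.2) * (pairP p)⁻¹ := by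
  rw [pairQ_flip hp, mul_inv, inv_neg, mul_inv, inv_inv, ← Complex.exp_neg]
  congr 5
  push_cast
  ring

/-- The involution exchanges `pairP` with `pairQ` and reverses the parameters of `pairExp` and
`pairLin`, up to good factors. It therefore permutes the list. -/
theorem singularFactor_flip (b : ℝ) (i : Fin 9) : ∃ u, IsGood b u ∧ ∃ i', ∀ p ∈ region b 0,
    singularFactor b i (flip p) = u p * singularFactor b i' p := by
  have hμ := isGood_snd b
  have hE := fun a : ℝ => ((isGood_const b (Complex.exp (-a))).mul hμ).neg
  have hQ := ((isGood_exp_half b (-Real.pi) (-1)).mul hμ).neg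
  have hP := ((isGood_exp_half b Real.pi (-1)).mul hμ).neg
  fin_cases i
  on_goal 1 => refine ⟨_, (hE b).neg, 4, fun p hp => ?_⟩
  on_goal 2 => refine ⟨_, hP.neg, 3, fun p hp => ?_⟩
  on_goal 3 => refine ⟨_, hQ.mul (hE b), 5, fun p hp => ?_⟩
  on_goal 4 => refine ⟨_, hQ.neg, 1, fun p hp => ?_⟩
  on_goal 5 => refine ⟨_, (hE (-b)).neg, 0, fun p hp => ?_⟩
  on_goal 6 => refine ⟨_, hP.mul (hE (-b)), 2, fun p hp => ?_⟩
  on_goal 7 => refine ⟨_, hQ, 7, fun p hp => ?_⟩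
  on_goal 8 => refine ⟨_, hP, 6, fun p hp => ?_⟩
  on_goal 9 => refine ⟨_, isGood_const b 1, 8, fun p hp => ?_⟩
  all_goals
    simp only [singularFactor, Matrix.cons_val, Fin.reduceFinMk, Fin.zero_eta, Fin.mk_one, mul_inv,
      pairLin_flip, inv_pairExp_flip _ hp.1, inv_pairP_flip hp.1, inv_pairQ_flip hp.1, inv_neg,
      neg_neg, one_mul]
  all_goals ring

theorem HasForm.comp_flip (hF : HasForm b F) : HasForm b fun p => F (flip p) := by
  obtain ⟨g, hg, he⟩ := hF
  refine (hasForm_sum Finset.univ (F := fun i p => g i (flip p) * singularFactor b i (flip p))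
    fun i => ?_).congr fun p hp => he _ (flip_mem_region hp)
  obtain ⟨u, hu, i', h⟩ := singularFactor_flip b i
  refine (((hg i).comp_flip.mul hu).hasForm_mul i').congr fun p hp => ?_
  rw [h p hp, mul_assoc]

theorem one_sub_ratioX (p : ℂ × ℂ) :
    1 - ratioX p = Complex.exp ((Complex.I * p.1 - Real.pi) / 2) * pairP p := by
  have h : Complex.exp ((Complex.I * p.1 - Real.pi) / 2) *
      Complex.exp (((Real.pi : ℂ) - Complex.I * p.1) / 2) = 1 := by
    rw [← Complex.exp_add, ← Complex.exp_zero]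
    congr 1
    ring
  rw [ratioX, pairP]
  linear_combination -h

theorem inv_one_sub_ratioX (p : ℂ × ℂ) : (1 - ratioX p)⁻¹ =
    Complex.exp (((Real.pi : ℝ) + Complex.I * p.1 * (-1 : ℝ)) / 2) * (pairP p)⁻¹ := by
  rw [one_sub_ratioX, mul_inv, ← Complex.exp_neg]
  congr 2
  push_cast
  ring

theorem inv_ratioY_sub_one (b s : ℝ) (p : ℂ × ℂ) :
    (ratioY b s p - 1)⁻¹ = -Complex.exp (-(s * b)) * (pairExp (-(s * b)) p)⁻¹ := by
  have h : Complex.exp (s * b) * Complex.exp (-(s * b)) = 1 := by rw [← Complex.exp_add]; simp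
  have e : ratioY b s p - 1 = -Complex.exp (s * b) * pairExp (-(s * b)) p := by
    rw [ratioY, pairExp]
    push_cast
    linear_combination h
  rw [e, mul_inv, inv_neg, Complex.exp_neg]

theorem one_sub_ratioX_ne_zero (hp : p ∈ region b 0) : 1 - ratioX p ≠ 0 := fun hcon => by
  have := norm_ratioX_lt_one hp
  rw [← sub_eq_zero.1 hcon, norm_one] at this
  exact lt_irrefl _ this

theorem pairP_ne_zero (hp : p ∈ region b 0) : pairP p ≠ 0 := by
  have h := one_sub_ratioX_ne_zero hp
  rw [one_sub_ratioX] at h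
  exact right_ne_zero_of_mul h

theorem pairQ_ne_zero (hp : p ∈ region b 0) : pairQ p ≠ 0 := by
  have h := pairP_ne_zero (flip_mem_region hp)
  rw [pairP_flip hp.1] at h
  exact right_ne_zero_of_mul h

/-- Summation at constant `2ξ - j` isolates the single factor `(pairP p)⁻¹`. -/
theorem hasForm_coneTerm_left (hs : s = 1 ∨ s = -1) (hb : Real.pi / 2 < b)
    (hQ : HalfLineDecay Q (3 * b)) : HasForm b (coneTerm s (halfExp Real.pi) Q) := by
  have hpi := Real.pi_pos
  refine ((((isGood_exp_half b Real.pi (-1)).mul (isGood_const b (1 / 2))).mul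
    (isGood_diagIntegral hs hb hQ)).hasForm_mul 6).congr fun p hp => ?_
  rw [coneTerm_halfExp_left hs hQ (by linarith) hp, inv_one_sub_ratioX]
  simp only [singularFactor, Matrix.cons_val]
  ring

theorem hasForm_coneTerm_right (hs : s = 1 ∨ s = -1) (hP : HalfLineDecay P (3 * Real.pi)) :
    HasForm b (coneTerm s P (halfExp b)) := by
  have hpi := Real.pi_pos
  have hΦ := isGood_rowIntegral (b := b) hs hP
  have hc := isGood_const b (-s * Complex.exp (-(s * b)))
  have he : ∀ p ∈ region b 0, coneTerm s P (halfExp b) p = _ := fun p hp => by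
    rw [coneTerm_halfExp_right hs hP (by linarith) hp, div_eq_mul_inv, inv_ratioY_sub_one]
  rcases hs with rfl | rfl
  -- The sum has only the pole of `pairExp (-b)`, which does not occur alone in the list; the
  -- numerator is multiplied by the good function `pairQ` to fit. In the other case `pairP` plays
  -- this role.
  · refine (((hc.mul hΦ).mul (isGood_pairQ b)).hasForm_mul 5).congr fun p hp => ?_
    have hQ0 := pairQ_ne_zero hp
    rw [he p hp]
    simp only [singularFactor, Matrix.cons_val, mul_inv, one_mul]
    rw [mul_assoc _ (pairQ p), mul_inv_cancel_left₀ hQ0]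
    ring
  · refine (((hc.mul hΦ).mul (isGood_pairP b)).hasForm_mul 2).congr fun p hp => ?_
    have hP0 := pairP_ne_zero hp
    rw [he p hp]
    simp only [singularFactor, Matrix.cons_val, mul_inv, neg_one_mul, neg_neg]
    rw [mul_assoc _ (pairP p), mul_inv_cancel_left₀ hP0]
    ring

/-- For `s = 1` put `X = ratioX p`, `Y = ratioY b 1 p` and `c = iτ - π - 2b`. Then `X = Y e^{c/2}`,
and since `c ≠ 0` on the region the integral over `(0, 1/2)` is `(e^{c/2} - 1)/c`. Partial fractions
give `-c⁻¹((Y - 1)⁻¹ + (1 - X)⁻¹)`, that is, the two factors with `pairLin`. For `s = -1` the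
product of `pairP` and `pairExp b` already occurs in the list, and the integral stays as a good
coefficient. -/
theorem hasForm_coneTerm_leading (hs : s = 1 ∨ s = -1) :
    HasForm b (coneTerm s (halfExp Real.pi) (halfExp b)) := by
  have hpi := Real.pi_pos
  rcases hs with rfl | rfl
  · have h5 := (isGood_const b (Complex.exp (-b))).hasForm_mul 4
    have h4 := (isGood_exp_half b Real.pi (-1)).neg.hasForm_mul 3
    refine (h5.add h4).congr fun p hp => ?_
    rw [coneTerm_halfExp_halfExp (Or.inl rfl) hp]
    set c : ℂ := Complex.I * p.1 - Real.pi - 2 * b * (1 : ℝ) with hc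
    have hc0 : c ≠ 0 := by
      intro hcon
      have h1 : c.re = -p.1.im - Real.pi - 2 * b := by simp [hc]
      rw [hcon, Complex.zero_re] at h1
      linarith [(abs_lt.1 hp.2.1).1, (abs_lt.1 hp.2.1).2, (abs_lt.1 hp.2.2).1]
    have hlin : pairLin (-(2 * b + Real.pi)) p = c := by
      rw [pairLin, hc]; push_cast; ring
    have hY : ratioY b 1 p - 1 ≠ 0 := fun hcon => by
      have := one_lt_norm_ratioY_one hp
      rw [sub_eq_zero.1 hcon, norm_one] at this
      exact lt_irrefl _ this
    have hX := one_sub_ratioX_ne_zero hp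
    have hXY : ratioX p = ratioY b 1 p * Complex.exp (c * (1 / 2)) := by
      rw [ratioX, ratioY, mul_assoc, ← Complex.exp_add, hc]
      congr 2
      push_cast
      ring
    have e1 : Complex.exp (-b) * (pairExp (-b) p)⁻¹ = -(ratioY b 1 p - 1)⁻¹ := by
      have := inv_ratioY_sub_one b 1 p
      rw [this, one_mul]
      push_cast
      rw [one_mul]
      ring
    have e2 := inv_one_sub_ratioX p
    simp only [singularFactor, Matrix.cons_val, hlin, mul_inv]
    have e3 : Complex.exp (-b) * (c⁻¹ * (pairExp (-b) p)⁻¹) +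
        -Complex.exp (((Real.pi : ℝ) + Complex.I * p.1 * (-1 : ℝ)) / 2) *
          ((pairP p)⁻¹ * c⁻¹) = -(c⁻¹ * ((ratioY b 1 p - 1)⁻¹ + (1 - ratioX p)⁻¹)) := by
      rw [e2]
      linear_combination c⁻¹ * e1
    have e4 : ∫ x in (0 : ℝ)..(1 / 2), Complex.exp (c * x) =
        (Complex.exp (c * (1 / 2)) - 1) / c := by
      rw [integral_exp_mul_complex hc0]
      simp
    rw [e3, e4]
    rw [hXY] at hX ⊢
    rw [Complex.ofReal_one]
    generalize Complex.exp (c * (1 / 2)) = e at *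
    generalize ratioY b 1 p = Y at *
    field_simp
    ring
  · have hY : IsGood b (ratioY b (-1)) := (isGood_snd b).mul (isGood_const b _)
    have h3 := ((((isGood_const b (Complex.exp b)).mul hY).mul
      (isGood_exp_half b Real.pi (-1))).mul
      (isGood_integral_exp b (Real.pi - 2 * b))).hasForm_mul 2
    refine h3.congr fun p hp => ?_
    rw [coneTerm_halfExp_halfExp (Or.inr rfl) hp, div_eq_mul_inv,
      inv_ratioY_sub_one, inv_one_sub_ratioX]
    have e : ∀ x : ℝ, Complex.exp ((Complex.I * p.1 - Real.pi - 2 * b * (-1 : ℝ)) * x) =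
        Complex.exp ((Complex.I * p.1 - (Real.pi - 2 * b : ℝ)) * x) := by
      intro x
      congr 2
      push_cast
      ring
    simp only [singularFactor, Matrix.cons_val, mul_inv, e, neg_one_mul, neg_neg]
    push_cast
    simp only [neg_one_mul, neg_neg]
    ring

theorem coneTerm_bilinear (hs : s = 1 ∨ s = -1) (hb : Real.pi / 2 < b)
    (hP : HalfLineDecay P (3 * Real.pi)) (hQ : HalfLineDecay Q (3 * b)) (A₀ B₀ : ℂ)
    (hp : p ∈ region b 0) :
    coneTerm s (fun x => A₀ * halfExp Real.pi x + P x) (fun x => B₀ * halfExp b x + Q x) p =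
      A₀ * B₀ * coneTerm s (halfExp Real.pi) (halfExp b) p +
      A₀ * coneTerm s (halfExp Real.pi) Q p + B₀ * coneTerm s P (halfExp b) p +
      coneTerm s P Q p := by
  have hpi := Real.pi_pos
  have hE := halfLineDecay_halfExp Real.pi
  have hE' := halfLineDecay_halfExp b
  have h1 := (integrable_coneTerm hE hE' hs hp le_rfl le_rfl).const_mul (A₀ * B₀)
  have h2 := (integrable_coneTerm hE hQ hs hp le_rfl (by linarith)).const_mul A₀
  have h3 := (integrable_coneTerm hP hE' hs hp (by linarith) le_rfl).const_mul B₀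
  have h4 := integrable_coneTerm hP hQ hs hp (by linarith) (by linarith)
  have i1 := integral_add ((h1.add h2).add h3) h4
  have i2 := integral_add (h1.add h2) h3
  have i3 := integral_add h1 h2
  simp only [Pi.add_apply] at i1 i2 i3
  simp only [coneTerm]
  rw [← integral_const_mul, ← integral_const_mul, ← integral_const_mul, ← i3, ← i2, ← i1]
  congr 1
  ext q
  ring

theorem hasForm_coneTerm (hs : s = 1 ∨ s = -1) (hb : Real.pi / 2 < b)
    (hP : HalfLineDecay P (3 * Real.pi)) (hQ : HalfLineDecay Q (3 * b)) (A₀ B₀ : ℂ) :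
    HasForm b (coneTerm s (fun x => A₀ * halfExp Real.pi x + P x)
      (fun x => B₀ * halfExp b x + Q x)) := by
  refine (((((hasForm_coneTerm_leading hs).const_mul (A₀ * B₀)).add
    ((hasForm_coneTerm_left hs hb hQ).const_mul A₀)).add
    ((hasForm_coneTerm_right hs hP).const_mul B₀)).add
    ((isGood_coneTerm hs hb hP hQ).hasForm_mul 8)).congr fun p hp => ?_
  rw [coneTerm_bilinear hs hb hP hQ A₀ B₀ hp]
  simp [singularFactor]

end Form

/-! ### Decomposition of the Fourier integral into four cones -/

section ConeSum

/-- Measurable functions which are `A₀ e^{-kx} + O(e^{-3kx})` as `x → +∞`. -/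
def ExpAsymptotic (A : ℝ → ℂ) (k : ℝ) : Prop :=
  Measurable A ∧ ∃ (A₀ : ℂ) (C : ℝ), ∀ x, 0 < x →
    ‖A x - A₀ * Complex.exp (-(k * x))‖ ≤ C * Real.exp (-(3 * k * x))

/-- The restriction to the positive half-line. -/
noncomputable def halfLine (A : ℝ → ℂ) : ℝ → ℂ := (Set.Ioi 0).indicator A

variable {b k : ℝ} {A B : ℝ → ℂ} {p : ℂ × ℂ}

theorem halfLine_of_pos {x : ℝ} (hx : 0 < x) : halfLine A x = A x := Set.indicator_of_mem hx _

theorem halfLine_of_nonpos {x : ℝ} (hx : x ≤ 0) : halfLine A x = 0 :=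
  Set.indicator_of_notMem (by simpa using hx) _

theorem ExpAsymptotic.exists_eq (hA : ExpAsymptotic A k) : ∃ (A₀ : ℂ) (R : ℝ → ℂ),
    HalfLineDecay R (3 * k) ∧ halfLine A = fun x => A₀ * halfExp k x + R x := by
  obtain ⟨hm, A₀, C, hC⟩ := hA
  refine ⟨A₀, fun x => halfLine A x - A₀ * halfExp k x, ⟨?_, fun x hx => ?_, C, fun x hx => ?_⟩, ?_⟩
  · exact (hm.indicator measurableSet_Ioi).sub ((halfLineDecay_halfExp k).1.const_mul A₀)
  · simp only
    rw [halfLine_of_nonpos hx, halfExp_of_nonpos k hx, mul_zero, sub_zero]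
  · simp only
    rw [halfLine_of_pos hx, halfExp_of_pos k hx]
    exact hC x hx
  · ext x
    ring

theorem ExpAsymptotic.halfLineDecay (hk : 0 < k) (hA : ExpAsymptotic A k) :
    HalfLineDecay (halfLine A) k := by
  obtain ⟨A₀, R, hR, he⟩ := hA.exists_eq
  obtain ⟨C, hC0, hC⟩ := (hR.mono (by linarith : k ≤ 3 * k)).exists_bound
  refine ⟨hA.1.indicator measurableSet_Ioi, fun x hx => halfLine_of_nonpos hx, ‖A₀‖ + C,
    fun x hx => ?_⟩
  rw [he]
  simp only
  rw [halfExp_of_pos k hx, add_mul]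
  refine (norm_add_le _ _).trans (add_le_add ?_ (hC x))
  rw [norm_mul, Complex.norm_exp]
  simp

/-- The full Fourier integral. -/
noncomputable def coneSum (A B : ℝ → ℂ) (p : ℂ × ℂ) : ℂ :=
  ∫ q, pairMode p q * (A q.2 * B (2 * q.2 - q.1)) ∂modeMeasure

theorem measurePreserving_neg_modeMeasure :
    MeasurePreserving (fun q : ℤ × ℝ => -q) modeMeasure modeMeasure :=
  (Measure.measurePreserving_neg (Measure.count : Measure ℤ)).prod
    (Measure.measurePreserving_neg (volume : Measure ℝ))

/-- The edges of the cones are null sets, so the half-line cut-offs may vanish at zero. -/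
theorem ae_modeMeasure_ne : ∀ᵐ q ∂modeMeasure, q.2 ≠ 0 ∧ 2 * q.2 - (q.1 : ℝ) ≠ 0 := by
  have hm := measurable_intCast_fst
  rw [modeMeasure, Measure.ae_prod_iff_ae_ae]
  · refine ae_of_all _ fun j => ?_
    filter_upwards [(Set.countable_singleton (0 : ℝ)).ae_notMem volume,
      (Set.countable_singleton ((j : ℝ) / 2)).ae_notMem volume] with x h1 h2
    refine ⟨h1, fun h => h2 ?_⟩
    rw [Set.mem_singleton_iff]
    have h' : 2 * x - (j : ℝ) = 0 := h
    linarith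
  · exact (measurableSet_eq_fun (by fun_prop) measurable_const).compl.inter
      (measurableSet_eq_fun (by fun_prop) measurable_const).compl

/-- The four sign patterns of `ξ` and `2ξ - j`. The two cones with `ξ < 0` are reflected by `q ↦
-q`, which replaces `p` by `flip p`, so that only cones with `ξ > 0` need analysis. -/
theorem coneSum_eq (hb : Real.pi / 2 < b) (hA : ExpAsymptotic A Real.pi)
    (hA' : ExpAsymptotic (fun x => A (-x)) Real.pi) (hB : ExpAsymptotic B b)
    (hB' : ExpAsymptotic (fun x => B (-x)) b) (hp : p ∈ region b 0) :
    Integrable (fun q => pairMode p q * (A q.2 * B (2 * q.2 - q.1))) modeMeasure ∧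
    coneSum A B p = coneTerm 1 (halfLine A) (halfLine B) p +
      coneTerm (-1) (halfLine A) (halfLine fun x => B (-x)) p +
      coneTerm 1 (halfLine fun x => A (-x)) (halfLine fun x => B (-x)) (flip p) +
      coneTerm (-1) (halfLine fun x => A (-x)) (halfLine B) (flip p) := by
  have hpi := Real.pi_pos
  have hb0 : 0 < b := by linarith
  have h1 := integrable_coneTerm (hA.halfLineDecay hpi) (hB.halfLineDecay hb0)
    (s := 1) (Or.inl rfl) hp le_rfl le_rfl
  have h2 := integrable_coneTerm (hA.halfLineDecay hpi) (hB'.halfLineDecay hb0)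
    (s := -1) (Or.inr rfl) hp le_rfl le_rfl
  have h3 := integrable_coneTerm (hA'.halfLineDecay hpi) (hB'.halfLineDecay hb0)
    (s := 1) (Or.inl rfl) (flip_mem_region hp) le_rfl le_rfl
  have h4 := integrable_coneTerm (hA'.halfLineDecay hpi) (hB.halfLineDecay hb0)
    (s := -1) (Or.inr rfl) (flip_mem_region hp) le_rfl le_rfl
  have hemb : MeasurableEmbedding fun q : ℤ × ℝ => -q := (MeasurableEquiv.neg _).measurableEmbedding
  have e3 := measurePreserving_neg_modeMeasure.integral_comp hemb (fun q => pairMode (flip p) q *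
    (halfLine (fun x => A (-x)) q.2 * halfLine (fun x => B (-x)) (1 * (2 * q.2 - q.1))))
  have e4 := measurePreserving_neg_modeMeasure.integral_comp hemb (fun q => pairMode (flip p) q *
    (halfLine (fun x => A (-x)) q.2 * halfLine B (-1 * (2 * q.2 - q.1))))
  have h3' := (measurePreserving_neg_modeMeasure.integrable_comp_emb hemb).2 h3
  have h4' := (measurePreserving_neg_modeMeasure.integrable_comp_emb hemb).2 h4
  have hsum := ((h1.add h2).add h3').add h4'
  have hae : (fun q => pairMode p q * (A q.2 * B (2 * q.2 - q.1))) =ᵐ[modeMeasure] fun q =>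
      pairMode p q * (halfLine A q.2 * halfLine B (1 * (2 * q.2 - q.1))) +
      pairMode p q * (halfLine A q.2 * halfLine (fun x => B (-x)) (-1 * (2 * q.2 - q.1))) +
      pairMode (flip p) (-q) * (halfLine (fun x => A (-x)) (-q).2 *
        halfLine (fun x => B (-x)) (1 * (2 * (-q).2 - (-q).1))) +
      pairMode (flip p) (-q) * (halfLine (fun x => A (-x)) (-q).2 *
        halfLine B (-1 * (2 * (-q).2 - (-q).1))) := by
    filter_upwards [ae_modeMeasure_ne] with q hq
    have e : (2 * (-q).2 - ((-q).1 : ℤ) : ℝ) = -(2 * q.2 - q.1) := by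
      rw [Prod.snd_neg, Prod.fst_neg]; push_cast; ring
    rw [pairMode_flip, neg_neg, e, Prod.snd_neg]
    set x := 2 * q.2 - (q.1 : ℝ) with hx
    rw [one_mul, neg_one_mul, one_mul, neg_one_mul, neg_neg]
    rcases lt_or_gt_of_ne hq.1 with h5 | h5 <;> rcases lt_or_gt_of_ne hq.2 with h6 | h6
    · rw [halfLine_of_nonpos h5.le, halfLine_of_pos (neg_pos.2 h5), halfLine_of_pos (neg_pos.2 h6),
        halfLine_of_nonpos h6.le, neg_neg, neg_neg]
      ring
    · rw [halfLine_of_nonpos h5.le, halfLine_of_pos (neg_pos.2 h5), halfLine_of_pos h6,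
        halfLine_of_nonpos (neg_neg_of_pos h6).le, neg_neg]
      ring
    · rw [halfLine_of_pos h5, halfLine_of_nonpos (neg_neg_of_pos h5).le,
        halfLine_of_pos (neg_pos.2 h6), halfLine_of_nonpos h6.le, neg_neg]
      ring
    · rw [halfLine_of_pos h5, halfLine_of_nonpos (neg_neg_of_pos h5).le,
        halfLine_of_nonpos (neg_neg_of_pos h6).le, halfLine_of_pos h6]
      ring
  refine ⟨hsum.congr hae.symm, ?_⟩
  rw [coneSum, integral_congr_ae hae]
  have i1 := integral_add ((h1.add h2).add h3') h4'
  have i2 := integral_add (h1.add h2) h3'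
  have i3 := integral_add h1 h2
  simp only [Pi.add_apply, Function.comp_apply] at i1 i2 i3
  rw [i1, i2, i3, e3, e4]
  rfl

theorem hasForm_coneSum (hb : Real.pi / 2 < b) (hA : ExpAsymptotic A Real.pi)
    (hA' : ExpAsymptotic (fun x => A (-x)) Real.pi) (hB : ExpAsymptotic B b)
    (hB' : ExpAsymptotic (fun x => B (-x)) b) : HasForm b (coneSum A B) := by
  have key : ∀ {s : ℝ} {A B : ℝ → ℂ}, (s = 1 ∨ s = -1) → ExpAsymptotic A Real.pi →
      ExpAsymptotic B b → HasForm b (coneTerm s (halfLine A) (halfLine B)) := by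
    intro s A B hs hA hB
    obtain ⟨A₀, P, hP, e1⟩ := hA.exists_eq
    obtain ⟨B₀, Q, hQ, e2⟩ := hB.exists_eq
    rw [e1, e2]
    exact hasForm_coneTerm hs hb hP hQ A₀ B₀
  exact ((((key (Or.inl rfl) hA hB).add (key (Or.inr rfl) hA hB')).add
    (key (Or.inl rfl) hA' hB').comp_flip).add (key (Or.inr rfl) hA' hB).comp_flip).congr
    fun p hp => (coneSum_eq hb hA hA' hB hB' hp).2

end ConeSum

end Worm

namespace Worm

/-! ### The series of residues -/

section PoleSeries

variable {b k θ ν : ℝ} {p : ℂ × ℂ}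

/-- The reciprocal of the hyperbolic cosine on a horizontal line. -/
noncomputable def lineSech (k θ x : ℝ) : ℂ := (Complex.cosh ((k * x : ℝ) + θ * Complex.I))⁻¹

theorem lineSech_neg (k θ x : ℝ) : lineSech k θ (-x) = lineSech k (-θ) x := by
  rw [lineSech, lineSech, ← Complex.cosh_neg]
  congr 2
  push_cast
  ring

theorem norm_lineSech_sub_le (hk : 0 ≤ k) (hθ : Real.cos θ ≠ 0) {x : ℝ} (hx : 0 ≤ x) :
    ‖lineSech k θ x - 2 * Complex.exp (-(θ * Complex.I)) * Complex.exp (-(k * x))‖ ≤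
      2 / |Real.cos θ| * Real.exp (-(3 * k * x)) := by
  have hre : (((k * x : ℝ) : ℂ) + θ * Complex.I).re = k * x := by
    rw [Complex.add_re, Complex.ofReal_re, Complex.re_ofReal_mul, Complex.I_re, mul_zero, add_zero]
  have him : (((k * x : ℝ) : ℂ) + θ * Complex.I).im = θ := by
    rw [Complex.add_im, Complex.ofReal_im, Complex.im_ofReal_mul, Complex.I_im, mul_one, zero_add]
  have h := norm_inv_cosh_sub_le (z := (k * x : ℝ) + θ * Complex.I) (abs_pos.2 hθ)
    (by rw [him]) (by rw [hre]; positivity)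
  rw [hre] at h
  have e : Complex.exp (-(((k * x : ℝ) : ℂ) + θ * Complex.I)) =
      Complex.exp (-(θ * Complex.I)) * Complex.exp (-(k * x)) := by
    rw [← Complex.exp_add]
    congr 1
    push_cast
    ring
  rw [e, ← mul_assoc, ← mul_assoc] at h
  exact h

theorem continuous_lineSech (hθ : Real.cos θ ≠ 0) : Continuous (lineSech k θ) := by
  unfold lineSech
  refine Continuous.inv₀ (by fun_prop) fun x => cosh_ne_zero_of_cos_ne_zero ?_
  rwa [Complex.add_im, Complex.ofReal_im, Complex.im_ofReal_mul, Complex.I_im, mul_one, zero_add]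

theorem expAsymptotic_lineSech (hk : 0 < k) (hθ : Real.cos θ ≠ 0) :
    ExpAsymptotic (lineSech k θ) k ∧ ExpAsymptotic (fun x => lineSech k θ (-x)) k := by
  have h : ∀ θ : ℝ, Real.cos θ ≠ 0 → ExpAsymptotic (lineSech k θ) k := fun θ hθ =>
    ⟨(continuous_lineSech hθ).measurable, _, _,
      fun x hx => norm_lineSech_sub_le hk.le hθ hx.le⟩
  refine ⟨h θ hθ, ?_⟩
  simp only [lineSech_neg]
  exact h (-θ) (by rwa [Real.cos_neg])

/-- The functions with at most simple poles along the zero sets of `pairP` and `pairQ`. -/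
def HasPoles (b : ℝ) (F : ℂ × ℂ → ℂ) : Prop :=
  ∃ ρ₁ ρ₂ e, IsGood b ρ₁ ∧ IsGood b ρ₂ ∧ IsGood b e ∧
    ∀ p ∈ region b 0, F p = ρ₁ p * (pairP p)⁻¹ + ρ₂ p * (pairQ p)⁻¹ + e p

theorem HasPoles.comp_flip {F : ℂ × ℂ → ℂ} (hF : HasPoles b F) :
    HasPoles b fun p => F (flip p) := by
  obtain ⟨ρ₁, ρ₂, e, h1, h2, h3, h⟩ := hF
  have hμ := isGood_snd b
  have hQ := ((isGood_exp_half b (-Real.pi) (-1)).mul hμ).neg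
  have hP := ((isGood_exp_half b Real.pi (-1)).mul hμ).neg
  refine ⟨_, _, _, h2.comp_flip.mul hP, h1.comp_flip.mul hQ, h3.comp_flip, fun p hp => ?_⟩
  simp only
  rw [h _ (flip_mem_region hp), inv_pairP_flip hp.1, inv_pairQ_flip hp.1]
  ring

theorem HasPoles.add {F G : ℂ × ℂ → ℂ} (hF : HasPoles b F) (hG : HasPoles b G) :
    HasPoles b fun p => F p + G p := by
  obtain ⟨ρ₁, ρ₂, e, h1, h2, h3, h⟩ := hF
  obtain ⟨ρ₁', ρ₂', e', h1', h2', h3', h'⟩ := hG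
  refine ⟨_, _, _, h1.add h1', h2.add h2', h3.add h3', fun p hp => ?_⟩
  simp only
  rw [h p hp, h' p hp]
  ring

theorem HasPoles.mul_good {F f : ℂ × ℂ → ℂ} (hF : HasPoles b F) (hf : IsGood b f) :
    HasPoles b fun p => f p * F p := by
  obtain ⟨ρ₁, ρ₂, e, h1, h2, h3, h⟩ := hF
  refine ⟨_, _, _, hf.mul h1, hf.mul h2, hf.mul h3, fun p hp => ?_⟩
  simp only
  rw [h p hp]
  ring

/-- The combination `μ e^{iτ/2}`. -/
noncomputable def lam (p : ℂ × ℂ) : ℂ := p.2 * Complex.exp (Complex.I * p.1 * (1 / 2 : ℝ))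

theorem lam_ne_zero (hp : p.2 ≠ 0) : lam p ≠ 0 := mul_ne_zero hp (Complex.exp_ne_zero _)

theorem lam_flip (p : ℂ × ℂ) : lam (flip p) = (lam p)⁻¹ := by
  rw [lam, lam, mul_inv, ← Complex.exp_neg]
  simp [flip]

theorem isGood_lam (b : ℝ) : IsGood b lam := (isGood_snd b).mul (isGood_exp b (1 / 2))

theorem ratioX_eq_lam (p : ℂ × ℂ) : ratioX p = lam p * Complex.exp (-(Real.pi / 2)) := by
  rw [ratioX, lam, mul_assoc, ← Complex.exp_add]
  congr 2
  push_cast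
  ring

theorem log_norm_lam (hp : p.2 ≠ 0) :
    Real.log ‖lam p‖ = (2 * Real.log ‖p.2‖ - p.1.im) / 2 := by
  rw [lam, norm_mul, Real.log_mul (norm_ne_zero_iff.2 hp) (by simp), Complex.norm_exp,
    Real.log_exp]
  simp
  ring

/-- The leading part of `t` gives a geometric series in `ratioX`, with a pole where `pairP`
vanishes. On the enlarged region `|λ| ≤ e^{3π/4}`, so the remainder converges there with ratio
`e^{-3π/4}`. -/
theorem exists_hasSum_lam_pow {t : ℕ → ℂ} {t₀ : ℂ} {C : ℝ} (ht : ∀ n : ℕ,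
    ‖t n - t₀ * Complex.exp (-(Real.pi / 2)) ^ n‖ ≤ C * Real.exp (-(3 * Real.pi / 2)) ^ n) :
    ∃ F, HasPoles b F ∧ ∀ p ∈ region b 0, HasSum (fun n : ℕ => lam p ^ n * t n) (F p) := by
  have hpi := Real.pi_pos
  set r : ℕ → ℂ := fun n => t n - t₀ * Complex.exp (-(Real.pi / 2)) ^ n with hr
  have hC0 : 0 ≤ C := by simpa using (norm_nonneg _).trans (ht 0)
  have hG : Summable fun n : ℕ => C * Real.exp (-(3 * Real.pi / 4)) ^ n :=
    (summable_geometric_of_lt_one (Real.exp_pos _).le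
      (by rw [← Real.exp_zero, Real.exp_lt_exp]; linarith)).mul_left C
  have hb : ∀ p ∈ region b (Real.pi / 4), ∀ n : ℕ, ‖lam p ^ n * r n‖ ≤
      C * Real.exp (-(3 * Real.pi / 4)) ^ n := by
    intro p hp n
    have h1 : ‖lam p‖ ≤ Real.exp (3 * Real.pi / 4) := by
      rw [← Real.log_le_iff_le_exp (norm_pos_iff.2 (lam_ne_zero hp.1)), log_norm_lam hp.1]
      linarith [(abs_lt.1 hp.2.1).1]
    rw [norm_mul, norm_pow]
    calc _ ≤ Real.exp (3 * Real.pi / 4) ^ n * (C * Real.exp (-(3 * Real.pi / 2)) ^ n) := by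
          gcongr
          exact ht n
      _ = C * (Real.exp (3 * Real.pi / 4) * Real.exp (-(3 * Real.pi / 2))) ^ n := by
          rw [mul_pow]; ring
      _ = _ := by
          rw [← Real.exp_add]
          congr 3
          ring
  have hGi : Integrable (fun n : ℕ => C * Real.exp (-(3 * Real.pi / 4)) ^ n) Measure.count := by
    rw [integrable_count_iff]
    exact hG.norm
  -- The series is read as an integral over counting measure, so that the criterion for dominated
  -- integrals applies.
  have hgood : IsGood b fun p => ∫ n, lam p ^ n * r n ∂(Measure.count : Measure ℕ) :=
    isGood_integral_of_dominated hGi (fun p => (measurable_from_top).aestronglyMeasurable)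
      (fun n => ((isGood_lam b).1.pow n).mul_const _) hb
  refine ⟨_, ⟨_, _, _, (isGood_const b t₀).mul (isGood_exp_half b Real.pi (-1)), isGood_const b 0,
    hgood, fun p hp => rfl⟩, fun p hp => ?_⟩
  have hp' : p ∈ region b (Real.pi / 4) := region_mono (by positivity) hp
  have hsr : Summable fun n => lam p ^ n * r n := Summable.of_norm_bounded hG (hb p hp')
  have h1 := (hasSum_geometric_of_norm_lt_one (norm_ratioX_lt_one hp)).mul_left t₀
  have h2 : HasSum (fun n => lam p ^ n * r n) (∫ n, lam p ^ n * r n ∂(Measure.count : Measure ℕ)) := by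
    have hi : Integrable (fun n => lam p ^ n * r n) Measure.count := by
      rw [integrable_count_iff]
      exact hsr.norm
    rw [integral_countable hi]
    simpa [measureReal_def] using hsr.hasSum
  have h3 := h1.add h2
  rw [inv_one_sub_ratioX, ← mul_assoc] at h3
  rw [zero_mul, add_zero]
  refine h3.congr_fun fun n => ?_
  rw [ratioX_eq_lam, mul_pow, hr]
  ring

/-- The terms with `j < 0` form a power series in `λ⁻¹`, which is `lam (flip p)`, with the angle
reversed. The pole along `pairP` thus becomes one along `pairQ`. -/
theorem exists_hasSum_poleSeries (hν : Real.cos (Real.pi * ν / 2) ≠ 0) :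
    ∃ F, HasPoles b F ∧ ∀ p ∈ region b 0,
      HasSum (fun j : ℤ => lam p ^ j * lineSech (Real.pi / 2) (Real.pi * ν / 2) j) (F p) := by
  have hpi := Real.pi_pos
  have hk : 0 ≤ Real.pi / 2 := by positivity
  set θ := Real.pi * ν / 2 with hθ
  have hbound : ∀ θ : ℝ, Real.cos θ ≠ 0 → ∀ x : ℝ, 0 ≤ x →
      ‖lineSech (Real.pi / 2) θ x - 2 * Complex.exp (-(θ * Complex.I)) *
        Complex.exp (-(Real.pi / 2) * x)‖ ≤
      2 / |Real.cos θ| * Real.exp (-(3 * Real.pi / 2) * x) := by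
    intro θ hθ x hx
    have h := norm_lineSech_sub_le hk hθ hx
    have e : Real.exp (-(3 * (Real.pi / 2) * x)) = Real.exp (-(3 * Real.pi / 2) * x) := by
      congr 1; ring
    rw [e] at h
    convert h using 5
    push_cast
    ring
  obtain ⟨F, hF, hsF⟩ := exists_hasSum_lam_pow (b := b)
    (t := fun n : ℕ => lineSech (Real.pi / 2) θ n) (t₀ := 2 * Complex.exp (-(θ * Complex.I)))
    (C := 2 / |Real.cos θ|) (fun n => by
      have h := hbound θ hν n (by positivity)
      rw [← Complex.exp_nat_mul, ← Real.exp_nat_mul]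
      convert h using 3
      · congr 2
        push_cast
        ring
      · ring)
  -- Indexed by `j = -(n + 1)`; the shift by one puts `e^{-π/2}` into the leading coefficient and
  -- `e^{-3π/2}` into the error constant.
  obtain ⟨G, hG, hsG⟩ := exists_hasSum_lam_pow (b := b)
    (t := fun n : ℕ => lineSech (Real.pi / 2) (-θ) (n + 1))
    (t₀ := 2 * Complex.exp (-((-θ : ℝ) * Complex.I)) * Complex.exp (-(Real.pi / 2)))
    (C := 2 / |Real.cos (-θ)| * Real.exp (-(3 * Real.pi / 2))) (fun n => by
      have h := hbound (-θ) (by rwa [Real.cos_neg]) (n + 1) (by positivity)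
      rw [mul_assoc (2 * _), ← pow_succ', mul_assoc (2 / _), ← pow_succ', ← Complex.exp_nat_mul,
        ← Real.exp_nat_mul]
      convert h using 3
      · congr 2
        push_cast
        ring
      · push_cast
        ring)
  refine ⟨_, hF.add (hG.comp_flip.mul_good (isGood_lam b).comp_flip), fun p hp => ?_⟩
  have h2 := (hsG _ (flip_mem_region hp)).mul_left (lam (flip p))
  refine HasSum.of_nat_of_neg_add_one ?_ ?_
  · refine (hsF p hp).congr_fun fun n => ?_
    rw [zpow_natCast, Int.cast_natCast]
  · refine h2.congr_fun fun n => ?_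
    have e1 : (((-((n : ℤ) + 1) : ℤ)) : ℝ) = -((n : ℝ) + 1) := by push_cast; ring
    rw [e1, lineSech_neg, lam_flip, zpow_neg, ← inv_zpow, ← mul_assoc, ← pow_succ']
    rfl

end PoleSeries

end Worm

namespace Worm

/-! ### The Szegő kernel as residues plus a shifted integral -/

section KernelFormula

variable {β b h ν : ℝ} {w z : ℂ × ℂ} {A B : ℝ → ℂ}

/-- The pair `(w₁ - conj z₁, w₂ conj z₂)` on which the kernel depends. -/
def kernelPair (w z : ℂ × ℂ) : ℂ × ℂ := (tau w z, w.2 * conj z.2)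

theorem kernelPair_mem_region {t s b δ : ℝ} (hw : w ∈ subdomain t s) (hz : z ∈ subdomain t s)
    (ht : 2 * t = Real.pi + 2 * δ) (hs : s = b + δ) : kernelPair w z ∈ region b δ := by
  obtain ⟨hw0, hw1, hw2⟩ := hw
  obtain ⟨hz0, hz1, hz2⟩ := hz
  rw [Real.log_pow, Nat.cast_ofNat] at hw1 hw2 hz1 hz2
  have e1 : Real.log ‖(kernelPair w z).2‖ = Real.log ‖w.2‖ + Real.log ‖z.2‖ := by
    rw [kernelPair, norm_mul, RCLike.norm_conj, Real.log_mul (norm_ne_zero_iff.2 hw0)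
      (norm_ne_zero_iff.2 hz0)]
  have e2 : (kernelPair w z).1.im = w.1.im + z.1.im := by simp [kernelPair, tau]
  refine ⟨mul_ne_zero hw0 ((map_ne_zero _).2 hz0), ?_, ?_⟩
  · rw [e1, e2]
    rw [abs_lt] at *
    constructor <;> linarith
  · rw [e1]
    rw [abs_lt] at *
    constructor <;> linarith

theorem kernelPair_mem_region_zero (hw : w ∈ domain β) (hz : z ∈ domain β) :
    kernelPair w z ∈ region (β - Real.pi / 2) 0 :=
  kernelPair_mem_region (t := Real.pi / 2) (s := β - Real.pi / 2) hw hz (by ring) (by ring)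

theorem kernelModes_mul_mode (β : ℝ) (w z : ℂ × ℂ) (j : ℤ) (η : ℝ) :
    kernelModes β z (j, η) * mode w (j, η) = 1 / 4 * (pairMode (kernelPair w z) (j, 2 * Real.pi * η) *
      (lineSech Real.pi 0 (2 * Real.pi * η) *
        lineSech (β - Real.pi / 2) 0 (2 * (2 * Real.pi * η) - j))) := by
  have e1 : conj (mode z (j, η)) * mode w (j, η) =
      pairMode (kernelPair w z) (j, 2 * Real.pi * η) := by
    simp only [mode, pairMode, kernelPair, map_mul, map_zpow₀, ← Complex.exp_conj, Complex.conj_I,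
      Complex.conj_ofReal, map_ofNat, mul_zpow]
    have : Complex.exp (2 * Real.pi * -Complex.I * η * conj z.1) *
        Complex.exp (2 * Real.pi * Complex.I * η * w.1) =
        Complex.exp (Complex.I * ((2 * Real.pi * η : ℝ) : ℂ) * tau w z) := by
      rw [← Complex.exp_add, tau]
      congr 1
      push_cast
      ring
    rw [← this]
    ring
  rw [kernelModes, ← e1, modeWeight, lineSech, lineSech]
  simp only [Complex.ofReal_zero, zero_mul, add_zero, ← Complex.ofReal_cosh]
  have a1 : 4 * Real.pi * η * (Real.pi / 2) = Real.pi * (2 * Real.pi * η) := by ring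
  have a2 : (4 * Real.pi * η - j) * (β - Real.pi / 2) =
      (β - Real.pi / 2) * (2 * (2 * Real.pi * η) - j) := by ring
  rw [a1, a2]
  push_cast
  rw [div_eq_mul_inv, mul_inv, mul_inv]
  ring

/-- Substitution `ξ = 2πη` in each mode `j`. The constant combines `1/4` from the weight with
`1/(2π)` from the substitution. -/
theorem szegoKernel_eq_coneSum (hβ : Real.pi < β) (hw : w ∈ domain β) (hz : z ∈ domain β) :
    szegoKernel β w z = (8 * (Real.pi : ℂ))⁻¹ *
      coneSum (lineSech Real.pi 0) (lineSech (β - Real.pi / 2) 0) (kernelPair w z) := by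
  have hpi := Real.pi_pos
  have hp := kernelPair_mem_region_zero hw hz
  have hb : Real.pi / 2 < β - Real.pi / 2 := by linarith
  have h0 : Real.cos 0 ≠ 0 := by simp
  have hA := expAsymptotic_lineSech hpi h0
  have hB := expAsymptotic_lineSech (by linarith : 0 < β - Real.pi / 2) h0
  have hi := (coneSum_eq hb hA.1 hA.2 hB.1 hB.2 hp).1
  have h1 := (hasSum_integral_modeMeasure hi).mul_left (8 * (Real.pi : ℂ))⁻¹
  have h2 := hasSum_integral_modeMeasure ((isHardyModes_kernelModes hz).integrable_mul_mode hw)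
  refine h2.unique (h1.congr_fun fun j => ?_)
  simp only [kernelModes_mul_mode]
  rw [integral_const_mul, Measure.integral_comp_mul_left (fun x : ℝ =>
    pairMode (kernelPair w z) (j, x) * (lineSech Real.pi 0 x *
      lineSech (β - Real.pi / 2) 0 (2 * x - j))) (2 * Real.pi),
    abs_of_pos (by positivity), Complex.real_smul]
  push_cast
  rw [← mul_assoc]
  congr 1
  rw [mul_inv, mul_inv]
  norm_num
  ring

theorem coneSum_flip (hA : ∀ x, A (-x) = A x) (hB : ∀ x, B (-x) = B x) (p : ℂ × ℂ) :
    coneSum A B (flip p) = coneSum A B p := by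
  have hemb : MeasurableEmbedding fun q : ℤ × ℝ => -q := (MeasurableEquiv.neg _).measurableEmbedding
  rw [coneSum, coneSum, ← measurePreserving_neg_modeMeasure.integral_comp hemb]
  congr 1
  ext q
  have e : (2 * (-q).2 - ((-q).1 : ℤ) : ℝ) = -(2 * q.2 - q.1) := by
    rw [Prod.snd_neg, Prod.fst_neg]; push_cast; ring
  rw [pairMode_flip, neg_neg, e, hB, Prod.snd_neg, hA]

theorem coeffIntegrand_line (b h : ℝ) (p : ℂ × ℂ) (j : ℤ) (x : ℝ) :
    p.2 ^ j * coeffIntegrand b p.1 j (x + h * Complex.I) = Complex.exp (-(p.1 * h)) *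
      (pairMode p (j, x) * (lineSech Real.pi (Real.pi * h) x *
        lineSech b (2 * b * h) (2 * x - j))) := by
  have e1 : Complex.exp (Complex.I * (x + h * Complex.I) * p.1) =
      Complex.exp (-(p.1 * h)) * Complex.exp (Complex.I * x * p.1) := by
    rw [← Complex.exp_add]
    congr 1
    linear_combination (h * p.1) * Complex.I_mul_I
  have e2 : (Real.pi : ℂ) * (x + h * Complex.I) =
      ((Real.pi * x : ℝ) : ℂ) + (Real.pi * h : ℝ) * Complex.I := by push_cast; ring
  have e3 : (2 * ((x : ℂ) + h * Complex.I) - j) * b =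
      ((b * (2 * x - j) : ℝ) : ℂ) + (2 * b * h : ℝ) * Complex.I := by push_cast; ring
  rw [coeffIntegrand, e1, e2, e3, pairMode, lineSech, lineSech]
  ring

theorem coeffIntegrand_real (b : ℝ) (p : ℂ × ℂ) (j : ℤ) (x : ℝ) :
    p.2 ^ j * coeffIntegrand b p.1 j x =
      pairMode p (j, x) * (lineSech Real.pi 0 x * lineSech b 0 (2 * x - j)) := by
  have h := coeffIntegrand_line b 0 p j x
  simpa using h

/-- The kernel as an exponentially weighted sum of residues and a Fourier integral along a shifted
line. -/
theorem exists_coneSum_eq (hb : Real.pi / 2 < b) (hν : 2 * b * ν = Real.pi) (h1 : ν / 2 < h)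
    (h2 : h < 1 / 2) (h3 : h < 3 * ν / 2) :
    ∃ F G, HasPoles b F ∧ HasForm b G ∧ ∀ p ∈ region b 0,
      coneSum (lineSech Real.pi 0) (lineSech b 0) p =
        Complex.exp (-(p.1 * ν / 2)) * F p + Complex.exp (-(p.1 * h)) * G p := by
  have hpi := Real.pi_pos
  have hb0 : 0 < b := by linarith
  have hν0 : 0 < ν := by
    by_contra hcon
    have : 2 * b * ν ≤ 0 := mul_nonpos_of_nonneg_of_nonpos (by positivity) (not_lt.1 hcon)
    linarith
  have c0 : Real.cos 0 ≠ 0 := by simp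
  have c1 : Real.cos (Real.pi * ν / 2) ≠ 0 :=
    (Real.cos_pos_of_mem_Ioo ⟨by nlinarith, by nlinarith⟩).ne'
  have c2 : Real.cos (Real.pi * h) ≠ 0 :=
    -- `h < 1/2` keeps the new line below the zeros of `cosh(πξ)`.
    (Real.cos_pos_of_mem_Ioo ⟨by nlinarith, by nlinarith⟩).ne'
  -- `ν/2 < h < 3ν/2` puts `2bh` strictly between `π/2` and `3π/2`.
  have c3 : Real.cos (2 * b * h) ≠ 0 :=
    (Real.cos_neg_of_pi_div_two_lt_of_lt (by nlinarith) (by nlinarith)).ne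
  have hA := expAsymptotic_lineSech hpi c0
  have hB := expAsymptotic_lineSech hb0 c0
  have hA' := expAsymptotic_lineSech hpi c2
  have hB' := expAsymptotic_lineSech hb0 c3
  obtain ⟨F, hF, hsF⟩ := exists_hasSum_poleSeries (b := b) c1
  refine ⟨_, _, hF.mul_good (isGood_const b (Real.pi / b)), hasForm_coneSum hb hA'.1 hA'.2 hB'.1 hB'.2,
    fun p hp => ?_⟩
  have hs := hasSum_integral_modeMeasure (coneSum_eq hb hA.1 hA.2 hB.1 hB.2 hp).1
  have hs' := hasSum_integral_modeMeasure (coneSum_eq hb hA'.1 hA'.2 hB'.1 hB'.2 hp).1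
  refine hs.unique ((((hsF p hp).mul_left (Real.pi / b : ℂ)).mul_left
    (Complex.exp (-(p.1 * ν / 2)))).add (hs'.mul_left (Complex.exp (-(p.1 * h)))) |>.congr_fun
    fun j => ?_)
  have hτ : |p.1.im| < Real.pi + 2 * b := by
    have := abs_im_lt_of_mem_region hp
    linarith
  have hshift := integral_coeffIntegrand_shift hb0 hν h1 h2 h3 hτ j
  -- At the pole the exponential splits into the common factor `e^{-τν/2}` and the `j`-th power of
  -- `e^{iτ/2}`, which combines with `μʲ` to `λʲ`.
  have e1 : Complex.exp (Complex.I * (j / 2 + ν / 2 * Complex.I) * p.1) =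
      Complex.exp (-(p.1 * ν / 2)) * Complex.exp (Complex.I * p.1 * (1 / 2 : ℝ)) ^ j := by
    rw [← Complex.exp_int_mul, ← Complex.exp_add]
    congr 1
    push_cast
    linear_combination (ν / 2 * p.1) * Complex.I_mul_I
  have e2 : (Complex.cosh (Real.pi * (j / 2 + ν / 2 * Complex.I)))⁻¹ =
      lineSech (Real.pi / 2) (Real.pi * ν / 2) j := by
    rw [lineSech]
    congr 2
    push_cast
    ring
  simp only [← coeffIntegrand_real]
  rw [integral_const_mul, hshift, mul_add, ← integral_const_mul (p.2 ^ j)]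
  simp only [coeffIntegrand_line]
  rw [integral_const_mul, e1, e2, lam, mul_zpow]
  ring

end KernelFormula

end Worm

namespace Worm

/-! ### Coefficients on a uniform neighbourhood of the closure -/

section Neighbourhood

variable {β : ℝ} {w z : ℂ × ℂ}

/-- The neighbourhood of the closed worm domain on which the coefficients are defined. -/
def enlargement (β : ℝ) : Set (ℂ × ℂ) :=
  subdomain (Real.pi / 2 + Real.pi / 4) (β - Real.pi / 2 + Real.pi / 4)

/-- On the domain `|z₂|` is bounded below by `e^{-(β - π/2)/2}`, so the closure avoids `z₂ = 0` and
the logarithm passes to the limit. -/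
theorem closure_domain_subset :
    closure (domain β) ⊆ {z | z.2 ≠ 0 ∧ |z.1.im - Real.log (‖z.2‖ ^ 2)| ≤ Real.pi / 2 ∧
      |Real.log (‖z.2‖ ^ 2)| ≤ β - Real.pi / 2} := by
  intro z hz
  obtain ⟨x, hx, hlim⟩ := mem_closure_iff_seq_limit.1 hz
  have h2 : Tendsto (fun n => ‖(x n).2‖) atTop (𝓝 ‖z.2‖) :=
    ((continuous_snd.norm).tendsto z).comp hlim
  have hlow : ∀ n, Real.exp (-(β - Real.pi / 2) / 2) ≤ ‖(x n).2‖ := by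
    intro n
    rw [← Real.le_log_iff_exp_le (norm_pos_iff.2 (hx n).1)]
    have h := (abs_lt.1 (hx n).2.2).1
    rw [Real.log_pow, Nat.cast_ofNat] at h
    linarith
  have h0 : z.2 ≠ 0 :=
    norm_pos_iff.1 ((Real.exp_pos _).trans_le (ge_of_tendsto' h2 hlow))
  have hlog : Tendsto (fun n => Real.log (‖(x n).2‖ ^ 2)) atTop (𝓝 (Real.log (‖z.2‖ ^ 2))) :=
    (h2.pow 2).log (pow_ne_zero 2 (norm_ne_zero_iff.2 h0))
  have him : Tendsto (fun n => (x n).1.im) atTop (𝓝 z.1.im) :=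
    ((Complex.continuous_im.comp continuous_fst).tendsto z).comp hlim
  exact ⟨h0, le_of_tendsto' (him.sub hlog).abs fun n => (hx n).2.1.le,
    le_of_tendsto' hlog.abs fun n => (hx n).2.2.le⟩

theorem abs_log_sub_log_le {x y m : ℝ} (hm : 0 < m) (hx : m ≤ x) (hy : m ≤ y) :
    |Real.log x - Real.log y| ≤ |x - y| / m := by
  have key : ∀ {x y : ℝ}, m ≤ x → m ≤ y → Real.log x - Real.log y ≤ |x - y| / m := by
    intro x y hx hy
    have hx0 := hm.trans_le hx
    have hy0 := hm.trans_le hy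
    rw [← Real.log_div hx0.ne' hy0.ne']
    refine (Real.log_le_sub_one_of_pos (div_pos hx0 hy0)).trans ?_
    have e : x / y - 1 = (x - y) / y := by field_simp
    rw [e]
    calc (x - y) / y ≤ |x - y| / y := by gcongr; exact le_abs_self _
      _ ≤ |x - y| / m := by gcongr
  rw [abs_le]
  have h1 := key hx hy
  have h2 := key hy hx
  rw [abs_sub_comm] at h2
  exact ⟨by linarith, h1⟩

theorem exists_ball_subset_enlargement (β : ℝ) :
    ∃ r, 0 < r ∧ ∀ z ∈ closure (domain β), Metric.ball z r ⊆ enlargement β := by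
  have hpi := Real.pi_gt_three
  set m := Real.exp (-(β - Real.pi / 2) / 2) with hm
  have hm0 : 0 < m := Real.exp_pos _
  -- `Im z₁` moves by at most `1/4` and `log |z₂|` by at most `(m/16)/(m/2) = 1/8`. The defining
  -- quantities thus change by at most `1/2`, less than the margin `π/4`.
  refine ⟨min (1 / 4) (m / 16), by positivity, fun z hz w hw => ?_⟩
  obtain ⟨h0, h1, h2⟩ := closure_domain_subset hz
  rw [Metric.mem_ball, Prod.dist_eq, max_lt_iff, lt_min_iff, lt_min_iff, dist_eq_norm,
    dist_eq_norm] at hw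
  obtain ⟨⟨hw1, -⟩, -, hw2⟩ := hw
  rw [Real.log_pow, Nat.cast_ofNat] at h1 h2
  have hz2 : m ≤ ‖z.2‖ := by
    rw [hm, ← Real.le_log_iff_exp_le (norm_pos_iff.2 h0)]
    linarith [(abs_le.1 h2).1]
  have hd : |‖w.2‖ - ‖z.2‖| ≤ m / 16 := (abs_norm_sub_norm_le _ _).trans hw2.le
  have hw2' : m / 2 ≤ ‖w.2‖ := by linarith [(abs_le.1 hd).1]
  have hlog := abs_log_sub_log_le (by positivity : 0 < m / 2) hw2' (by linarith : m / 2 ≤ ‖z.2‖)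
  have hlog' : |Real.log ‖w.2‖ - Real.log ‖z.2‖| ≤ 1 / 8 := by
    refine hlog.trans ?_
    rw [div_le_iff₀ (by positivity)]
    linarith
  have him : |w.1.im - z.1.im| ≤ 1 / 4 := by
    rw [← Complex.sub_im]
    exact (Complex.abs_im_le_norm _).trans hw1.le
  refine ⟨norm_pos_iff.1 (lt_of_lt_of_le (by positivity) hw2'), ?_, ?_⟩ <;>
    rw [Real.log_pow, Nat.cast_ofNat] <;>
    rw [abs_lt] <;> rw [abs_le] at h1 h2 hlog' him <;>
    constructor <;> linarith

theorem conjPair_conjPair (z : ℂ × ℂ) : conjPair (conjPair z) = z := by simp [conjPair]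

theorem dist_conjPair (z w : ℂ × ℂ) : dist (conjPair z) (conjPair w) = dist z w := by
  simp only [conjPair, Prod.dist_eq, Complex.dist_conj_conj]

/-- The polarization of `kernelPair`. -/
def polarizedPair (p : (ℂ × ℂ) × (ℂ × ℂ)) : ℂ × ℂ := (p.1.1 - p.2.1, p.1.2 * p.2.2)

theorem kernelPair_conjPair (p : (ℂ × ℂ) × (ℂ × ℂ)) :
    kernelPair p.1 (conjPair p.2) = polarizedPair p := by
  simp [kernelPair, tau, conjPair, polarizedPair]

theorem polarizedPair_mem_region {p : (ℂ × ℂ) × (ℂ × ℂ)} (h1 : p.1 ∈ enlargement β)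
    (h2 : conjPair p.2 ∈ enlargement β) :
    polarizedPair p ∈ region (β - Real.pi / 2) (Real.pi / 4) := by
  rw [← kernelPair_conjPair]
  exact kernelPair_mem_region h1 h2 (by ring) rfl

theorem IsGood.holAntihol {φ : ℂ × ℂ → ℂ} (hφ : IsGood (β - Real.pi / 2) φ) :
    HolAntihol (enlargement β) fun w z => φ (kernelPair w z) := by
  have e : polarized (fun w z => φ (kernelPair w z)) = fun p => φ (polarizedPair p) := by
    ext p
    rw [polarized, kernelPair_conjPair]
  rw [HolAntihol, e]
  refine hφ.1.comp (f := polarizedPair) ?_ fun p hp => polarizedPair_mem_region hp.1 hp.2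
  unfold polarizedPair
  fun_prop

/-- The same radius works at every pair of points of the closure, so Cauchy estimates bound the
derivatives on the whole closure and the threshold `0` suffices. -/
theorem IsGood.boundedAtInfinity {φ : ℂ × ℂ → ℂ} (hφ : IsGood (β - Real.pi / 2) φ) :
    BoundedAtInfinity β fun w z => φ (kernelPair w z) := by
  intro n
  obtain ⟨r, hr, hball⟩ := exists_ball_subset_enlargement β
  obtain ⟨C, hC⟩ := hφ.2
  obtain ⟨C', hC'⟩ := exists_bound_iteratedFDeriv (E := (ℂ × ℂ) × (ℂ × ℂ)) n hr C
  refine ⟨C', 0, fun w hw z hz _ => ?_⟩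
  have hsub : ∀ q ∈ Metric.ball (w, conjPair z) r,
      q.1 ∈ enlargement β ∧ conjPair q.2 ∈ enlargement β := by
    intro q hq
    rw [Metric.mem_ball, Prod.dist_eq, max_lt_iff] at hq
    refine ⟨hball w hw hq.1, hball z hz ?_⟩
    rw [Metric.mem_ball, ← dist_conjPair, conjPair_conjPair]
    exact hq.2
  refine hC' _ _ (hφ.holAntihol.mono fun q hq => hsub q hq) fun q hq => ?_
  rw [polarized, kernelPair_conjPair]
  exact hC _ (polarizedPair_mem_region (hsub q hq).1 (hsub q hq).2)

theorem isGood_pullback {φ : ℂ × ℂ → ℂ} (hφ : IsGood (β - Real.pi / 2) φ) :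
    HolAntihol (enlargement β) (fun w z => φ (kernelPair w z)) ∧
      BoundedAtInfinity β fun w z => φ (kernelPair w z) :=
  ⟨hφ.holAntihol, hφ.boundedAtInfinity⟩

theorem closure_domain_subset_enlargement (β : ℝ) : closure (domain β) ⊆ enlargement β := by
  obtain ⟨r, hr, h⟩ := exists_ball_subset_enlargement β
  exact fun z hz => h z hz (Metric.mem_ball_self hr)

end Neighbourhood

/-! ### Assembly of the expansion -/

theorem sum_singularFactor (b : ℝ) (g : Fin 9 → ℂ × ℂ → ℂ) (p : ℂ × ℂ) :
    ∑ i, g i p * singularFactor b i p =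
      g 0 p / (pairLin (2 * b + Real.pi) p * pairExp b p) +
      g 1 p / (pairQ p * pairLin (2 * b + Real.pi) p) +
      g 2 p / (pairP p * pairExp b p) +
      g 3 p / (pairP p * pairLin (-(2 * b + Real.pi)) p) +
      g 4 p / (pairLin (-(2 * b + Real.pi)) p * pairExp (-b) p) +
      g 5 p / (pairQ p * pairExp (-b) p) + g 6 p / pairP p + g 7 p / pairQ p + g 8 p := by
  rw [Fin.sum_univ_castSucc, Fin.sum_univ_eight]
  simp [singularFactor, div_eq_mul_inv]

/-- The unshifted integrand is even, so the Fourier integral is invariant under `flip`. Applying the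
expansion at `flip p` reverses the sign of `τ` in the exponentials, and both classes of functions
are stable under this. -/
theorem exists_kernel_form {b ν h : ℝ} (hb : Real.pi / 2 < b) (hν : 2 * b * ν = Real.pi)
    (h1 : ν / 2 < h) (h2 : h < 1 / 2) (h3 : h < 3 * ν / 2) {ε : ℝ} (hε : ε = 1 ∨ ε = -1) :
    ∃ F G, HasPoles b F ∧ HasForm b G ∧ ∀ p ∈ region b 0,
      coneSum (lineSech Real.pi 0) (lineSech b 0) p =
        Complex.exp (-(ε * p.1 * ν / 2)) * F p + Complex.exp (-(ε * p.1 * h)) * G p := by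
  obtain ⟨F, G, hF, hG, he⟩ := exists_coneSum_eq hb hν h1 h2 h3
  rcases hε with rfl | rfl
  · refine ⟨F, G, hF, hG, fun p hp => ?_⟩
    rw [he p hp, Complex.ofReal_one, one_mul]
  · refine ⟨_, _, hF.comp_flip, hG.comp_flip, fun p hp => ?_⟩
    have hsym : ∀ k x : ℝ, lineSech k 0 (-x) = lineSech k 0 x := fun k x => by
      rw [lineSech_neg, neg_zero]
    rw [← coneSum_flip (hsym _) (hsym _), he _ (flip_mem_region hp)]
    simp [flip]

end Worm

theorem theorem1p2 (β : ℝ) (hβ : Real.pi < β) (ν : ℝ) (hν : ν = Real.pi / (2 * β - Real.pi))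
    (h : ℝ) (h_lower : ν / 2 < h) (h_upper : h < min (1 / 2) (3 * ν / 2)) :
    (∃ S : ℂ × ℂ → ℂ × ℂ → ℂ, Worm.IsSzegoKernel β S) ∧
    ∀ S : ℂ × ℂ → ℂ × ℂ → ℂ, Worm.IsSzegoKernel β S →
      ∀ ε : ℝ, ε = 1 ∨ ε = -1 →
        ∃ U : Set (ℂ × ℂ), IsOpen U ∧ closure (Worm.domain β) ⊆ U ∧
        ∃ ρ₁ ρ₂ G₁ G₂ G₃ G₄ G₅ G₆ G₇ G₈ E E' : ℂ × ℂ → ℂ × ℂ → ℂ,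
          (∀ f ∈ [ρ₁, ρ₂, G₁, G₂, G₃, G₄, G₅, G₆, G₇, G₈, E, E'],
            Worm.HolAntihol U f ∧ Worm.BoundedAtInfinity β f) ∧
          ∀ w ∈ Worm.domain β, ∀ z ∈ Worm.domain β, 0 ≤ ε * (Worm.tau w z).re →
            S w z =
              Complex.exp (-(ε * Worm.tau w z * ν / 2)) *
                (ρ₁ w z / Worm.denP w z + ρ₂ w z / Worm.denQ w z + E w z) +
              Complex.exp (-(ε * Worm.tau w z * h)) *
                (G₁ w z / (Worm.denLin (2 * β) w z * Worm.denExp (β - Real.pi / 2) w z) +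
                  G₂ w z / (Worm.denQ w z * Worm.denLin (2 * β) w z) +
                  G₃ w z / (Worm.denP w z * Worm.denExp (β - Real.pi / 2) w z) +
                  G₄ w z / (Worm.denP w z * Worm.denLin (-(2 * β)) w z) +
                  G₅ w z / (Worm.denLin (-(2 * β)) w z * Worm.denExp (-(β - Real.pi / 2)) w z) +
                  G₆ w z / (Worm.denQ w z * Worm.denExp (-(β - Real.pi / 2)) w z) +
                  G₇ w z / Worm.denP w z + G₈ w z / Worm.denQ w z + E' w z) := by
  have hpi := Real.pi_pos
  refine ⟨⟨_, Worm.isSzegoKernel_szegoKernel (by linarith)⟩, fun S hS ε hε => ?_⟩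
  have hb : Real.pi / 2 < β - Real.pi / 2 := by linarith
  have hν' : 2 * (β - Real.pi / 2) * ν = Real.pi := by
    have : 2 * β - Real.pi ≠ 0 := by linarith
    rw [hν]
    field_simp
  obtain ⟨F, G, hF, hG, hFG⟩ := Worm.exists_kernel_form hb hν' h_lower
    (h_upper.trans_le (min_le_left _ _)) (h_upper.trans_le (min_le_right _ _)) hε
  -- The constant `1/(8π)` is absorbed into the coefficients.
  obtain ⟨ρ₁, ρ₂, e, h1, h2, h3, hF'⟩ :=
    hF.mul_good (Worm.isGood_const (β - Real.pi / 2) (8 * (Real.pi : ℂ))⁻¹)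
  obtain ⟨g, hg, hG'⟩ := hG.const_mul (8 * (Real.pi : ℂ))⁻¹
  refine ⟨Worm.enlargement β, Worm.isOpen_subdomain _ _,
    Worm.closure_domain_subset_enlargement β,
    fun w z => ρ₁ (Worm.kernelPair w z), fun w z => ρ₂ (Worm.kernelPair w z),
    fun w z => g 0 (Worm.kernelPair w z), fun w z => g 1 (Worm.kernelPair w z),
    fun w z => g 2 (Worm.kernelPair w z), fun w z => g 3 (Worm.kernelPair w z),
    fun w z => g 4 (Worm.kernelPair w z), fun w z => g 5 (Worm.kernelPair w z),
    fun w z => g 6 (Worm.kernelPair w z), fun w z => g 7 (Worm.kernelPair w z),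
    fun w z => e (Worm.kernelPair w z), fun w z => g 8 (Worm.kernelPair w z), ?_, ?_⟩
  · simp only [List.forall_mem_cons]
    exact ⟨Worm.isGood_pullback h1, Worm.isGood_pullback h2, Worm.isGood_pullback (hg 0),
      Worm.isGood_pullback (hg 1), Worm.isGood_pullback (hg 2), Worm.isGood_pullback (hg 3),
      Worm.isGood_pullback (hg 4), Worm.isGood_pullback (hg 5), Worm.isGood_pullback (hg 6),
      Worm.isGood_pullback (hg 7), Worm.isGood_pullback h3, Worm.isGood_pullback (hg 8),
      fun _ hf => absurd hf List.not_mem_nil⟩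
  · intro w hw z hz _
    have hp := Worm.kernelPair_mem_region_zero hw hz
    have e1 := hF' _ hp
    have e2 := hG' _ hp
    rw [Worm.sum_singularFactor] at e2
    simp only at e1 e2
    rw [hS.eq_szegoKernel (by linarith) hw hz, Worm.szegoKernel_eq_coneSum hβ hw hz, hFG _ hp,
      mul_add, mul_left_comm, mul_left_comm _ (Complex.exp (-(ε * (Worm.kernelPair w z).1 * h))),
      e1, e2, show 2 * (β - Real.pi / 2) + Real.pi = 2 * β by ring]
    -- The denominators of the statement are by definition `pairP`, `pairQ`, `pairExp` and `pairLin`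
    -- at `kernelPair w z`; division by `denP` and `denQ` in the first group unfolds to
    -- multiplication by inverses.
    rfl
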